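/- Let $0\le l\le k$ be integers and put $A_{p,q}=2\min(p,q)+\max(p+q-k,0)$. **Configurations.** A finite configuration is a finitely supported family $\mathbf a=(a_i)_{i\in\mathbb Z}$ of non-negative integers; put $S[i,\mathbf a]=a_i+a_{i+1}$ and $L[i,\mathbf a]=a_{i-1}+2a_i+2a_{i+1}+a_{i+2}$. Let $C^{(k,l)}$ be the set of finite configurations such that, for all $i$, $a_i+a_{i+1}+a_{i+2}\le k$, $S[i,\mathbf a]\le l$ and $L[i,\mathbf a]\le k+l$. Let $C^{(k,l)}_{\rm pos}$ be the set of $\mathbf a\in C^{(k,l)}$ with $a_i=0$ for all $i<0$. **Rigged partitions.** Let $R^{(l)}$ be the set of pairs $(\lambda,\rho)$ with $\lambda=(\lambda_1\ge\dots\ge\lambda_n>0)$, $n\ge 0$, $\lambda_1\le l$ (if $n\geq 1$), and $\rho\in\mathbb Z^n$ such that $\rho_i\ge\rho_{i+1}$ whenever $\lambda_i=\lambda_{i+1}$. Let $R^{(l)}_{\rm pos}$ be the subset where all $\rho_i\ge 0$. **The map $\iota$.** Put $\iota(\mathbf 0)=\emptyset$. For $\mathbf a\ne\mathbf 0$ let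 $p$ be the least integer with $\mathbf a\in C^{(k,p)}$. The right move $M_+$ changes $(a_i,a_{i+1})$ into $(a_i-1,a_{i+1}+1)$, where $i$ is the largest integer with $S[i,\mathbf a]=p$ or $L[i,\mathbf a]=k+p$ (the highest position of a particle of weight $p$). Let $i_0$ be such that $a_{i_0-1}\neq0$ and $a_j=0$ for all $j\ge i_0$, and let $t_0\ge0$ be the least integer such that this property (with the same $i_0$) fails for $M_+^{t_0+1}\mathbf a$. Let $\mathbf b=M_+^{t_0}\mathbf a$, let $i$ be the highest position of a particle of weight $p$ in $\mathbf b$, and put $s=i\,b_i+(i+1)b_{i+1}-t_0$. Let $\bar{\mathbf a}$ agree with $\mathbf b$ at the indices $\le i_0-2$ and be $0$ elsewhere, and let $((\lambda_2,\dots,\lambda_n),(\rho_2,\dots,\rho_n))=\iota(\bar{\mathbf a})$, which is defined by recursion on $\sum_i a_i$. Then $\iota(\mathbf a)=(\lambda,\rho)$ with $\lambda_1=p$ and $\rho_1=s-\sum_{j=2}^{n}A_{\lambda_1,\lambda_j}$. **The map $\kappa$.** It is defined on $R^{(l)}$ by recursion on $l$, with $\kappa(\emptyset)=\mathbf 0$.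 Let $l\geq 1$. The positions $j_1,j_2,\dots$ of the particles of weight $l$ in a configuration $\mathbf a$, counted from the left, are found as follows: $j_1$ is the least integer $j$ with $S[j,\mathbf a]=l$ or $L[j,\mathbf a]=k+l$; replace $a_i$ by $0$ for all $i\le j_1+1$, and repeat to find $j_2$, and so on. The left move $M_-^{(c)}$ changes $(a_{j_c},a_{j_c+1})$ into $(a_{j_c}+1,a_{j_c+1}-1)$. Given $(\lambda,\rho)\in R^{(l)}$ with exactly $m$ parts equal to $l$, let $\bar{\mathbf a}=\kappa((\lambda_i)_{i>m},(\rho_i)_{i>m})$ be the configuration obtained from the rest, an element of $R^{(l-1)}$. For $1\le i\le m$ put $s_i=\rho_i+\sum_{j>i}A_{l,\lambda_j}$, and for $t\ge0$ put $d_i=s_i+t$. Let $\mathbf b$ be $\bar{\mathbf a}$ plus, for each $i\le m$, a free particle of weight $l$ and energy $d_i$, that is, the configuration with entries $c$ and $l-c$ at positions $j$ and $j+1$ and $0$ elsewhere, where $j\in\mathbb Z$ and $1\le c\le l$ are determined by $jc+(j+1)(l-c)=d_i$. Then $\kappa(\lambda,\rho)=(M_-^{(m)}\cdots M_-^{(1)})^t\,\mathbf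 b$ for all sufficiently large $t$. **Theorem.** The map $\iota$ restricts to a bijection $C^{(k,l)}_{\rm pos}\to R^{(l)}_{\rm pos}$, the map $\kappa$ restricts to a bijection $R^{(l)}_{\rm pos}\to C^{(k,l)}_{\rm pos}$, and these two bijections are inverse to each other. -/

import Mathlib

open Filter

noncomputable section

namespace RiggedConf

/-- A finite configuration `(a_i)_{i ∈ ℤ}` of non-negative integers. -/
abbrev Conf : Type := ℤ →₀ ℕ

/-- The length `|a| = ∑ a_i`. -/
def length (a : Conf) : ℕ := a.sum fun _ n => n

/-- `S[j, a] = a_j + a_{j+1}`. -/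
def S (a : Conf) (j : ℤ) : ℕ := a j + a (j + 1)

/-- `L[j, a] = a_{j-1} + 2 a_j + 2 a_{j+1} + a_{j+2}`. -/
def L (a : Conf) (j : ℤ) : ℕ := a (j - 1) + 2 * a j + 2 * a (j + 1) + a (j + 2)

/-- The set `C^{(k,l)}` of finite `(k,3)`-admissible configurations of maximal weight
at most `l`. -/
def C (k l : ℕ) : Set Conf :=
  {a | (∀ i, a i + a (i + 1) + a (i + 2) ≤ k) ∧ (∀ i, S a i ≤ l) ∧ (∀ i, L a i ≤ k + l)}

/-- The positively supported configurations in `C^{(k,l)}`. -/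
def CPos (k l : ℕ) : Set Conf := {a | a ∈ C k l ∧ ∀ i < 0, a i = 0}

/-- A partition `λ` with a rigging `ρ`, written as the list of the pairs `(λ_i, ρ_i)`. -/
abbrev RiggedList : Type := List (ℕ × ℤ)

/-- The set `R^{(l)}` of rigged partitions: `l ≥ λ_1 ≥ ⋯ ≥ λ_n > 0`, and
`ρ_i ≥ ρ_{i+1}` whenever `λ_i = λ_{i+1}`. -/
def R (l : ℕ) : Set RiggedList :=
  {r | (∀ p ∈ r, 0 < p.1 ∧ p.1 ≤ l) ∧
    r.IsChain fun p q => q.1 ≤ p.1 ∧ (p.1 = q.1 → q.2 ≤ p.2)}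

/-- The rigged partitions in `R^{(l)}` with non-negative riggings. -/
def RPos (l : ℕ) : Set RiggedList := {r | r ∈ R l ∧ ∀ p ∈ r, 0 ≤ p.2}

/-- `A_{l,l'} = 2 min(l,l') + (l + l' - k)_+`; the truncated subtraction of natural numbers
is the positive part. -/
def A (k l l' : ℕ) : ℕ := 2 * min l l' + (l + l' - k)

/-- The condition `S[i, a] = l` or `L[i, a] = k + l` locating a particle of weight `l`. -/
def HasParticle (k l : ℕ) (a : Conf) (i : ℤ) : Prop := S a i = l ∨ L a i = k + l

/-! ### Right moves and the map `ι` -/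

/-- The `l` such that `a` lies in `C^{(k,l)}` and not in `C^{(k,l-1)}`. -/
def weight (k : ℕ) (a : Conf) : ℕ := sInf {l | a ∈ C k l}

/-- The highest position `i_1` of a particle of weight `l`. -/
def highestPos (k l : ℕ) (a : Conf) : ℤ := sSup {i | HasParticle k l a i}

/-- The right move `M_+`: it changes `(a_i, a_{i+1})` into `(a_i - 1, a_{i+1} + 1)` at the
highest position `i` of a particle of weight `l`. -/
def rightMove (k l : ℕ) (a : Conf) : Conf :=
  a - Finsupp.single (highestPos k l a) 1 + Finsupp.single (highestPos k l a + 1) 1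

/-- The integer `i₀` with `a_{i₀-1} ≠ 0` and `a_j = 0` for all `j ≥ i₀` (for `a ≠ 0`). -/
def rightEnd (a : Conf) : ℤ := sSup {i | a i ≠ 0} + 1

/-- The `t₀` such that `b_{i₀-1} ≠ 0`, `b_j = 0 (j ≥ i₀)` breaks down for the first time in the
move from `M_+^{t₀} a` to `M_+^{t₀+1} a`, where `i₀` is the right end of `a`. -/
def breakTime (k l : ℕ) (a : Conf) : ℕ :=
  sInf {t | ¬ (((rightMove k l)^[t + 1] a) (rightEnd a - 1) ≠ 0 ∧
    ∀ j ≥ rightEnd a, ((rightMove k l)^[t + 1] a) j = 0)}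

/-- The configuration `M_+^{t₀} a`, whose highest particle of weight `l` is free. -/
def freed (k l : ℕ) (a : Conf) : Conf := (rightMove k l)^[breakTime k l a] a

/-- The configuration left when the free particle of weight `l` is removed from `M_+^{t₀} a`. -/
def removed (k l : ℕ) (a : Conf) : Conf :=
  (freed k l a).filter fun i => i ≤ rightEnd a - 2

/-- `s = d - t₀`, where `d = i b_i + (i+1) b_{i+1}` is the energy of the free particle, at the
position `i`, of `b = M_+^{t₀} a`. -/
def shiftedEnergy (k l : ℕ) (a : Conf) : ℤ :=
  let b := freed k l a
  let i := highestPos k l b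
  i * (b i : ℤ) + (i + 1) * (b (i + 1) : ℤ) - (breakTime k l a : ℤ)

/-- Particle content and rigging, with a bound `n` on the number of particles removed. -/
def iotaAux (k : ℕ) : ℕ → Conf → RiggedList
  | 0, _ => []
  | n + 1, a =>
    open Classical in
    if a = 0 then [] else
      let l := weight k a
      let r := iotaAux k n (removed k l a)
      (l, shiftedEnergy k l a - (r.map fun p => (A k l p.1 : ℤ)).sum) :: r

/-- The map `ι`: particle content and rigging. Removing a particle of weight `l ≥ 1` lowers the
length by `l`, so that there are at most `|a|` removals. -/
def iota (k : ℕ) (a : Conf) : RiggedList := iotaAux k (length a) a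

/-! ### Left moves and the map `κ` -/

/-- The lowest position `j_1` of a particle of weight `l`. -/
def lowestPos (k l : ℕ) (a : Conf) : ℤ := sInf {j | HasParticle k l a j}

/-- The cut-off from the left at `j_1 + 1`. -/
def cutLeft (k l : ℕ) (a : Conf) : Conf := a.filter fun i => lowestPos k l a + 2 ≤ i

/-- The position `j_{c+1}` of the `(c+1)`-st particle of weight `l` counted from the left. -/
def leftPos (k l c : ℕ) (a : Conf) : ℤ := lowestPos k l ((cutLeft k l)^[c] a)

/-- The move `M_-^{(c+1)}`: it changes `(a_j, a_{j+1})` into `(a_j + 1, a_{j+1} - 1)` at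
`j = j_{c+1}`. -/
def leftMove (k l c : ℕ) (a : Conf) : Conf :=
  a - Finsupp.single (leftPos k l c a + 1) 1 + Finsupp.single (leftPos k l c a) 1

/-- The composition `M_-^{(m)} ⋯ M_-^{(1)}`, in which `M_-^{(1)}` acts first. -/
def leftSweep (k l : ℕ) : ℕ → Conf → Conf
  | 0, a => a
  | m + 1, a => leftMove k l m (leftSweep k l m a)

/-- The free particle of weight `l` and energy `d`: `c` at `j` and `l - c` at `j + 1`, where
`1 ≤ c ≤ l` and `j c + (j+1) (l-c) = d`, that is, `j = ⌊d/l⌋` and `l - c = d mod l`. -/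
def freeParticle (l : ℕ) (d : ℤ) : Conf :=
  Finsupp.single (d / (l : ℤ)) (l - (d % (l : ℤ)).toNat) +
    Finsupp.single (d / (l : ℤ) + 1) (d % (l : ℤ)).toNat

/-- The sum of the free particles of weight `l` and energies `d_i = s_i + t` for the first `m`
entries of `r = (λ, ρ)`, where `s_i = ρ_i + ∑_{j > i} A_{l, λ_j}`. -/
def freeParticles (k l : ℕ) (t : ℤ) : ℕ → RiggedList → Conf
  | 0, _ => 0
  | _ + 1, [] => 0
  | m + 1, p :: r =>
    freeParticle l (p.2 + (r.map fun q => (A k l q.1 : ℤ)).sum + t) + freeParticles k l t m r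

open Classical in
/-- The value of `f t` for all sufficiently large `t` (and `0` if there is no such value). -/
def eventualValue (f : ℕ → Conf) : Conf :=
  if h : ∃ b, ∀ᶠ t in atTop, f t = b then h.choose else 0

/-- The number of parts of `r` that are equal to `l`. -/
def mult (l : ℕ) (r : RiggedList) : ℕ := r.countP fun p => p.1 = l

/-- The map `κ` on `R^{(l)}`, by recursion on `l`: drop the `m` parts equal to `l`, apply `κ` on
`R^{(l-1)}`, add `m` free particles of weight `l` at the energies `s_i + t` for `t` large, and
apply `(M_-^{(m)} ⋯ M_-^{(1)})^t`. -/
def kappa (k : ℕ) : ℕ → RiggedList → Conf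
  | 0, _ => 0
  | l + 1, r =>
    let m := mult (l + 1) r
    eventualValue fun t =>
      (leftSweep k (l + 1) m)^[t]
        (kappa k l (r.drop m) + freeParticles k (l + 1) (t : ℤ) m r)

end RiggedConf

end

open Filter

namespace RiggedConf

variable {k l : ℕ} {i j s σ : ℤ} {a b c : Conf}

/-! ### Elementary moves -/

/-! The inequalities for S and L that are sharp at weight l mark particles of weight l. A right move
at the highest such position keeps the configuration admissible (`C_of_mv`) and is injective
(`rightMove_inj`). Under repeated right moves the last particle eventually runs off to the right as
a free particle. `Detach` records this: up to a free particle of energy σ + t, the configuration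
after t moves is a fixed remainder b. The pair (b, σ) is determined by a (`Detach.unique`), and a is
determined by (b, σ) (`Detach.inj`). Hence ι, which reads off σ and recurses on b, is injective.

The values of ι are rigged partitions because consecutive particles of equal weight satisfy σ' +
A_{l,l} ≤ σ (`Detach.add_A_le`). The last two particles can be pushed right together until the
second one is free. Two free particles at distance exactly A_{l,l} have no preimage under the right
move, so they cannot have been closer.

The map κ is a right inverse of ι because a left sweep is compatible with detaching: sweeping all m
+ 1 particles of a amounts to sweeping the m particles of b and lowering σ by one (`Detach.sweep`).
So t sweeps undo the shift by t of all the free energies, and the result does not depend on large t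
(`exists_sweep_freeParticles`, `kappa_spec`). Together with injectivity of ι this makes the maps
mutually inverse on all admissible configurations.

It remains to match non-negative support with non-negative riggings (`nonnegSupp_iff`). At the
moment when the particle of weight p enters the non-negative sites it sits entirely at the site 0,
and everything else consists of lighter particles. Following it through them (`Phase`) gives a
shifted energy of 2|b| + |θ|, where θ is the overlap of b with the passing particle. The length of θ
is unchanged by the right moves of lighter particles, and each lighter particle of weight q that is
removed takes (p + q - k)_+ from it. So 2|b| + |θ| equals the sum of the A_{p,q}
(`IsOverlap.sum_A_eq`), and entering happens exactly at rigging 0. -/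

/-- `b` arises from `a` by moving one unit from the site `i` to the site `i + 1`. -/
def Mv (i : ℤ) (a b : Conf) : Prop :=
  a + Finsupp.single (i + 1) 1 = b + Finsupp.single i 1

theorem Mv.apply_self (h : Mv i a b) : a i = b i + 1 := by
  have := DFunLike.congr_fun h i
  simpa using this

theorem Mv.apply_succ (h : Mv i a b) : b (i + 1) = a (i + 1) + 1 := by
  have := DFunLike.congr_fun h (i + 1)
  simpa using this.symm

theorem Mv.apply_of_ne (h : Mv i a b) (h1 : j ≠ i) (h2 : j ≠ i + 1) : b j = a j := by
  have := DFunLike.congr_fun h j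
  simpa [Finsupp.single_apply, h1.symm, h2.symm] using this.symm

theorem Mv.left_unique (h : Mv i a c) (h' : Mv i b c) : a = b :=
  add_right_cancel (h.trans h'.symm)

theorem Mv.right_unique (h : Mv i a b) (h' : Mv i a c) : b = c :=
  add_right_cancel (h.symm.trans h')

theorem mv_right (h : 1 ≤ a i) : Mv i a (a - Finsupp.single i 1 + Finsupp.single (i + 1) 1) := by
  ext n
  simp only [Finsupp.add_apply, Finsupp.tsub_apply, Finsupp.single_apply]
  split_ifs <;> subst_vars <;> omega

theorem mv_left (h : 1 ≤ a (i + 1)) :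
    Mv i (a - Finsupp.single (i + 1) 1 + Finsupp.single i 1) a := by
  ext n
  simp only [Finsupp.add_apply, Finsupp.tsub_apply, Finsupp.single_apply]
  split_ifs <;> subst_vars <;> omega

/-- The values of `S` and `L` around `i` in terms of the entries. -/
theorem values (a : Conf) (i : ℤ) :
    (S a (i - 4) = a (i - 4) + a (i - 3) ∧ S a (i - 3) = a (i - 3) + a (i - 2) ∧
      S a (i - 2) = a (i - 2) + a (i - 1) ∧ S a (i - 1) = a (i - 1) + a i ∧
      S a i = a i + a (i + 1) ∧ S a (i + 1) = a (i + 1) + a (i + 2) ∧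
      S a (i + 2) = a (i + 2) + a (i + 3) ∧ S a (i + 3) = a (i + 3) + a (i + 4) ∧
      S a (i + 4) = a (i + 4) + a (i + 5)) ∧
    (L a (i - 3) = a (i - 4) + 2 * a (i - 3) + 2 * a (i - 2) + a (i - 1) ∧
      L a (i - 2) = a (i - 3) + 2 * a (i - 2) + 2 * a (i - 1) + a i ∧
      L a (i - 1) = a (i - 2) + 2 * a (i - 1) + 2 * a i + a (i + 1) ∧
      L a i = a (i - 1) + 2 * a i + 2 * a (i + 1) + a (i + 2) ∧
      L a (i + 1) = a i + 2 * a (i + 1) + 2 * a (i + 2) + a (i + 3) ∧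
      L a (i + 2) = a (i + 1) + 2 * a (i + 2) + 2 * a (i + 3) + a (i + 4) ∧
      L a (i + 3) = a (i + 2) + 2 * a (i + 3) + 2 * a (i + 4) + a (i + 5)) := by
  simp only [S, L]
  ring_nf
  simp

theorem L_eq_add (a : Conf) (i : ℤ) : L a i = S a (i - 1) + S a i + S a (i + 1) := by
  have := values a i
  omega

/-- The inequalities of `C^{(k,l)}` around `i`. -/
theorem bounds (ha : a ∈ C k l) (i : ℤ) :
    (a (i - 4) + a (i - 3) + a (i - 2) ≤ k ∧ a (i - 3) + a (i - 2) + a (i - 1) ≤ k ∧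
      a (i - 2) + a (i - 1) + a i ≤ k ∧ a (i - 1) + a i + a (i + 1) ≤ k ∧
      a i + a (i + 1) + a (i + 2) ≤ k ∧ a (i + 1) + a (i + 2) + a (i + 3) ≤ k ∧
      a (i + 2) + a (i + 3) + a (i + 4) ≤ k) ∧
    (S a (i - 3) ≤ l ∧ S a (i - 2) ≤ l ∧ S a (i - 1) ≤ l ∧ S a i ≤ l ∧
      S a (i + 1) ≤ l ∧ S a (i + 2) ≤ l ∧ S a (i + 3) ≤ l) ∧
    (L a (i - 3) ≤ k + l ∧ L a (i - 2) ≤ k + l ∧ L a (i - 1) ≤ k + l ∧ L a i ≤ k + l ∧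
      L a (i + 1) ≤ k + l ∧ L a (i + 2) ≤ k + l ∧ L a (i + 3) ≤ k + l) := by
  obtain ⟨h1, h2, h3⟩ := ha
  have e1 := h1 (i - 4)
  have e2 := h1 (i - 3)
  have e3 := h1 (i - 2)
  have e4 := h1 (i - 1)
  have e5 := h1 i
  have e6 := h1 (i + 1)
  have e7 := h1 (i + 2)
  ring_nf at e1 e2 e3 e4 e5 e6 e7
  refine ⟨?_, ⟨h2 _, h2 _, h2 _, h2 _, h2 _, h2 _, h2 _⟩,
    h3 _, h3 _, h3 _, h3 _, h3 _, h3 _, h3 _⟩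
  ring_nf
  omega

theorem C_mono {l' : ℕ} (h : l ≤ l') (ha : a ∈ C k l) : a ∈ C k l' :=
  ⟨ha.1, fun i => (ha.2.1 i).trans h, fun i => (ha.2.2 i).trans (by omega)⟩

theorem C_of_le (ha : a ∈ C k l) (h : b ≤ a) : b ∈ C k l := by
  obtain ⟨h1, h2, h3⟩ := ha
  refine ⟨fun i => ?_, fun i => ?_, fun i => ?_⟩
  · have := h1 i; have := h i; have := h (i + 1); have := h (i + 2); omega
  · have := h2 i; have := h i; have := h (i + 1); unfold S at *; omega
  · have := h3 i; have := h (i - 1); have := h i; have := h (i + 1); have := h (i + 2)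
    unfold L at *; omega

theorem Mv.S_pred (h : Mv i a b) : S a (i - 1) = S b (i - 1) + 1 := by
  have := values a i; have := values b i
  have := h.apply_self; have := h.apply_of_ne (j := i - 1) (by omega) (by omega); omega

theorem Mv.S_succ (h : Mv i a b) : S b (i + 1) = S a (i + 1) + 1 := by
  have := values a i; have := values b i
  have := h.apply_succ; have := h.apply_of_ne (j := i + 2) (by omega) (by omega); omega

theorem Mv.S_of_ne (h : Mv i a b) (h1 : j ≠ i - 1) (h2 : j ≠ i + 1) : S b j = S a j := by
  have e1 := h.apply_self; have e2 := h.apply_succ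
  unfold S
  by_cases hj : j = i
  · subst hj; omega
  · rw [h.apply_of_ne hj (by omega), h.apply_of_ne (j := j + 1) (by omega) (by omega)]

theorem Mv.L_eq (h : Mv i a b) : (L b (i - 2) + 1 = L a (i - 2) ∧ L b (i - 1) + 1 = L a (i - 1)) ∧
    (L b (i + 1) = L a (i + 1) + 1 ∧ L b (i + 2) = L a (i + 2) + 1) := by
  have := values a i; have := values b i
  have := h.apply_self; have := h.apply_succ
  have := h.apply_of_ne (j := i - 3) (by omega) (by omega)
  have := h.apply_of_ne (j := i - 2) (by omega) (by omega)
  have := h.apply_of_ne (j := i - 1) (by omega) (by omega)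
  have := h.apply_of_ne (j := i + 2) (by omega) (by omega)
  have := h.apply_of_ne (j := i + 3) (by omega) (by omega)
  have := h.apply_of_ne (j := i + 4) (by omega) (by omega)
  omega

theorem Mv.L_of_ne (h : Mv i a b) (h1 : j ≠ i - 2) (h2 : j ≠ i - 1) (h3 : j ≠ i + 1)
    (h4 : j ≠ i + 2) : L b j = L a j := by
  rw [L_eq_add, L_eq_add]
  by_cases hj : j = i
  · subst hj
    have := h.S_pred; have := h.S_succ
    rw [h.S_of_ne (j := j) (by omega) (by omega)]; omega
  · rw [h.S_of_ne (j := j - 1) (by omega) (by omega), h.S_of_ne (j := j) (by omega) (by omega),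
      h.S_of_ne (j := j + 1) (by omega) (by omega)]

/-- The move from `i` to `i + 1` may be made: `i` is the position of a particle of weight `l`,
and no inequality on its right is sharp. -/
structure ReadyR (k l : ℕ) (a : Conf) (i : ℤ) : Prop where
  hasParticle : HasParticle k l a i
  S_succ : S a (i + 1) < l
  L_succ : L a (i + 1) < k + l
  L_succ_succ : L a (i + 2) < k + l

/-- The move from `i + 1` to `i` may be made: `i` is the position of a particle of weight `l`,
and no inequality on its left is sharp. -/
structure ReadyL (k l : ℕ) (a : Conf) (i : ℤ) : Prop where
  hasParticle : HasParticle k l a i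
  S_pred : S a (i - 1) < l
  L_pred : L a (i - 1) < k + l
  L_pred_pred : L a (i - 2) < k + l

/-- If S is sharp at i, strictness of S at i + 1 gives a i > a (i + 2). If L is sharp at i, write it
as the triple sum starting at i - 1, plus a i, plus S at i + 1; the first is at most k and the last
is below l. -/
theorem ReadyR.pos (ha : a ∈ C k l) (h : ReadyR k l a i) : 1 ≤ a i := by
  have := values a i; have := bounds ha i
  obtain ⟨h1, h2, h3, h4⟩ := h
  unfold HasParticle at h1; omega

theorem ReadyL.pos (ha : a ∈ C k l) (h : ReadyL k l a i) : 1 ≤ a (i + 1) := by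
  have := values a i; have := bounds ha i
  obtain ⟨h1, h2, h3, h4⟩ := h
  unfold HasParticle at h1; omega

theorem C_of_mv (h : Mv i a b) (ha : a ∈ C k l) (hr : ReadyR k l a i) : b ∈ C k l := by
  obtain ⟨h1, h2, h3, h4⟩ := hr
  have e1 := h.apply_self; have e2 := h.apply_succ
  have := h.S_succ; have := h.S_pred; have := h.L_eq
  refine ⟨fun j => ?_, fun j => ?_, fun j => ?_⟩
  -- Only the triple starting at i + 1 grows. The particle forces the triple at i to be at least l,
  -- and L at i + 1 is the sum of the triples at i and i + 1; as it is below k + l, the triple at i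
  -- + 1 was below k.
  · by_cases hj : j = i + 1
    · subst hj
      have e3 := h.apply_of_ne (j := i + 2) (by omega) (by omega)
      have e4 := h.apply_of_ne (j := i + 3) (by omega) (by omega)
      rw [show i + 1 + 1 = i + 2 by ring, show i + 1 + 2 = i + 3 by ring]
      have := values a i; have := bounds ha i
      unfold HasParticle at h1; omega
    · have := ha.1 j
      by_cases hj1 : j = i
      · subst hj1
        have e3 := h.apply_of_ne (j := j + 2) (by omega) (by omega)
        omega
      by_cases hj2 : j = i - 1
      · subst hj2
        have e3 := h.apply_of_ne (j := i - 1) (by omega) (by omega)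
        simp only [show i - 1 + 1 = i by ring, show i - 1 + 2 = i + 1 by ring] at *
        omega
      by_cases hj3 : j = i - 2
      · subst hj3
        have e3 := h.apply_of_ne (j := i - 2) (by omega) (by omega)
        have e4 := h.apply_of_ne (j := i - 2 + 1) (by omega) (by omega)
        simp only [show i - 2 + 2 = i by ring] at *
        omega
      rw [h.apply_of_ne (j := j) (by omega) (by omega),
        h.apply_of_ne (j := j + 1) (by omega) (by omega),
        h.apply_of_ne (j := j + 2) (by omega) (by omega)]
      exact this
  · have := ha.2.1 j
    by_cases hj : j = i + 1
    · subst hj; omega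
    by_cases hj1 : j = i - 1
    · subst hj1; omega
    rw [h.S_of_ne hj1 hj]; exact this
  · have := ha.2.2 j
    by_cases hj : j = i + 1
    · subst hj; omega
    by_cases hj1 : j = i - 1
    · subst hj1; omega
    by_cases hj2 : j = i + 2
    · subst hj2; omega
    by_cases hj3 : j = i - 2
    · subst hj3; omega
    rw [h.L_of_ne hj3 hj1 hj hj2]; exact this

/-- The move lowers S at i - 1 and L at i - 1 and i - 2 by one, so none of them is sharp afterwards,
while S and L at i itself do not change. -/
theorem readyL_of_mv (h : Mv i a b) (ha : a ∈ C k l) (hr : HasParticle k l a i) :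
    ReadyL k l b i := by
  have := bounds ha i; have := h.S_pred; have := h.L_eq
  refine ⟨?_, by omega, by omega, by omega⟩
  unfold HasParticle at *
  rwa [h.S_of_ne (by omega) (by omega), h.L_of_ne (by omega) (by omega) (by omega) (by omega)]

/-! ### Reflection -/

/-- The reflection `i ↦ 1 - i` of the sites, under which a position `i` becomes `-i`. -/
def refl (a : Conf) : Conf := a.equivMapDomain (Equiv.subLeft 1)

@[simp] theorem refl_apply (a : Conf) (i : ℤ) : refl a i = a (1 - i) := by
  simp [refl, Finsupp.equivMapDomain_apply, neg_add_eq_sub]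

@[simp] theorem refl_refl (a : Conf) : refl (refl a) = a := by
  ext i; simp

theorem S_refl (a : Conf) (i : ℤ) : S (refl a) i = S a (-i) := by
  rw [S, S, refl_apply, refl_apply, show 1 - (i + 1) = -i by ring, show 1 - i = -i + 1 by ring]
  exact add_comm _ _

theorem L_refl (a : Conf) (i : ℤ) : L (refl a) i = L a (-i) := by
  rw [L_eq_add, L_eq_add, S_refl, S_refl, S_refl, show -(i - 1) = -i + 1 by ring,
    show -(i + 1) = -i - 1 by ring]
  ring

theorem refl_mem_C (ha : a ∈ C k l) : refl a ∈ C k l := by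
  refine ⟨fun i => ?_, fun i => ?_, fun i => ?_⟩
  · have := ha.1 (-1 - i)
    simp only [refl_apply]; ring_nf at *; omega
  · rw [S_refl]; exact ha.2.1 _
  · rw [L_refl]; exact ha.2.2 _

theorem Mv.refl (h : Mv i a b) : Mv (-i) (refl b) (refl a) := by
  ext n
  have := DFunLike.congr_fun h (1 - n)
  simp only [Finsupp.add_apply, Finsupp.single_apply, refl_apply] at *
  simp only [show (i + 1 = 1 - n) = (-i = n) from propext ⟨by omega, by omega⟩,
    show (i = 1 - n) = (-i + 1 = n) from propext ⟨by omega, by omega⟩] at this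
  exact this.symm

theorem ReadyL.refl (h : ReadyL k l a i) : ReadyR k l (refl a) (-i) := by
  obtain ⟨h1, h2, h3, h4⟩ := h
  refine ⟨?_, ?_, ?_, ?_⟩
  · simpa [HasParticle, S_refl, L_refl] using h1
  · rw [S_refl]; ring_nf at *; exact h2
  · rw [L_refl]; ring_nf at *; exact h3
  · rw [L_refl]; ring_nf at *; exact h4

theorem C_of_mv' (h : Mv i a b) (hb : b ∈ C k l) (hr : ReadyL k l b i) : a ∈ C k l := by
  have := refl_mem_C (C_of_mv h.refl (refl_mem_C hb) hr.refl)
  simpa using this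

/-! ### The right move -/

/-- `i` is the highest position of a particle of weight `l`. -/
def Top (k l : ℕ) (a : Conf) (i : ℤ) : Prop := IsGreatest {j | HasParticle k l a j} i

theorem Top.highestPos_eq (h : Top k l a i) : highestPos k l a = i := h.csSup_eq

theorem Top.readyR (h : Top k l a i) (ha : a ∈ C k l) : ReadyR k l a i := by
  have key : ∀ j, i < j → S a j < l ∧ L a j < k + l := fun j hj => by
    have h1 : ¬ HasParticle k l a j := fun h' => not_le_of_gt hj (h.2 h')
    have := ha.2.1 j; have := ha.2.2 j
    unfold HasParticle at h1; omega
  exact ⟨h.1, (key _ (by omega)).1, (key _ (by omega)).2, (key _ (by omega)).2⟩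

theorem Top.mv (h : Top k l a i) (ha : a ∈ C k l) : Mv i a (rightMove k l a) := by
  rw [rightMove, h.highestPos_eq]
  exact mv_right ((h.readyR ha).pos ha)

theorem Top.rightMove_eq (h : Top k l a i) (ha : a ∈ C k l) (hm : Mv i a b) :
    rightMove k l a = b := (h.mv ha).right_unique hm

theorem Top.mem_C (h : Top k l a i) (ha : a ∈ C k l) : rightMove k l a ∈ C k l :=
  C_of_mv (h.mv ha) ha (h.readyR ha)

theorem HasParticle.exists_ne (h : HasParticle k l a j) (hl : 1 ≤ l) :
    ∃ n, j - 1 ≤ n ∧ n ≤ j + 2 ∧ a n ≠ 0 := by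
  by_contra! H
  have h1 := H (j - 1) (by omega) (by omega)
  have h2 := H j (by omega) (by omega)
  have h3 := H (j + 1) (by omega) (by omega)
  have h4 := H (j + 2) (by omega) (by omega)
  unfold HasParticle S L at h
  omega

theorem exists_bound (a : Conf) : ∃ N : ℤ, 0 ≤ N ∧ ∀ n, N ≤ n ∨ n ≤ -N → a n = 0 := by
  obtain ⟨M, hM⟩ := a.support.bddAbove
  obtain ⟨m, hm⟩ := a.support.bddBelow
  refine ⟨|M| + |m| + 1, by positivity, fun n hn => ?_⟩
  by_contra h
  have h' : n ∈ (a.support : Set ℤ) := by simpa using h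
  have h1 := hM h'; have h2 := hm h'
  have := le_abs_self M; have := neg_abs_le m; have := abs_nonneg M; have := abs_nonneg m
  omega

theorem exists_top (hl : 1 ≤ l) (h : HasParticle k l a j) : ∃ i, Top k l a i := by
  obtain ⟨N, -, hN⟩ := exists_bound a
  obtain ⟨i, hi, hi'⟩ := Int.exists_greatest_of_bdd (P := fun j => HasParticle k l a j)
    ⟨N + 1, fun z hz => by
      obtain ⟨n, h1, h2, h3⟩ := hz.exists_ne hl
      by_contra hlt
      exact h3 (hN n (Or.inl (by omega)))⟩ ⟨j, h⟩
  exact ⟨i, hi, fun z hz => hi' z hz⟩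

theorem HasParticle.le_or (hm : Mv i a b) (h : HasParticle k l b j) (hj : i + 2 < j) :
    HasParticle k l a j := by
  unfold HasParticle at *
  rwa [hm.S_of_ne (by omega) (by omega),
    hm.L_of_ne (by omega) (by omega) (by omega) (by omega)] at h

/-- Positions beyond i + 2 do not notice the move and i stays a position, so the new highest
position is within two steps. The extra data in the double-step case are what injectivity and the
phase argument need. -/
theorem Top.of_mv (h : Top k l a i) (ha : a ∈ C k l) (hl : 1 ≤ l) (hm : Mv i a b) :
    Top k l b i ∨ Top k l b (i + 1) ∨
      (Top k l b (i + 2) ∧ S b i < l ∧ L b i = k + l ∧ L b (i + 2) = k + l) := by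
  have hb := C_of_mv hm ha (h.readyR ha)
  obtain ⟨i', hi'⟩ := exists_top hl (readyL_of_mv hm ha h.1).hasParticle
  have h1 : i ≤ i' := hi'.2 (readyL_of_mv hm ha h.1).hasParticle
  have h2 : i' ≤ i + 2 := by
    by_contra hlt
    have := h.2 (HasParticle.le_or hm hi'.1 (by omega))
    omega
  obtain rfl | rfl | rfl : i' = i ∨ i' = i + 1 ∨ i' = i + 2 := by omega
  · exact Or.inl hi'
  · exact Or.inr (Or.inl hi')
  · refine Or.inr (Or.inr ⟨hi', ?_⟩)
    obtain ⟨hr1, hr2, hr3, hr4⟩ := h.readyR ha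
    have h3 : ¬ HasParticle k l a (i + 3) := fun h' => by have := h.2 h'; omega
    have h4 : ¬ HasParticle k l a (i + 2) := fun h' => by have := h.2 h'; omega
    have h5 : HasParticle k l b (i + 2) := hi'.1
    have h6 := hm.S_of_ne (j := i) (by omega) (by omega)
    have h7 := hm.S_of_ne (j := i + 2) (by omega) (by omega)
    have h8 := hm.L_of_ne (j := i) (by omega) (by omega) (by omega) (by omega)
    have h9 := hm.L_eq.2.2
    have e1 := L_eq_add a (i + 1)
    have e2 := L_eq_add a (i + 2)
    rw [show i + 1 - 1 = i by ring, show i + 1 + 1 = i + 2 by ring] at e1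
    rw [show i + 2 - 1 = i + 1 by ring, show i + 2 + 1 = i + 3 by ring] at e2
    have b1 := ha.2.1 (i + 3)
    have b2 := ha.2.1 i
    unfold HasParticle at h3 h4 h5 hr1
    have h10 : L b (i + 2) = k + l := by omega
    -- If S were sharp at i, then L a (i + 1) < k + l would leave S a (i + 1) + S a (i + 2) < k, and
    -- the sharp L at i + 2 after the move would force S a (i + 3) = l, above the highest position.
    have h11 : S a i ≠ l := fun h' => by omega
    omega

/-- After a move from j no inequality just left of j is sharp. If the same configuration also came
from a move at i < j, then i is still a position there and j is at most two steps above it, so i is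
one of the places where sharpness is excluded. -/
theorem rightMove_inj (hl : 1 ≤ l) (ha : a ∈ C k l) (hb : b ∈ C k l) (hi : Top k l a i)
    (hj : Top k l b j) (h : rightMove k l a = rightMove k l b) : a = b := by
  wlog hij : i ≤ j generalizing a b i j
  · exact (this hb ha hj hi h.symm (by omega)).symm
  have m1 := hi.mv ha
  have m2 := hj.mv hb
  rw [← h] at m2
  obtain hij | hij := hij.eq_or_lt
  · subst hij; exact m1.left_unique m2
  exfalso
  have r1 := readyL_of_mv m1 ha hi.1
  have r2 := readyL_of_mv m2 hb hj.1
  obtain ⟨p1, p2, p3, p4⟩ := r2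
  have p5 := r1.1
  rcases hi.of_mv ha hl m1 with h3 | h3 | ⟨h3, h4⟩
  · have := h3.2 p1; omega
  · have := h3.2 p1
    obtain rfl : j = i + 1 := by omega
    rw [add_sub_cancel_right] at p2 p3
    unfold HasParticle at p5; omega
  · have := h3.2 p1
    obtain rfl | rfl : j = i + 1 ∨ j = i + 2 := by omega
    · rw [add_sub_cancel_right] at p2 p3
      unfold HasParticle at p5; omega
    · rw [add_sub_cancel_right] at p4
      unfold HasParticle at p5; omega

theorem iterate_mem (hl : 1 ≤ l) (ha : a ∈ C k l) (hi : Top k l a i) (t : ℕ) :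
    (rightMove k l)^[t] a ∈ C k l ∧ ∃ i', i ≤ i' ∧ Top k l ((rightMove k l)^[t] a) i' := by
  induction t with
  | zero => exact ⟨ha, i, le_rfl, hi⟩
  | succ t ih =>
    obtain ⟨h1, i', h2, h3⟩ := ih
    rw [Function.iterate_succ_apply']
    refine ⟨h3.mem_C h1, ?_⟩
    rcases h3.of_mv h1 hl (h3.mv h1) with h | h | ⟨h, -⟩
    exacts [⟨_, h2, h⟩, ⟨_, by omega, h⟩, ⟨_, by omega, h⟩]

theorem iterate_inj (hl : 1 ≤ l) (t : ℕ) {i j : ℤ} {a b : Conf} (ha : a ∈ C k l)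
    (hb : b ∈ C k l) (hi : Top k l a i) (hj : Top k l b j)
    (h : (rightMove k l)^[t] a = (rightMove k l)^[t] b) : a = b := by
  induction t with
  | zero => exact h
  | succ t ih =>
    rw [Function.iterate_succ_apply', Function.iterate_succ_apply'] at h
    obtain ⟨h1, i', -, h3⟩ := iterate_mem hl ha hi t
    obtain ⟨h1', j', -, h3'⟩ := iterate_mem hl hb hj t
    exact ih (rightMove_inj hl h1 h1' h3 h3' h)

/-! ### The positions counted from the left -/

/-- The positions of the particles of weight `l` of `a` cut off to the sites `≥ s`. -/
def PL (k l : ℕ) (a : Conf) (s : ℤ) : Set ℤ :=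
  {j | (s ≤ j ∧ S a j = l) ∨ (s + 1 ≤ j ∧ L a j = k + l)}

/-- `js` lists the positions, counted from the left, of the particles of weight `l` of `a` cut
off to the sites `≥ s`. -/
def PosL (k l : ℕ) (a : Conf) : ℤ → List ℤ → Prop
  | s, [] => PL k l a s = ∅
  | s, j :: js => IsLeast (PL k l a s) j ∧ PosL k l a (j + 2) js

theorem le_of_mem_PL (h : j ∈ PL k l a s) : s ≤ j := by
  simp only [PL, Set.mem_ofPred_eq] at h; omega

theorem hasParticle_of_mem_PL (h : j ∈ PL k l a s) : HasParticle k l a j := by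
  simp only [PL, Set.mem_ofPred_eq, HasParticle] at *; tauto

theorem PosL.le_of_mem {js : List ℤ} (h : PosL k l a s js) (hj : j ∈ js) : s ≤ j := by
  induction js generalizing s with
  | nil => simp at hj
  | cons j' js ih =>
    have := le_of_mem_PL h.1.1
    rcases List.mem_cons.1 hj with rfl | hj
    · exact this
    · have := ih h.2 hj; omega

theorem PosL.unique {js js' : List ℤ} (h : PosL k l a s js) (h' : PosL k l a s js') :
    js = js' := by
  induction js generalizing s js' with
  | nil =>
    cases js' with
    | nil => rfl
    | cons j js' =>
      have h1 : PL k l a s = ∅ := h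
      have := h'.1.1
      simp [h1] at this
  | cons j js ih =>
    cases js' with
    | nil =>
      have h1 : PL k l a s = ∅ := h'
      have := h.1.1
      simp [h1] at this
    | cons j' js' =>
      obtain rfl := h.1.unique h'.1
      rw [ih h.2 h'.2]

theorem PosL.of_append {js js' : List ℤ} (h : PosL k l a s (js ++ js')) :
    ∃ s', s ≤ s' ∧ PosL k l a s' js' := by
  induction js generalizing s with
  | nil => exact ⟨s, le_rfl, h⟩
  | cons j js ih =>
    obtain ⟨s', h1, h2⟩ := ih h.2
    have := le_of_mem_PL h.1.1
    exact ⟨s', by omega, h2⟩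

theorem exists_least_PL (h : j ∈ PL k l a s) : ∃ j', IsLeast (PL k l a s) j' := by
  obtain ⟨i, hi, hi'⟩ := Int.exists_least_of_bdd (P := fun j => j ∈ PL k l a s)
    ⟨s, fun z hz => le_of_mem_PL hz⟩ ⟨j, h⟩
  exact ⟨i, hi, fun z hz => hi' z hz⟩

theorem exists_posL (hl : 1 ≤ l) (a : Conf) (s : ℤ) : ∃ js, PosL k l a s js := by
  obtain ⟨N, -, hN⟩ := exists_bound a
  have key : ∀ n : ℕ, ∀ s : ℤ, N + 1 - s ≤ n → ∃ js, PosL k l a s js := by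
    intro n
    induction n with
    | zero =>
      intro s hs
      refine ⟨[], ?_⟩
      ext j
      simp only [Set.mem_empty_iff_false, iff_false]
      intro hj
      obtain ⟨m, h1, h2, h3⟩ := (hasParticle_of_mem_PL hj).exists_ne hl
      have := le_of_mem_PL hj
      exact h3 (hN m (Or.inl (by push_cast at hs; omega)))
    | succ n ih =>
      intro s hs
      by_cases he : PL k l a s = ∅
      · exact ⟨[], he⟩
      obtain ⟨j, hj⟩ := Set.nonempty_iff_ne_empty.2 he
      obtain ⟨j, hj⟩ := exists_least_PL hj
      have := le_of_mem_PL hj.1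
      obtain ⟨js, hjs⟩ := ih (j + 2) (by push_cast at hs; omega)
      exact ⟨j :: js, hj, hjs⟩
  exact key (N + 1 - s).toNat s (by omega)

theorem PL_congr {a b : Conf} {s s' : ℤ} (hs : s ≤ s') (h : ∀ n, s ≤ n → a n = b n) :
    PL k l a s' = PL k l b s' := by
  ext j
  simp only [PL, Set.mem_ofPred_eq]
  refine or_congr (and_congr_right fun hj => ?_) (and_congr_right fun hj => ?_)
  · rw [S, S, h _ (by omega), h _ (by omega)]
  · rw [L, L, h _ (by omega), h _ (by omega), h _ (by omega), h _ (by omega)]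

theorem PosL.congr {a b : Conf} {js : List ℤ} (h : ∀ n, s ≤ n → a n = b n) {s' : ℤ}
    (hs : s ≤ s') (hp : PosL k l a s' js) : PosL k l b s' js := by
  induction js generalizing s' with
  | nil =>
    have h1 : PL k l a s' = ∅ := hp
    rwa [PL_congr hs h] at h1
  | cons j js ih =>
    have h1 := hp.1
    have := le_of_mem_PL h1.1
    rw [PL_congr hs h] at h1
    exact ⟨h1, ih (by omega) hp.2⟩

/-- The right move changes the position of the last particle only. -/
theorem PosL.of_mv {js : List ℤ} (ha : a ∈ C k l) (hi : Top k l a i) (hm : Mv i a b)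
    (his : i ∈ PL k l a s) (h : PosL k l a s js) :
    js ≠ [] ∧ PosL k l b s (js.dropLast ++ [i]) := by
  have hr := hi.readyR ha
  have hS : ∀ j, j ≠ i - 1 → j ≠ i + 1 → S b j = S a j := fun j h1 h2 => hm.S_of_ne h1 h2
  have hL : ∀ j, j ≠ i - 2 → j ≠ i - 1 → j ≠ i + 1 → j ≠ i + 2 → L b j = L a j :=
    fun j h1 h2 h3 h4 => hm.L_of_ne h1 h2 h3 h4
  have hrl := readyL_of_mv hm ha hi.1
  -- A particle may be seen at several neighbouring positions: i is the highest of them, while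
  -- counting from the left finds a lower j. After the move nothing just below i is sharp, so the
  -- count from the left finds i itself.
  have fin : ∀ s j, IsLeast (PL k l a s) j → i ∈ PL k l a s → i - 2 ≤ j →
      ¬ (j = i - 2 ∧ S a (i - 2) = l) → PosL k l b s [i] := by
    intro s j hj his hji hne
    refine ⟨⟨?_, ?_⟩, ?_⟩
    · simpa only [PL, Set.mem_ofPred_eq, hS i (by omega) (by omega),
        hL i (by omega) (by omega) (by omega) (by omega)] using his
    · intro w hw
      by_contra hlt
      obtain ⟨-, p2, p3, p4⟩ := hrl
      simp only [PL, Set.mem_ofPred_eq] at hw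
      by_cases w1 : w = i - 1
      · subst w1; omega
      by_cases w2 : w = i - 2
      · subst w2
        have h1 : S a (i - 2) = l := by rw [← hS _ (by omega) (by omega)]; omega
        have : j ≤ i - 2 := hj.2 (Or.inl ⟨by omega, h1⟩)
        exact hne ⟨by omega, h1⟩
      · rw [hS w (by omega) (by omega), hL w (by omega) (by omega) (by omega) (by omega)] at hw
        have := hj.2 hw
        omega
    · ext w
      simp only [Set.mem_empty_iff_false, iff_false]
      intro hw
      have := le_of_mem_PL hw
      have h1 : HasParticle k l a w := by
        simp only [PL, Set.mem_ofPred_eq] at hw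
        rcases hw with hw | hw
        · rw [hS w (by omega) (by omega)] at hw; exact Or.inl hw.2
        · rw [hL w (by omega) (by omega) (by omega) (by omega)] at hw; exact Or.inr hw.2
      have := hi.2 h1
      omega
  have emp : ∀ s' js, i < s' → PosL k l a s' js → js = [] := by
    intro s' js hs' hp
    refine hp.unique (js' := []) ?_
    ext w
    simp only [Set.mem_empty_iff_false, iff_false]
    intro hw
    have := le_of_mem_PL hw
    have := hi.2 (hasParticle_of_mem_PL hw)
    omega
  induction js generalizing s with
  | nil =>
    have h1 : PL k l a s = ∅ := h
    simp [h1] at his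
  | cons j js ih =>
    refine ⟨by simp, ?_⟩
    obtain ⟨hj, hjs⟩ := h
    have hji : j ≤ i := hj.2 his
    have step : i ∈ PL k l a (j + 2) → (S a j = l ∨ j ≤ i - 3) → j ≤ i - 2 →
        PosL k l b s ((j :: js).dropLast ++ [i]) := by
      intro hi2 hor hle
      obtain ⟨hne, hp⟩ := ih hi2 hjs
      rw [List.dropLast_cons_of_ne_nil hne]
      refine ⟨⟨?_, fun w hw => ?_⟩, hp⟩
      · have hj1 := hj.1
        simp only [PL, Set.mem_ofPred_eq] at hj1 ⊢
        rw [hS j (by omega) (by omega)]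
        rcases hor with hor | hor
        · left; omega
        · rwa [hL j (by omega) (by omega) (by omega) (by omega)]
      · by_contra hlt
        simp only [PL, Set.mem_ofPred_eq] at hw
        rw [hS w (by omega) (by omega), hL w (by omega) (by omega) (by omega) (by omega)] at hw
        have := hj.2 hw
        omega
    by_cases h3 : j ≤ i - 3
    · refine step ?_ (Or.inr h3) (by omega)
      have := hi.1
      simp only [PL, Set.mem_ofPred_eq, HasParticle] at this ⊢
      omega
    by_cases h2 : j = i - 2
    · subst h2
      have v := values a i; have v' := bounds ha i
      obtain ⟨r1, r2, r3, r4⟩ := hr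
      by_cases hSl : S a (i - 2) = l
      · refine step ?_ (Or.inl hSl) le_rfl
        left
        unfold HasParticle at r1
        omega
      -- Here the positions i - 2 and i belong to one and the same particle: the one at i - 2 is due
      -- to L only, and a later position i due to S would force S to be sharp already at i - 3,
      -- against minimality of i - 2.
      · have hne : js = [] := by
          refine hjs.unique (js' := []) ?_
          ext w
          simp only [Set.mem_empty_iff_false, iff_false]
          intro hw
          have h5 := hi.2 (hasParticle_of_mem_PL hw)
          have h6 := le_of_mem_PL hw
          obtain rfl : w = i := by omega
          have h7 : S a w = l := by
            simp only [PL, Set.mem_ofPred_eq] at hw; omega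
          have h8 := hj.1
          simp only [PL, Set.mem_ofPred_eq] at h8
          have h9 : S a (w - 3) ≠ l := fun h => by
            have := hj.2 (Or.inl ⟨by omega, h⟩ : w - 3 ∈ PL k l a s)
            omega
          omega
        subst hne
        exact fin s _ hj his le_rfl (by tauto)
    · have hne : js = [] := emp _ _ (by omega) hjs
      subst hne
      exact fin s j hj his (by omega) (by tauto)

/-! ### The left sweep -/

/-- All entries of `a` at the sites `≤ s + 1` vanish. -/
def Low (a : Conf) (s : ℤ) : Prop := ∀ n ≤ s + 1, a n = 0

theorem exists_low (a : Conf) : ∃ N : ℤ, ∀ s ≤ N, Low a s := by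
  obtain ⟨N, -, hN⟩ := exists_bound a
  exact ⟨-N - 1, fun s hs n hn => hN n (Or.inr (by omega))⟩

theorem Low.mono {s' : ℤ} (h : Low a s) (hs : s' ≤ s) : Low a s' :=
  fun n hn => h n (by omega)

theorem Low.le (h : Low a s) (ha : a ∈ C k l) (hl : 1 ≤ l) (hj : HasParticle k l a j) :
    s + 1 ≤ j := by
  by_contra hlt
  have := values a j; have := bounds ha j
  have := h j (by omega); have := h (j - 1) (by omega); have := h (j + 1) (by omega)
  unfold HasParticle at hj
  omega

/-- Far enough to the left the cut-off is invisible, so positions in the cut configuration are just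
positions. -/
theorem Low.mem_PL (h : Low a s) (ha : a ∈ C k l) (hl : 1 ≤ l) (hj : HasParticle k l a j) :
    j ∈ PL k l a s := by
  have := h.le ha hl hj
  simp only [PL, Set.mem_ofPred_eq, HasParticle] at *
  omega

theorem Low.PL_eq {s' : ℤ} (h : Low a s) (h' : Low a s') (ha : a ∈ C k l) (hl : 1 ≤ l) :
    PL k l a s = PL k l a s' :=
  Set.ext fun _ => ⟨fun hj => h'.mem_PL ha hl (hasParticle_of_mem_PL hj),
    fun hj => h.mem_PL ha hl (hasParticle_of_mem_PL hj)⟩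

theorem PosL.of_low {s' : ℤ} {js : List ℤ} (hp : PosL k l a s js) (h : Low a s) (h' : Low a s')
    (ha : a ∈ C k l) (hl : 1 ≤ l) : PosL k l a s' js := by
  cases js with
  | nil => exact (h.PL_eq h' ha hl).symm.trans hp
  | cons j js => exact ⟨(h.PL_eq h' ha hl) ▸ hp.1, hp.2⟩

/-- Cutting off the sites `< s` in a way that leaves no trace of a particle cut in two. -/
def Cut (a : Conf) (s : ℤ) : Prop := Low a s ∨ 1 ≤ a (s - 1)

/-- The configuration `a` cut off to the sites `≥ s`. -/
def cutOff (s : ℤ) (a : Conf) : Conf := a.filter fun n => s ≤ n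

theorem cutOff_apply (s n : ℤ) (a : Conf) : cutOff s a n = if s ≤ n then a n else 0 := by
  simp [cutOff, Finsupp.filter_apply]

theorem cutOff_of_low (h : Low a s) : cutOff s a = a := by
  ext n
  rw [cutOff_apply]
  split_ifs with hn
  · rfl
  · exact (h n (by omega)).symm

/-- A nonzero entry removed at s - 1 makes the truncated L at s and the truncated S and L at s - 1
strictly smaller than their bounds. So cutting creates no positions, and at s only S can remain
sharp. -/
theorem hasParticle_cutOff (ha : a ∈ C k l) (hl : 1 ≤ l) (h : Cut a s) :
    {j | HasParticle k l (cutOff s a) j} = PL k l a s := by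
  ext j
  simp only [PL, Set.mem_ofPred_eq, HasParticle]
  have e : ∀ n, s ≤ n → cutOff s a n = a n := fun n hn => by rw [cutOff_apply, if_pos hn]
  have z : ∀ n, n < s → cutOff s a n = 0 := fun n hn => by rw [cutOff_apply, if_neg (by omega)]
  have h' : (a (s - 1) = 0 ∧ a s = 0 ∧ a (s + 1) = 0) ∨ 1 ≤ a (s - 1) :=
    h.imp (fun h => ⟨h _ (by omega), h _ (by omega), h _ (by omega)⟩) id
  have b1 := ha.1 (s - 1)
  have b2 := ha.1 s
  have b3 := ha.2.1 (s - 1)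
  have b4 := ha.2.2 s
  rw [show s - 1 + 1 = s by ring, show s - 1 + 2 = s + 1 by ring] at b1
  rw [S, show s - 1 + 1 = s by ring] at b3
  by_cases h1 : s + 1 ≤ j
  · rw [S, S, L, L, e _ (by omega), e _ (by omega), e _ (by omega), e _ (by omega)]
    have : s ≤ j := by omega
    simp [h1, this]
  by_cases h2 : j = s
  · subst h2
    rw [S, S, L, L, z (j - 1) (by omega), e j le_rfl, e (j + 1) (by omega), e (j + 2) (by omega)]
    unfold L at b4
    omega
  by_cases h3 : j = s - 1
  · subst h3
    rw [S, L, z (s - 1) (by omega), z (s - 1 - 1) (by omega), show s - 1 + 1 = s by ring,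
      show s - 1 + 2 = s + 1 by ring, e s (by omega), e (s + 1) (by omega)]
    omega
  by_cases h4 : j = s - 2
  · subst h4
    rw [S, L, z (s - 2) (by omega), z (s - 2 - 1) (by omega), z (s - 2 + 1) (by omega),
      show s - 2 + 2 = s by ring, e s (by omega)]
    omega
  · rw [S, L, z j (by omega), z (j - 1) (by omega), z (j + 1) (by omega), z (j + 2) (by omega)]
    omega

/-- This both makes the left move at j possible and makes the cut behind j a clean one in the sense
of `Cut`, so the counting can be iterated. -/
theorem one_le_of_isLeast (ha : a ∈ C k l) (hl : 1 ≤ l) (h : Cut a s)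
    (hj : IsLeast (PL k l a s) j) : 1 ≤ a (j + 1) := by
  have hj1 := hj.1
  have hs := le_of_mem_PL hj1
  have h1 : s ≤ j - 1 → S a (j - 1) ≠ l := fun hs' h' => by
    have := hj.2 (Or.inl ⟨hs', h'⟩ : j - 1 ∈ PL k l a s)
    omega
  have v := values a j; have := bounds ha j
  have hs' : s = j → 1 ≤ a (j - 1) ∨ a j = 0 := by
    rintro rfl
    exact h.symm.imp id fun h => h _ (by omega)
  simp only [PL, Set.mem_ofPred_eq] at hj1
  omega

theorem Cut.succ (ha : a ∈ C k l) (hl : 1 ≤ l) (h : Cut a s) (hj : IsLeast (PL k l a s) j) :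
    Cut a (j + 2) := by
  right
  rw [show j + 2 - 1 = j + 1 by ring]
  exact one_le_of_isLeast ha hl h hj

theorem lowestPos_cutOff (ha : a ∈ C k l) (hl : 1 ≤ l) (h : Cut a s)
    (hj : IsLeast (PL k l a s) j) : lowestPos k l (cutOff s a) = j := by
  rw [lowestPos, hasParticle_cutOff ha hl h]
  exact hj.csInf_eq

theorem cutLeft_cutOff (ha : a ∈ C k l) (hl : 1 ≤ l) (h : Cut a s)
    (hj : IsLeast (PL k l a s) j) : cutLeft k l (cutOff s a) = cutOff (j + 2) a := by
  have := le_of_mem_PL hj.1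
  ext n
  rw [cutLeft, lowestPos_cutOff ha hl h hj, Finsupp.filter_apply, cutOff_apply, cutOff_apply]
  split_ifs <;> first | rfl | omega

theorem leftPos_cutOff (ha : a ∈ C k l) (hl : 1 ≤ l) {js js' : List ℤ} (h : Cut a s)
    (hp : PosL k l a s (js ++ j :: js')) :
    leftPos k l js.length (cutOff s a) = j ∧ 1 ≤ a (j + 1) := by
  induction js generalizing s with
  | nil => exact ⟨lowestPos_cutOff ha hl h hp.1, one_le_of_isLeast ha hl h hp.1⟩
  | cons j' js ih =>
    rw [List.length_cons, leftPos, Function.iterate_succ_apply, cutLeft_cutOff ha hl h hp.1]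
    exact ih (h.succ ha hl hp.1) hp.2

theorem leftMove_mv (ha : a ∈ C k l) (hl : 1 ≤ l) {js js' : List ℤ} (h : Low a s)
    (hp : PosL k l a s (js ++ j :: js')) : Mv j (leftMove k l js.length a) a := by
  obtain ⟨h1, h2⟩ := leftPos_cutOff ha hl (Or.inl h) hp
  rw [cutOff_of_low h] at h1
  rw [leftMove, h1]
  exact mv_left h2

/-- A left move changes only the position of the particle that is moved, as seen from the
particles on its right. -/
theorem PosL.of_mv_left {js js' : List ℤ} (hc : c ∈ C k l) (hb : b ∈ C k l) (hm : Mv j b c)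
    (hr : ReadyL k l c j) (hp : PosL k l c s (js ++ j :: js')) :
    ∃ js₁, js₁.length = js.length + 1 ∧ PosL k l b s (js₁ ++ js') := by
  have hS : ∀ n, n ≠ j - 1 → n ≠ j + 1 → S c n = S b n := fun n h1 h2 => hm.S_of_ne h1 h2
  have hL : ∀ n, n ≠ j - 2 → n ≠ j - 1 → n ≠ j + 1 → n ≠ j + 2 → L c n = L b n :=
    fun n h1 h2 h3 h4 => hm.L_of_ne h1 h2 h3 h4
  obtain ⟨r1, r2, r3, r4⟩ := hr
  have d1 := hm.S_pred; have d2 := hm.S_succ; have d3 := hm.L_eq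
  induction js generalizing s with
  | nil =>
    obtain ⟨hj, hjs⟩ : IsLeast (PL k l c s) j ∧ PosL k l c (j + 2) js' := hp
    have low : ∀ w ∈ PL k l b s, w < j →
        w = j - 1 ∨ w = j - 2 ∧ L b (j - 2) = k + l ∧ s + 1 ≤ w := by
      intro w hw hwj
      by_cases w1 : w = j - 1
      · exact Or.inl w1
      have hn : w ∉ PL k l c s := fun h => by have := hj.2 h; omega
      simp only [PL, Set.mem_ofPred_eq] at hw hn
      rw [hS w w1 (by omega)] at hn
      by_cases w2 : w = j - 2
      · subst w2; omega
      rw [hL w w2 w1 (by omega) (by omega)] at hn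
      exact absurd hw hn
    have hjb : j ∈ PL k l b s := by
      have := hj.1
      simpa only [PL, Set.mem_ofPred_eq, hS j (by omega) (by omega),
        hL j (by omega) (by omega) (by omega) (by omega)] using this
    have hex : ∃ j', IsLeast (PL k l b s) j' ∧
        (j' = j ∨ j' = j - 1 ∨ j' = j - 2 ∧ L b (j - 2) = k + l ∧ s + 1 ≤ j') := by
      obtain ⟨j', hj'⟩ := exists_least_PL hjb
      refine ⟨j', hj', ?_⟩
      rcases (hj'.2 hjb).eq_or_lt with h | h
      · exact Or.inl h
      · exact Or.inr (low j' hj'.1 h)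
    obtain ⟨j', hj', hor⟩ := hex
    refine ⟨[j'], rfl, hj', ?_⟩
    -- The moved particle may be found one or two steps lower than before. None of the positions
    -- this uncovers up to j + 1 is sharp, and at j + 2 only S counts, which the move leaves alone.
    have hPL : PL k l b (j' + 2) = PL k l c (j + 2) := by
      ext w
      simp only [PL, Set.mem_ofPred_eq]
      have vb := bounds hb j; have vc := bounds hc j
      by_cases w1 : w = j + 1
      · subst w1; omega
      by_cases w2 : w = j + 2
      · subst w2
        rw [hS _ (by omega) (by omega)]
        omega
      by_cases w3 : w = j
      · subst w3
        have := values c w; have := hS w (by omega) (by omega)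
        rcases hor with h | h | ⟨h, h', h''⟩
        · omega
        · omega
        · have h7 : S c (w - 3) ≠ l := fun h7 => by
            have := hj.2 (Or.inl ⟨by omega, h7⟩ : w - 3 ∈ PL k l c s)
            omega
          omega
      by_cases w4 : w < j
      · omega
      rw [hS w (by omega) w1, hL w (by omega) (by omega) w1 w2]
      omega
    have hag : ∀ n, j + 2 ≤ n → c n = b n := fun n hn => hm.apply_of_ne (by omega) (by omega)
    cases js' with
    | nil => exact hPL.trans hjs
    | cons j'' js' =>
      obtain ⟨h1, h2⟩ := hjs
      have := le_of_mem_PL h1.1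
      exact ⟨hPL ▸ h1, h2.congr hag (by omega)⟩
  | cons j' js ih =>
    obtain ⟨hj', hjs⟩ := hp
    obtain ⟨js₁, h1, h2⟩ := ih hjs
    obtain ⟨s'', h4, h5⟩ := hjs.of_append
    have := le_of_mem_PL h5.1.1
    refine ⟨j' :: js₁, by simp [h1], ⟨?_, fun w hw => ?_⟩, h2⟩
    · have h3 := hj'.1
      simp only [PL, Set.mem_ofPred_eq] at h3 ⊢
      rw [hS j' (by omega) (by omega)] at h3
      by_cases hjj : j' = j - 2
      · subst hjj; omega
      rwa [hL j' (by omega) (by omega) (by omega) (by omega)] at h3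
    · by_contra hlt
      simp only [PL, Set.mem_ofPred_eq] at hw
      rw [← hS w (by omega) (by omega), ← hL w (by omega) (by omega) (by omega) (by omega)] at hw
      have := hj'.2 hw
      omega

/-- Moving the particle at j to the left lowers S at j + 1 and L at j + 1 and j + 2, which are the
only inequalities that could have blocked the next particle; those in between are not sharp by
minimality of its position. -/
theorem readyL_next {j' : ℤ} {js : List ℤ} (hc : c ∈ C k l) (hm : Mv j b c)
    (hr : ReadyL k l c j) (hp : PosL k l c (j + 2) (j' :: js)) : ReadyL k l b j' := by
  have hS : ∀ n, n ≠ j - 1 → n ≠ j + 1 → S c n = S b n := fun n h1 h2 => hm.S_of_ne h1 h2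
  have hL : ∀ n, n ≠ j - 2 → n ≠ j - 1 → n ≠ j + 1 → n ≠ j + 2 → L c n = L b n :=
    fun n h1 h2 h3 h4 => hm.L_of_ne h1 h2 h3 h4
  have hpos := hr.pos hc
  obtain ⟨r1, r2, r3, r4⟩ := hr
  have d1 := hm.S_pred; have d2 := hm.S_succ; have d3 := hm.L_eq
  have hj := hp.1.1
  have hmin : ∀ w, j + 2 ≤ w → w < j' → S c w ≠ l ∧ (j + 3 ≤ w → L c w ≠ k + l) := by
    intro w h1 h2
    have h3 : w ∉ PL k l c (j + 2) := fun h => by have := hp.1.2 h; omega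
    simp only [PL, Set.mem_ofPred_eq] at h3
    constructor
    · intro h; exact h3 (Or.inl ⟨h1, h⟩)
    · intro h h'; exact h3 (Or.inr ⟨by omega, h'⟩)
  have hle := le_of_mem_PL hj
  simp only [PL, Set.mem_ofPred_eq] at hj
  have hb1 := hc.2.1; have hb2 := hc.2.2
  have vc := values c j
  have vb := bounds hc j
  refine ⟨?_, ?_, ?_, ?_⟩
  · unfold HasParticle
    rw [← hS j' (by omega) (by omega)]
    by_cases h : j' = j + 2
    · left; omega
    rw [← hL j' (by omega) (by omega) (by omega) (by omega)]
    omega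
  · by_cases h : j' = j + 2
    · subst h
      rw [show j + 2 - 1 = j + 1 by ring]; omega
    rw [← hS _ (by omega) (by omega)]
    exact lt_of_le_of_ne (hb1 _) (hmin _ (by omega) (by omega)).1
  · by_cases h : j' = j + 2
    · subst h
      rw [show j + 2 - 1 = j + 1 by ring]; omega
    by_cases h' : j' = j + 3
    · subst h'
      rw [show j + 3 - 1 = j + 2 by ring]; omega
    rw [← hL _ (by omega) (by omega) (by omega) (by omega)]
    exact lt_of_le_of_ne (hb2 _) ((hmin _ (by omega) (by omega)).2 (by omega))
  · by_cases h : j' = j + 2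
    · subst h
      -- With S sharp at j + 2, the bound on L at j + 1 gives S j + S (j + 1) ≤ k, and S (j - 1) < l
      -- then keeps L at j below k + l.
      rw [show j + 2 - 2 = j by ring, ← hL _ (by omega) (by omega) (by omega) (by omega)]
      unfold HasParticle at r1
      omega
    by_cases h' : j' = j + 3
    · subst h'
      rw [show j + 3 - 2 = j + 1 by ring]; omega
    by_cases h'' : j' = j + 4
    · subst h''
      rw [show j + 4 - 2 = j + 2 by ring]; omega
    rw [← hL _ (by omega) (by omega) (by omega) (by omega)]
    exact lt_of_le_of_ne (hb2 _) ((hmin _ (by omega) (by omega)).2 (by omega))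

theorem top_of_mv_left {js : List ℤ} {j' : ℤ} (hm : Mv j b c)
    (hp : PosL k l c (j + 2) (j' :: js)) (hi : Top k l c i) : Top k l b i := by
  have d1 := hm.S_pred; have d2 := hm.S_succ; have d3 := hm.L_eq
  have h1 := hi.2 (hasParticle_of_mem_PL hp.1.1)
  have h2 := le_of_mem_PL hp.1.1
  have h3 := hi.1
  have h4 := hp.1.1
  refine ⟨?_, fun w hw => ?_⟩
  · simp only [Set.mem_ofPred_eq, HasParticle, PL] at *
    rw [← hm.S_of_ne (j := i) (by omega) (by omega)]
    by_cases h : i = j + 2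
    · obtain rfl : j' = i := by omega
      left; omega
    rwa [← hm.L_of_ne (j := i) (by omega) (by omega) (by omega) (by omega)]
  · by_contra hlt
    refine hlt (hi.2 ?_)
    simp only [Set.mem_ofPred_eq, HasParticle] at *
    rw [hm.S_of_ne (j := w) (by omega) (by omega)]
    by_cases h : w = j + 2
    · subst h
      omega
    rwa [hm.L_of_ne (j := w) (by omega) (by omega) (by omega) (by omega)]

/-- This makes the right move the inverse of the left move of the last particle. -/
theorem top_of_last (hc : c ∈ C k l) (hm : Mv j b c) (hr : ReadyL k l c j)
    (hp : PL k l c (j + 2) = ∅) : Top k l b j := by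
  have d1 := hm.S_pred; have d2 := hm.S_succ; have d3 := hm.L_eq
  have hb2 := hc.2.2
  have h0 := hr.1
  have ne : ∀ w, w ∉ PL k l c (j + 2) := by simp [hp]
  refine ⟨?_, fun w hw => ?_⟩
  · simp only [Set.mem_ofPred_eq, HasParticle] at *
    rwa [← hm.S_of_ne (j := j) (by omega) (by omega),
      ← hm.L_of_ne (j := j) (by omega) (by omega) (by omega) (by omega)]
  · by_contra hlt
    have nw := ne w
    have b1 := hc.2.1 (j + 1)
    have b2 := hb2 (j + 1); have b3 := hb2 (j + 2)
    simp only [Set.mem_ofPred_eq, HasParticle, PL] at *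
    by_cases h : w = j + 1
    · subst h; omega
    rw [hm.S_of_ne (j := w) (by omega) (by omega)] at nw
    by_cases h : w = j + 2
    · subst h; omega
    rw [hm.L_of_ne (j := w) (by omega) (by omega) (by omega) (by omega)] at nw
    omega

theorem PosL.readyL_head {js : List ℤ} (ha : a ∈ C k l) (hl : 1 ≤ l) (h : Low a s)
    (hp : PosL k l a s (j :: js)) : ReadyL k l a j := by
  have key : ∀ w, w < j → S a w < l ∧ L a w < k + l := fun w hw => by
    have h1 : ¬ HasParticle k l a w := fun h' => not_le_of_gt hw (hp.1.2 (h.mem_PL ha hl h'))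
    have := ha.2.1 w; have := ha.2.2 w
    unfold HasParticle at h1; omega
  exact ⟨hasParticle_of_mem_PL hp.1.1, (key _ (by omega)).1, (key _ (by omega)).2,
    (key _ (by omega)).2⟩

/-- The effect of the first `n` moves of a left sweep. -/
structure Swept (k l : ℕ) (a c : Conf) (s : ℤ) (js : List ℤ) (n : ℕ) : Prop where
  mem : c ∈ C k l
  low : Low c s
  pos : ∃ js', js'.length = n ∧ PosL k l c s (js' ++ js.drop n)
  ready : ∀ j js', js.drop n = j :: js' → ReadyL k l c j
  eq : c + ((js.take n).map fun j => Finsupp.single (j + 1) 1).sum =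
    a + ((js.take n).map fun j => Finsupp.single j 1).sum
  top : js.drop n ≠ [] → ∀ i, Top k l a i → Top k l c i

theorem swept_succ {js js' : List ℤ} {n : ℕ} (hl : 1 ≤ l) (h : Swept k l a c s js n)
    (hjs : js.drop n = j :: js') (hsj : s + 2 ≤ j) :
    Mv j (leftMove k l n c) c ∧ Swept k l a (leftMove k l n c) s js (n + 1) := by
  obtain ⟨h1, h2, ⟨js₁, rfl, h4⟩, h5, h6, h7⟩ := h
  have hd : js.drop (js₁.length + 1) = js' := by
    rw [← List.drop_drop, hjs]; rfl
  rw [hjs] at h4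
  have hm := leftMove_mv h1 hl h2 h4
  have hr := h5 _ _ hjs
  have hb := C_of_mv' hm h1 hr
  refine ⟨hm, hb, ?_, ?_, ?_, ?_, ?_⟩
  · intro m hmm
    rw [← h2 m hmm]
    exact (hm.apply_of_ne (by omega) (by omega)).symm
  · rw [hd]
    exact h4.of_mv_left h1 hb hm hr
  · intro j' js'' hj'
    rw [hd] at hj'
    subst hj'
    obtain ⟨s', -, h8⟩ := h4.of_append
    exact readyL_next h1 hm hr h8.2
  · have ht : js.take (js₁.length + 1) = js.take js₁.length ++ [j] := by
      rw [List.take_add, hjs]; rfl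
    rw [ht]
    simp only [List.map_append, List.sum_append, List.map_cons, List.map_nil, List.sum_cons,
      List.sum_nil, add_zero]
    unfold Mv at hm
    calc _ = (leftMove k l js₁.length c + Finsupp.single (j + 1) 1) +
          ((js.take js₁.length).map fun j => Finsupp.single (j + 1) 1).sum := by abel
      _ = (c + ((js.take js₁.length).map fun j => Finsupp.single (j + 1) 1).sum) +
          Finsupp.single j 1 := by rw [hm]; abel
      _ = _ := by rw [h6]; abel
  · intro hne i hi
    rw [hd] at hne
    obtain ⟨j', js'', rfl⟩ := List.exists_cons_of_ne_nil hne
    obtain ⟨s', -, h8⟩ := h4.of_append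
    exact top_of_mv_left hm h8.2 (h7 (by simp [hjs]) i hi)

/-- The one additional empty site is the room that a single sweep uses up: units land at sites ≥ s +
2, so the sites ≤ s + 1 stay empty during it. -/
theorem PosL.add_two_le {js : List ℤ} (ha : a ∈ C k l) (hl : 1 ≤ l) (h : Low a (s + 1))
    (hp : PosL k l a s js) : ∀ j ∈ js, s + 2 ≤ j := by
  have := hp.of_low (h.mono (by omega)) h ha hl
  cases js with
  | nil => simp
  | cons j' js =>
    have h1 := h.le ha hl (hasParticle_of_mem_PL this.1.1)
    intro j hj
    rcases List.mem_cons.1 hj with rfl | hj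
    · omega
    · have := hp.2.le_of_mem hj; omega

theorem PosL.swept {js : List ℤ} (ha : a ∈ C k l) (hl : 1 ≤ l) (h : Low a (s + 1))
    (hp : PosL k l a s js) {n : ℕ} (hn : n ≤ js.length) :
    Swept k l a (leftSweep k l n a) s js n := by
  induction n with
  | zero =>
    refine ⟨ha, h.mono (by omega), ⟨[], rfl, hp⟩, ?_, by simp [leftSweep], fun _ i hi => hi⟩
    rintro j js' hjs
    rw [List.drop_zero] at hjs
    subst hjs
    exact hp.readyL_head ha hl (h.mono (by omega))
  | succ n ih =>
    have ih := ih (by omega)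
    have hd : js.drop n = js[n] :: js.drop (n + 1) := List.drop_eq_getElem_cons (by omega)
    exact (swept_succ hl ih hd (hp.add_two_le ha hl h _ (List.getElem_mem _))).2

theorem PosL.sweep_last {js : List ℤ} (ha : a ∈ C k l) (hl : 1 ≤ l) (h : Low a (s + 1))
    (hp : PosL k l a s (js ++ [j])) :
    rightMove k l (leftSweep k l (js.length + 1) a) = leftSweep k l js.length a ∧
      ∃ i, Top k l (leftSweep k l (js.length + 1) a) i := by
  have h1 := hp.swept ha hl h (n := js.length) (by simp)
  have hd : (js ++ [j]).drop js.length = [j] := by simp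
  obtain ⟨hm, h2⟩ := swept_succ hl h1 hd (hp.add_two_le ha hl h _ (by simp))
  obtain ⟨js', h3, h4⟩ := h1.pos
  rw [hd] at h4
  obtain ⟨s', -, h5⟩ := h4.of_append
  have ht := top_of_last h1.mem hm (h1.ready _ _ hd) h5.2
  exact ⟨ht.rightMove_eq h2.mem hm, _, ht⟩

/-- A left sweep that spares the last particle commutes with the right move. -/
theorem PosL.sweep_rightMove {js : List ℤ} {j' : ℤ} (ha : a ∈ C k l) (hl : 1 ≤ l)
    (h : Low a (s + 1)) (hp : PosL k l a s (js ++ [j])) (hi : Top k l a i)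
    (hp' : PosL k l (rightMove k l a) s (js ++ [j'])) :
    rightMove k l (leftSweep k l js.length a) = leftSweep k l js.length (rightMove k l a) := by
  have hm := hi.mv ha
  have hlow : Low (rightMove k l a) (s + 1) := fun n hn => by
    have h1 := (hi.readyR ha).pos ha
    have h2 : s + 1 + 1 < i := by
      by_contra hlt
      have := h i (by omega)
      omega
    rw [hm.apply_of_ne (by omega) (by omega)]
    exact h n hn
  have h1 := hp.swept ha hl h (n := js.length) (by simp)
  have h2 := hp'.swept (hi.mem_C ha) hl hlow (n := js.length) (by simp)
  have ht := h1.top (by simp) i hi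
  refine ht.rightMove_eq h1.mem ?_
  have e1 := h1.eq
  have e2 := h2.eq
  simp only [List.take_left'] at e1 e2
  unfold Mv at hm ⊢
  -- By `Swept.eq` a sweep is a sum of unit displacements at the listed positions. The list is the
  -- same before and after the right move, so the displacements commute and cancel.
  refine add_right_cancel (b := (js.map fun j => Finsupp.single (j + 1) 1).sum) ?_
  calc _ = (leftSweep k l js.length a + (js.map fun j => Finsupp.single (j + 1) 1).sum) +
        Finsupp.single (i + 1) 1 := by abel
    _ = (a + Finsupp.single (i + 1) 1) + (js.map fun j => Finsupp.single j 1).sum := by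
        rw [e1]; abel
    _ = (rightMove k l a + (js.map fun j => Finsupp.single j 1).sum) +
        Finsupp.single i 1 := by rw [hm]; abel
    _ = _ := by rw [← e2]; abel

/-! ### Free particles -/

theorem freeParticle_eq {q d : ℤ} {c : ℕ} (h1 : 1 ≤ c) (h2 : c ≤ l) (hd : d = q * l + (l - c)) :
    d / l = q ∧ freeParticle l d = Finsupp.single q c + Finsupp.single (q + 1) (l - c) := by
  have e1 : d / l = q := by
    rw [hd, Int.add_comm, Int.add_mul_ediv_right _ _ (by omega),
      Int.ediv_eq_zero_of_lt (by omega) (by omega), zero_add]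
  have e2 : d % l = l - c := by
    rw [Int.emod_def, e1, hd]; ring
  refine ⟨e1, ?_⟩
  rw [freeParticle, e1, e2]
  congr 2 <;> omega

theorem freeParticle_spec (hl : 1 ≤ l) (d : ℤ) :
    ∃ c : ℕ, 1 ≤ c ∧ c ≤ l ∧ d = d / l * l + (l - c) ∧ freeParticle l d (d / l) = c ∧
      freeParticle l d (d / l + 1) = l - c ∧
      ∀ n, n ≠ d / l → n ≠ d / l + 1 → freeParticle l d n = 0 := by
  have h1 := Int.emod_nonneg d (b := l) (by omega)
  have h2 := Int.emod_lt_of_pos d (b := l) (by omega)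
  have h3 := Int.emod_add_mul_ediv d l
  obtain ⟨c, hc⟩ : ∃ c : ℕ, (c : ℤ) = l - d % l := ⟨(l - d % l).toNat, by omega⟩
  have h4 : d = d / l * l + (l - c) := by rw [mul_comm]; omega
  refine ⟨c, by omega, by omega, h4, ?_⟩
  rw [(freeParticle_eq (by omega) (by omega) h4).2]
  refine ⟨by simp, by simp, fun n h5 h6 => ?_⟩
  simp [h5.symm, h6.symm]

theorem freeParticle_mul (hl : 1 ≤ l) (n : ℤ) : freeParticle l (n * l) = Finsupp.single n l := by
  rw [(freeParticle_eq hl le_rfl (by ring : n * l = n * l + (l - (l : ℕ)))).2]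
  simp

theorem freeParticle_mv (hl : 1 ≤ l) (d : ℤ) :
    Mv (d / l) (freeParticle l d) (freeParticle l (d + 1)) := by
  obtain ⟨c, h1, h2, h3, -⟩ := freeParticle_spec hl d
  have e1 := (freeParticle_eq h1 h2 h3).2
  -- When c = 1 the last unit leaves the site d / l, and the particle then sits entirely at the next
  -- site.
  obtain h | h := h1.eq_or_lt
  · have e2 := (freeParticle_eq (q := d / l + 1) (d := d + 1) hl le_rfl (by
      subst h; push_cast at h3; nlinarith)).2
    rw [Mv, e1, e2, ← h]
    ext n
    simp only [Finsupp.add_apply, Finsupp.single_apply]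
    split_ifs <;> omega
  · have e2 := (freeParticle_eq (q := d / l) (d := d + 1) (c := c - 1) (l := l) (by omega)
      (by omega) (by push_cast [h1]; omega)).2
    rw [Mv, e1, e2]
    ext n
    simp only [Finsupp.add_apply, Finsupp.single_apply]
    split_ifs <;> omega

theorem Mv.add_left (h : Mv i a b) (c : Conf) : Mv i (c + a) (c + b) := by
  unfold Mv at *
  rw [add_assoc, h, add_assoc]

theorem Mv.add_right (h : Mv i a b) (c : Conf) : Mv i (a + c) (b + c) := by
  rw [add_comm a, add_comm b]
  exact h.add_left c

theorem top_free {d : ℤ} (hl : 1 ≤ l) (hlk : l ≤ k)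
    (ha : ∀ n, d / l ≤ n → a n = 0) : Top k l (a + freeParticle l d) (d / l) := by
  obtain ⟨c, h1, h2, h3, h4, h5, h6⟩ := freeParticle_spec hl d
  set q := d / l
  have e : ∀ n, (a + freeParticle l d) n = a n + freeParticle l d n := fun n => rfl
  refine ⟨Or.inl ?_, fun w hw => ?_⟩
  · rw [S, e, e, ha _ le_rfl, ha _ (by omega), h4, h5]; omega
  · by_contra hlt
    have z : ∀ n, q + 2 ≤ n → (a + freeParticle l d) n = 0 := fun n hn => by
      rw [e, ha _ (by omega), h6 _ (by omega) (by omega)]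
    have z0 : (a + freeParticle l d) q = c := by rw [e, ha _ (by omega), h4, zero_add]
    have z1 : (a + freeParticle l d) (q + 1) = l - c := by rw [e, ha _ (by omega), h5, zero_add]
    simp only [Set.mem_ofPred_eq, HasParticle] at hw
    obtain rfl | rfl | hw3 : w = q + 1 ∨ w = q + 2 ∨ q + 3 ≤ w := by omega
    · rw [S, L, z (q + 1 + 1) (by omega), z (q + 1 + 2) (by omega), add_sub_cancel_right] at hw
      omega
    · rw [S, L, z (q + 2 + 1) (by omega), z (q + 2 + 2) (by omega), z (q + 2) (by omega),
        show q + 2 - 1 = q + 1 by ring] at hw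
      omega
    · rw [S, L, z (w - 1) (by omega), z w (by omega), z (w + 1) (by omega),
        z (w + 2) (by omega)] at hw
      omega

theorem rightMove_free {d : ℤ} (hl : 1 ≤ l) (hlk : l ≤ k) (hx : a + freeParticle l d ∈ C k l)
    (ha : ∀ n, d / l ≤ n → a n = 0) :
    rightMove k l (a + freeParticle l d) = a + freeParticle l (d + 1) :=
  (top_free hl hlk ha).rightMove_eq hx ((freeParticle_mv hl d).add_left a)

theorem iterate_free {d : ℤ} (hl : 1 ≤ l) (hlk : l ≤ k) (hx : a + freeParticle l d ∈ C k l)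
    (ha : ∀ n, d / l ≤ n → a n = 0) (t : ℕ) :
    (rightMove k l)^[t] (a + freeParticle l d) = a + freeParticle l (d + t) := by
  induction t with
  | zero => simp
  | succ t ih =>
    have h1 := (iterate_mem hl hx (top_free hl hlk ha) t).1
    rw [Function.iterate_succ_apply', ih]
    rw [ih] at h1
    rw [rightMove_free hl hlk h1 fun n hn => ha n ?_]
    · push_cast; rw [add_assoc]
    · exact (Int.ediv_le_ediv (by omega) (by omega)).trans hn

/-! ### Detaching the last particle -/

/-- The last particle of weight `l` of `a` becomes free under the right moves; it leaves `b`
behind, and `s` is its energy shifted by the number of moves. -/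
structure Detach (k l : ℕ) (a b : Conf) (s : ℤ) : Prop where
  mem : a ∈ C k l
  top : ∃ i, Top k l a i
  eq : ∃ t : ℕ, (rightMove k l)^[t] a = b + freeParticle l (s + t) ∧
    ∀ n, (s + t) / (l : ℤ) ≤ n → b n = 0

/-- A free particle to the right of everything stays free under right moves. Five empty sites before
it ensure that no S or L involving an entry of b involves one of the free particle. -/
theorem Detach.eventually (h : Detach k l a b σ) (hl : 1 ≤ l) (hlk : l ≤ k) (N : ℤ) :
    ∃ T : ℕ, ∀ t ≥ T, (rightMove k l)^[t] a = b + freeParticle l (σ + t) ∧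
      N ≤ (σ + t) / (l : ℤ) ∧ ∀ n, (σ + t) / (l : ℤ) - 5 ≤ n → b n = 0 := by
  obtain ⟨ha, ⟨i, hi⟩, t₀, ht, hb⟩ := h
  obtain ⟨M, -, hM⟩ := exists_bound b
  have hx := (iterate_mem hl ha hi t₀).1
  rw [ht] at hx
  refine ⟨t₀ + (l * (max N (M + 5)) - σ).toNat, fun t ht' => ?_⟩
  obtain ⟨u, rfl⟩ := Nat.exists_eq_add_of_le (show t₀ ≤ t by omega)
  have hq : max N (M + 5) ≤ (σ + (t₀ + u : ℕ)) / (l : ℤ) := by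
    rw [Int.le_ediv_iff_mul_le (by omega), mul_comm]
    have := Int.self_le_toNat (l * (max N (M + 5)) - σ)
    push_cast
    omega
  refine ⟨?_, (le_max_left _ _).trans hq, fun n hn => hM n (Or.inl ?_)⟩
  · rw [add_comm t₀ u, Function.iterate_add_apply, ht, iterate_free hl hlk hx hb]
    congr 2; push_cast; ring
  · have := (le_max_right N (M + 5)).trans hq
    omega

theorem Detach.iterate_mem (h : Detach k l a b σ) (hl : 1 ≤ l) (t : ℕ) :
    (rightMove k l)^[t] a ∈ C k l := by
  obtain ⟨i, hi⟩ := h.top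
  exact (RiggedConf.iterate_mem hl h.mem hi t).1

theorem Detach.mem_left (h : Detach k l a b σ) (hl : 1 ≤ l) : b ∈ C k l := by
  obtain ⟨t, ht, -⟩ := h.eq
  have := h.iterate_mem hl t
  rw [ht] at this
  exact C_of_le this le_self_add

theorem Detach.of_rightMove (ha : a ∈ C k l) (hi : Top k l a i)
    (h : Detach k l (rightMove k l a) b σ) : Detach k l a b (σ - 1) := by
  obtain ⟨-, -, t, ht, hb⟩ := h
  refine ⟨ha, ⟨i, hi⟩, t + 1, ?_, ?_⟩
  · rw [Function.iterate_succ_apply, ht]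
    congr 2; push_cast; ring
  · rw [show σ - 1 + (t + 1 : ℕ) = σ + t by push_cast; ring]
    exact hb

theorem Detach.rightMove (h : Detach k l a b σ) (hl : 1 ≤ l) (hlk : l ≤ k) :
    Detach k l (rightMove k l a) b (σ + 1) := by
  obtain ⟨i, hi⟩ := h.top
  obtain ⟨T, hT⟩ := h.eventually hl hlk 0
  obtain ⟨h1, -, h3⟩ := hT (T + 1) (by omega)
  have hm := RiggedConf.iterate_mem hl h.mem hi 1
  refine ⟨hi.mem_C h.mem, ⟨_, hm.2.choose_spec.2⟩, T, ?_, ?_⟩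
  · rw [← Function.iterate_succ_apply (RiggedConf.rightMove k l), h1]
    congr 2; push_cast; ring
  · rw [show σ + 1 + (T : ℤ) = σ + (T + 1 : ℕ) by push_cast; ring]
    exact fun n hn => h3 n (by omega)

/-- At a common late time both decompositions have the same highest position, and the entry there is
that of the free particle alone. So the free energies agree, and then the remainders. -/
theorem Detach.unique {b' : Conf} {σ' : ℤ} (h : Detach k l a b σ) (h' : Detach k l a b' σ')
    (hl : 1 ≤ l) (hlk : l ≤ k) : b = b' ∧ σ = σ' := by
  obtain ⟨T, hT⟩ := h.eventually hl hlk 0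
  obtain ⟨T', hT'⟩ := h'.eventually hl hlk 0
  obtain ⟨e1, -, e2⟩ := hT (T + T') (by omega)
  obtain ⟨e1', -, e2'⟩ := hT' (T + T') (by omega)
  have hx := h.iterate_mem hl (T + T')
  have hx' := hx
  rw [e1] at hx
  rw [e1'] at hx'
  have t1 := top_free (a := b) (d := σ + (T + T' : ℕ)) hl hlk fun n hn => e2 n (by omega)
  have t2 := top_free (a := b') (d := σ' + (T + T' : ℕ)) hl hlk fun n hn => e2' n (by omega)
  have he : b + freeParticle l (σ + (T + T' : ℕ)) = b' + freeParticle l (σ' + (T + T' : ℕ)) :=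
    e1.symm.trans e1'
  rw [he] at t1
  have hq := t1.unique t2
  obtain ⟨c, -, -, p3, p4, -, p6⟩ := freeParticle_spec hl (σ + (T + T' : ℕ))
  obtain ⟨c', -, -, p3', p4', -, p6'⟩ := freeParticle_spec hl (σ' + (T + T' : ℕ))
  have hv : ∀ n, b n + freeParticle l (σ + (T + T' : ℕ)) n =
      b' n + freeParticle l (σ' + (T + T' : ℕ)) n := fun n => DFunLike.congr_fun he n
  have hσ : σ + (T + T' : ℕ) = σ' + (T + T' : ℕ) := by
    have := hv ((σ + (T + T' : ℕ)) / (l : ℤ))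
    rw [p4, e2 _ (by omega), hq, p4', e2' _ (by omega)] at this
    rw [p3, p3', hq]; omega
  rw [hσ] at he
  exact ⟨add_right_cancel he, by omega⟩

/-- At a common late time both configurations have become equal, and right moves are injective. This
is the tool for identifying configurations in all that follows. -/
theorem Detach.inj {a' : Conf} (h : Detach k l a b σ) (h' : Detach k l a' b σ)
    (hl : 1 ≤ l) (hlk : l ≤ k) : a = a' := by
  obtain ⟨T, hT⟩ := h.eventually hl hlk 0
  obtain ⟨T', hT'⟩ := h'.eventually hl hlk 0
  obtain ⟨e1, -, e2⟩ := hT (T + T') (by omega)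
  obtain ⟨e1', -, e2'⟩ := hT' (T + T') (by omega)
  obtain ⟨i, hi⟩ := h.top
  obtain ⟨i', hi'⟩ := h'.top
  exact iterate_inj hl _ h.mem h'.mem hi hi' (e1.trans e1'.symm)

theorem Detach.iterate (h : Detach k l a b σ) (hl : 1 ≤ l) (hlk : l ≤ k) (n : ℕ) :
    Detach k l ((RiggedConf.rightMove k l)^[n] a) b (σ + n) := by
  induction n with
  | zero => simpa using h
  | succ n ih =>
    rw [Function.iterate_succ_apply']
    have := ih.rightMove hl hlk
    rwa [add_assoc] at this

theorem detach_free {d : ℤ} (hl : 1 ≤ l) (hlk : l ≤ k) (hx : b + freeParticle l d ∈ C k l)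
    (hb : ∀ n, d / l ≤ n → b n = 0) : Detach k l (b + freeParticle l d) b d :=
  ⟨hx, ⟨_, top_free hl hlk hb⟩, 0, by simp, by simpa using hb⟩

/-! ### Counting particles, and left sweeps of a detaching configuration -/

theorem Low.rightMove (h : Low a s) (ha : a ∈ C k l) (hi : Top k l a i) :
    Low (rightMove k l a) s := fun n hn => by
  have h1 := (hi.readyR ha).pos ha
  have h2 : s + 1 < i := by
    by_contra hlt
    have := h i (by omega)
    omega
  rw [(hi.mv ha).apply_of_ne (by omega) (by omega)]
  exact h n hn

/-- `a` has exactly `m` particles of weight `l`. -/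
def Num (k l : ℕ) (a : Conf) (m : ℕ) : Prop :=
  ∃ s js, Low a s ∧ PosL k l a s js ∧ js.length = m

theorem Num.posL {m : ℕ} (h : Num k l a m) (ha : a ∈ C k l) (hl : 1 ≤ l) (hs : Low a s) :
    ∃ js, PosL k l a s js ∧ js.length = m := by
  obtain ⟨s', js, h1, h2, h3⟩ := h
  exact ⟨js, h2.of_low h1 hs ha hl, h3⟩

theorem exists_num (hl : 1 ≤ l) (a : Conf) : ∃ m, Num k l a m := by
  obtain ⟨N, hN⟩ := exists_low a
  obtain ⟨js, hjs⟩ := exists_posL (k := k) hl a N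
  exact ⟨_, N, js, hN N le_rfl, hjs, rfl⟩

theorem Num.unique {m m' : ℕ} (h : Num k l a m) (h' : Num k l a m') (ha : a ∈ C k l)
    (hl : 1 ≤ l) : m = m' := by
  obtain ⟨s, js, h1, h2, rfl⟩ := h
  obtain ⟨js', h3, rfl⟩ := h'.posL ha hl h1
  rw [h2.unique h3]

theorem num_zero_iff (ha : a ∈ C k l) (hl : 1 ≤ l) :
    Num k l a 0 ↔ ∀ j, ¬ HasParticle k l a j := by
  constructor
  · rintro ⟨s, js, h1, h2, h3⟩ j hj
    obtain rfl := List.length_eq_zero_iff.1 h3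
    have h4 : PL k l a s = ∅ := h2
    have := h1.mem_PL ha hl hj
    simp [h4] at this
  · intro h
    obtain ⟨N, hN⟩ := exists_low a
    refine ⟨N, [], hN N le_rfl, ?_, rfl⟩
    ext j
    simp only [Set.mem_empty_iff_false, iff_false]
    exact fun hj => h j (hasParticle_of_mem_PL hj)

theorem PosL.iterate {js : List ℤ} (ha : a ∈ C k l) (hl : 1 ≤ l) (hi : Top k l a i)
    (hs : Low a s) (h : PosL k l a s js) (t : ℕ) :
    js ≠ [] ∧ Low ((rightMove k l)^[t] a) s ∧
      ∃ j, PosL k l ((rightMove k l)^[t] a) s (js.dropLast ++ [j]) := by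
  have hne : js ≠ [] := by
    rintro rfl
    have h4 : PL k l a s = ∅ := h
    have := hs.mem_PL ha hl hi.1
    simp [h4] at this
  refine ⟨hne, ?_⟩
  induction t with
  | zero => exact ⟨hs, js.getLast hne, by rwa [List.dropLast_append_getLast]⟩
  | succ t ih =>
    obtain ⟨h1, j, h2⟩ := ih
    obtain ⟨m1, i', -, m2⟩ := iterate_mem hl ha hi t
    rw [Function.iterate_succ_apply']
    obtain ⟨-, h3⟩ := h2.of_mv m1 m2 (m2.mv m1) (h1.mem_PL m1 hl m2.1)
    rw [List.dropLast_concat] at h3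
    exact ⟨h1.rightMove m1 m2, _, h3⟩

theorem PosL.add_free {d : ℤ} {js : List ℤ} (hl : 1 ≤ l) (hlk : l ≤ k)
    (ha : ∀ n, d / l - 5 ≤ n → a n = 0) (hs : s ≤ d / l) (h : PosL k l a s js) :
    ∃ j, PosL k l (a + freeParticle l d) s (js ++ [j]) := by
  have ht := top_free (a := a) (d := d) hl hlk fun n hn => ha n (by omega)
  obtain ⟨c, h1, h2, -, h4, h5, h6⟩ := freeParticle_spec hl d
  set q := d / l
  set x := a + freeParticle l d
  have e : ∀ n, x n = a n + freeParticle l d n := fun n => rfl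
  have e' : ∀ n, n < q → x n = a n := fun n hn => by rw [e, h6 n (by omega) (by omega), add_zero]
  have hSL : ∀ w, w ≤ q - 3 → S x w = S a w ∧ L x w = L a w := fun w hw => by
    rw [S, S, L, L, e' _ (by omega), e' _ (by omega), e' _ (by omega), e' _ (by omega)]
    exact ⟨rfl, rfl⟩
  have hSq : S x q = l := by
    rw [S, e, e, h4, h5, ha _ (by omega), ha _ (by omega)]; omega
  induction js generalizing s with
  | nil =>
    have h : PL k l a s = ∅ := h
    have hq : q ∈ PL k l x s := Or.inl ⟨hs, hSq⟩
    obtain ⟨j, hj⟩ := exists_least_PL hq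
    have hjq := hj.2 hq
    have hj3 : q - 2 ≤ j := by
      by_contra hlt
      have h7 : j ∈ PL k l a s := by
        have := hj.1
        simp only [PL, Set.mem_ofPred_eq] at this ⊢
        rwa [(hSL j (by omega)).1, (hSL j (by omega)).2] at this
      simp [h] at h7
    have hj2 : j ≠ q - 2 := by
      rintro rfl
      have h7 := hasParticle_of_mem_PL hj.1
      rw [HasParticle, S, L, e' _ (by omega), e' (q - 2 + 1) (by omega),
        e' (q - 2 - 1) (by omega), show q - 2 + 2 = q by ring, e, h4,
        ha _ (by omega), ha _ (by omega), ha _ (by omega), ha _ (by omega)] at h7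
      omega
    refine ⟨j, hj, ?_⟩
    ext w
    simp only [Set.mem_empty_iff_false, iff_false]
    intro hw
    have h8 := le_of_mem_PL hw
    have h9 := ht.2 (hasParticle_of_mem_PL hw)
    omega
  | cons j js ih =>
    obtain ⟨w, hw1, hw2, hw3⟩ := (hasParticle_of_mem_PL h.1.1).exists_ne hl
    have hjq : j ≤ q - 5 := by
      by_contra hlt
      exact hw3 (ha w (by omega))
    obtain ⟨j', hj'⟩ := ih (s := j + 2) h.2 (by omega)
    refine ⟨j', ⟨?_, fun w hw => ?_⟩, hj'⟩
    · have := h.1.1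
      simp only [PL, Set.mem_ofPred_eq] at this ⊢
      rwa [(hSL j (by omega)).1, (hSL j (by omega)).2]
    · by_contra hlt
      simp only [PL, Set.mem_ofPred_eq] at hw
      rw [(hSL w (by omega)).1, (hSL w (by omega)).2] at hw
      have := h.1.2 hw
      omega

/-- Right moves change only the last entry of the list of positions, and at a late time the
configuration is b with one far-away free particle, whose list is that of b with one entry added. -/
theorem Detach.posL {js : List ℤ} (h : Detach k l a b σ) (hl : 1 ≤ l) (hlk : l ≤ k)
    (hs : Low a s) (hp : PosL k l b s js) : ∃ j, PosL k l a s (js ++ [j]) := by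
  obtain ⟨i, hi⟩ := h.top
  obtain ⟨js', hjs'⟩ := exists_posL (k := k) hl a s
  obtain ⟨T, hT⟩ := h.eventually hl hlk s
  obtain ⟨e1, e2, e3⟩ := hT T le_rfl
  obtain ⟨hne, -, j', hj'⟩ := hjs'.iterate h.mem hl hi hs T
  rw [e1] at hj'
  obtain ⟨j'', hj''⟩ := hp.add_free hl hlk e3 e2
  have := (List.append_inj' (hj'.unique hj'') rfl).1
  refine ⟨js'.getLast hne, ?_⟩
  rwa [← this, List.dropLast_append_getLast]

theorem Detach.num {m : ℕ} (h : Detach k l a b σ) (hl : 1 ≤ l) (hlk : l ≤ k)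
    (hm : Num k l b m) : Num k l a (m + 1) := by
  obtain ⟨N, hN⟩ := exists_low a
  obtain ⟨N', hN'⟩ := exists_low b
  obtain ⟨js, h1, rfl⟩ := hm.posL (h.mem_left hl) hl (hN' (min N N') (min_le_right _ _))
  have hs := hN (min N N') (min_le_left _ _)
  obtain ⟨j, hj⟩ := h.posL hl hlk hs h1
  exact ⟨_, _, hs, hj, by simp⟩

theorem Num.sweep {m : ℕ} (h : Num k l a m) (ha : a ∈ C k l) (hl : 1 ≤ l) :
    leftSweep k l m a ∈ C k l ∧ Num k l (leftSweep k l m a) m := by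
  obtain ⟨N, hN⟩ := exists_low a
  obtain ⟨js, h1, rfl⟩ := h.posL ha hl (hN (N - 1) (by omega))
  have h2 := h1.swept ha hl (hN _ (by omega)) le_rfl
  obtain ⟨js', h3, h4⟩ := h2.pos
  rw [List.drop_length, List.append_nil] at h4
  exact ⟨h2.mem, _, _, h2.low, h4, h3⟩

/-- The right move undoes the final left move of the sweep, and the remaining m left moves commute
with all right moves. So one may first free the last particle and then sweep b alone; the undone
move accounts for the energy -1. -/
theorem Detach.sweep {m : ℕ} (h : Detach k l a b σ) (hl : 1 ≤ l) (hlk : l ≤ k)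
    (hm : Num k l b m) :
    Detach k l (leftSweep k l (m + 1) a) (leftSweep k l m b) (σ - 1) := by
  obtain ⟨N₁, hN₁⟩ := exists_low a
  obtain ⟨N₂, hN₂⟩ := exists_low b
  set s := min N₁ N₂ - 1
  have hsa : Low a (s + 1) := hN₁ _ (by omega)
  have hsb : Low b (s + 1) := hN₂ _ (by omega)
  have hb := h.mem_left hl
  obtain ⟨i, hi⟩ := h.top
  obtain ⟨js, hjs, rfl⟩ := hm.posL hb hl (hsb.mono (by omega : s ≤ s + 1))
  obtain ⟨j, hj⟩ := h.posL hl hlk (hsa.mono (by omega)) hjs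
  obtain ⟨e, i', hi'⟩ := hj.sweep_last h.mem hl hsa
  have hmem := (hj.swept h.mem hl hsa (n := js.length + 1) (by simp)).mem
  have h1 := hj.swept h.mem hl hsa (n := js.length) (by simp)
  refine Detach.of_rightMove hmem hi' ?_
  rw [e]
  refine ⟨h1.mem, ⟨i, h1.top (by simp) i hi⟩, ?_⟩
  have comm : ∀ t, Low ((RiggedConf.rightMove k l)^[t] a) (s + 1) ∧
      (∃ j, PosL k l ((RiggedConf.rightMove k l)^[t] a) s (js ++ [j])) ∧
      (RiggedConf.rightMove k l)^[t] (leftSweep k l js.length a) =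
        leftSweep k l js.length ((RiggedConf.rightMove k l)^[t] a) := by
    intro t
    induction t with
    | zero => exact ⟨hsa, ⟨j, hj⟩, rfl⟩
    | succ t ih =>
      obtain ⟨i1, ⟨j', i2⟩, i3⟩ := ih
      obtain ⟨m1, i', -, m2⟩ := RiggedConf.iterate_mem hl h.mem hi t
      obtain ⟨-, -, j'', hj''⟩ := hj.iterate h.mem hl hi (hsa.mono (by omega)) (t + 1)
      rw [List.dropLast_concat] at hj''
      rw [Function.iterate_succ_apply'] at hj'' ⊢
      refine ⟨i1.rightMove m1 m2, ⟨j'', hj''⟩, ?_⟩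
      rw [Function.iterate_succ_apply', i3]
      exact i2.sweep_rightMove m1 hl i1 m2 hj''
  obtain ⟨M, -, hM⟩ := exists_bound (leftSweep k l js.length b)
  obtain ⟨T, hT⟩ := h.eventually hl hlk M
  obtain ⟨e1, e2, e3⟩ := hT T le_rfl
  refine ⟨T, ?_, fun n hn => hM n (Or.inl (by omega))⟩
  obtain ⟨c1, ⟨j', c2⟩, c3⟩ := comm T
  rw [c3]
  have hx := h.iterate_mem hl T
  have s1 := (c2.swept hx hl c1 (n := js.length) (by simp)).eq
  have s2 := (hjs.swept hb hl hsb (n := js.length) le_rfl).eq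
  simp only [List.take_left', List.take_length] at s1 s2
  -- The sweep of b plus the far free particle and the sweep of b displace units at the same
  -- positions, so the free particle is carried along untouched.
  refine add_right_cancel (b := (js.map fun j => Finsupp.single (j + 1) 1).sum) ?_
  rw [s1, e1]
  calc _ = (b + (js.map fun j => Finsupp.single j 1).sum) + freeParticle l (σ + T) := by abel
    _ = _ := by rw [← s2]; abel

/-! ### The order of the riggings -/

/-- The positions of the particles of weight `l` of `a` cut off to the sites `< s`. -/
def PR (k l : ℕ) (a : Conf) (s : ℤ) : Set ℤ :=
  {j | (j ≤ s - 2 ∧ S a j = l) ∨ (j ≤ s - 3 ∧ L a j = k + l)}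

/-- The move makes S and L directly left of i strictly smaller than their bounds, so advancing the
cut together with the last particle reveals nothing new. -/
theorem PR_rightMove (ha : a ∈ C k l) (hl : 1 ≤ l) (hi : Top k l a i)
    (hj : Top k l (rightMove k l a) j) : PR k l (rightMove k l a) j = PR k l a i := by
  have hm := hi.mv ha
  have hb := hi.mem_C ha
  obtain ⟨r1, r2, r3, r4⟩ := readyL_of_mv hm ha hi.1
  have hor : j = i ∨ j = i + 1 ∨ j = i + 2 ∧ S (rightMove k l a) i < l := by
    rcases hi.of_mv ha hl hm with h | h | ⟨h, h', -⟩
    exacts [Or.inl (hj.unique h), Or.inr (Or.inl (hj.unique h)),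
      Or.inr (Or.inr ⟨hj.unique h, h'⟩)]
  ext w
  simp only [PR, Set.mem_ofPred_eq]
  by_cases w1 : w = i - 1
  · subst w1; omega
  by_cases w2 : w = i - 2
  · subst w2
    rw [hm.S_of_ne (j := i - 2) (by omega) (by omega)]; omega
  by_cases w3 : w = i
  · subst w3; omega
  by_cases w4 : i < w
  · omega
  rw [hm.S_of_ne (j := w) (by omega) (by omega),
    hm.L_of_ne (j := w) (by omega) (by omega) (by omega) (by omega)]
  omega

theorem PR_iterate (ha : a ∈ C k l) (hl : 1 ≤ l) (hi : Top k l a i) (t : ℕ)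
    (hj : Top k l ((rightMove k l)^[t] a) j) : PR k l ((rightMove k l)^[t] a) j = PR k l a i := by
  induction t generalizing j with
  | zero => rw [hi.unique hj]; rfl
  | succ t ih =>
    obtain ⟨m1, i', -, m2⟩ := iterate_mem hl ha hi t
    rw [Function.iterate_succ_apply'] at hj ⊢
    rw [PR_rightMove m1 hl m2 hj, ih m2]

/-- After a right move of the last particle, the last but one may be moved, too. -/
theorem readyR_second (ha : a ∈ C k l) (hi : Top k l a i) (hj : IsGreatest (PR k l a i) j) :
    ReadyR k l (rightMove k l a) j := by
  have hm := hi.mv ha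
  obtain ⟨r1, r2, r3, r4⟩ := readyL_of_mv hm ha hi.1
  obtain ⟨q1, q2, q3, q4⟩ := hi.readyR ha
  have hS : ∀ j, j ≠ i - 1 → j ≠ i + 1 → S (rightMove k l a) j = S a j :=
    fun j h1 h2 => hm.S_of_ne h1 h2
  have hL : ∀ j, j ≠ i - 2 → j ≠ i - 1 → j ≠ i + 1 → j ≠ i + 2 → L (rightMove k l a) j = L a j :=
    fun j h1 h2 h3 h4 => hm.L_of_ne h1 h2 h3 h4
  have hj1 := hj.1
  simp only [PR, Set.mem_ofPred_eq] at hj1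
  have hmax : ∀ w, j < w → (w ≤ i - 2 → S a w < l) ∧ (w ≤ i - 3 → L a w < k + l) := by
    intro w h1
    have h3 : w ∉ PR k l a i := fun h => by have := hj.2 h; omega
    simp only [PR, Set.mem_ofPred_eq] at h3
    have := ha.2.1 w; have := ha.2.2 w
    omega
  refine ⟨?_, ?_, ?_, ?_⟩
  · unfold HasParticle
    rw [hS j (by omega) (by omega)]
    by_cases h : j = i - 2
    · left; omega
    rw [hL j (by omega) (by omega) (by omega) (by omega)]
    omega
  · by_cases h : j = i - 2
    · subst h; rw [show i - 2 + 1 = i - 1 by ring]; exact r2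
    rw [hS _ (by omega) (by omega)]
    exact (hmax _ (by omega)).1 (by omega)
  · by_cases h : j = i - 2
    · subst h; rw [show i - 2 + 1 = i - 1 by ring]; exact r3
    by_cases h' : j = i - 3
    · subst h'; rw [show i - 3 + 1 = i - 2 by ring]; exact r4
    rw [hL _ (by omega) (by omega) (by omega) (by omega)]
    exact (hmax _ (by omega)).2 (by omega)
  · by_cases h : j = i - 2
    · subst h
      -- S is sharp at i - 2, so the bound on L at i - 1 gives S (i - 1) + S i ≤ k, and S (i + 1) <
      -- l keeps L at i below k + l.
      rw [show i - 2 + 2 = i by ring, hL i (by omega) (by omega) (by omega) (by omega)]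
      have := values a i; have := bounds ha i
      unfold HasParticle at q1
      omega
    by_cases h' : j = i - 3
    · subst h'; rw [show i - 3 + 2 = i - 1 by ring]; exact r3
    by_cases h'' : j = i - 4
    · subst h''; rw [show i - 4 + 2 = i - 2 by ring]; exact r4
    rw [hL _ (by omega) (by omega) (by omega) (by omega)]
    exact (hmax _ (by omega)).2 (by omega)

/-- `b` arises from `a` by moving the last two particles of weight `l` to the right. -/
def Kick (k l : ℕ) (a b : Conf) : Prop :=
  ∃ i j, Top k l a i ∧ IsGreatest (PR k l a i) j ∧ Mv j (rightMove k l a) b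

/-- The displacement of the second particle affects neither the highest position after the next move
nor, by `PR_rightMove`, its own position j; hence it persists as the same unit move under further
right moves. -/
theorem Kick.step (ha : a ∈ C k l) (hl : 1 ≤ l) (h : Kick k l a b) :
    b ∈ C k l ∧ (∃ i, Top k l b i) ∧ Kick k l (rightMove k l a) (rightMove k l b) := by
  obtain ⟨i, j, hi, hj, hm⟩ := h
  have ha' := hi.mem_C ha
  have hr := readyR_second ha hi hj
  have hb := C_of_mv hm ha' hr
  obtain ⟨-, i', hii, hi'⟩ := iterate_mem hl ha hi 1
  have hii' : i ≤ i' := hii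
  replace hi' : Top k l (rightMove k l a) i' := hi'
  have hji : j ≤ i - 2 := by
    have := hj.1
    simp only [PR, Set.mem_ofPred_eq] at this
    omega
  have d1 := hm.S_succ; have d2 := hm.L_eq
  have ht : Top k l b i' := by
    refine ⟨?_, fun w hw => ?_⟩
    · have h1 := hi'.1
      simp only [Set.mem_ofPred_eq, HasParticle] at h1 ⊢
      rw [hm.S_of_ne (j := i') (by omega) (by omega)]
      by_cases h : i' = j + 2
      · subst h
        have := hb.2.2 (j + 2)
        omega
      rwa [hm.L_of_ne (j := i') (by omega) (by omega) (by omega) (by omega)]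
    · by_contra hlt
      refine hlt (hi'.2 ?_)
      simp only [Set.mem_ofPred_eq, HasParticle] at hw ⊢
      rwa [hm.S_of_ne (j := w) (by omega) (by omega),
        hm.L_of_ne (j := w) (by omega) (by omega) (by omega) (by omega)] at hw
  refine ⟨hb, ⟨i', ht⟩, i', j, hi', ?_, ?_⟩
  · rwa [PR_rightMove ha hl hi hi']
  · have m1 := hi'.mv ha'
    have m2 := ht.mv hb
    unfold Mv at *
    refine add_right_cancel (b := Finsupp.single i' 1) ?_
    calc _ = (rightMove k l (rightMove k l a) + Finsupp.single i' 1) +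
          Finsupp.single (j + 1) 1 := by abel
      _ = (rightMove k l a + Finsupp.single (j + 1) 1) + Finsupp.single (i' + 1) 1 := by
          rw [← m1]; abel
      _ = (b + Finsupp.single (i' + 1) 1) + Finsupp.single j 1 := by rw [hm]; abel
      _ = _ := by rw [m2]; abel

theorem PR_free {d : ℤ} (hl : 1 ≤ l) (ha : ∀ n, d / l - 5 ≤ n → a n = 0) :
    PR k l (a + freeParticle l d) (d / l) = {j | HasParticle k l a j} := by
  obtain ⟨c, -, -, -, -, -, h6⟩ := freeParticle_spec hl d
  set q := d / l
  have e : ∀ n, n < q → (a + freeParticle l d) n = a n := fun n hn => by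
    rw [Finsupp.add_apply, h6 n (by omega) (by omega), add_zero]
  ext w
  simp only [PR, Set.mem_ofPred_eq]
  constructor
  · rintro (⟨h1, h2⟩ | ⟨h1, h2⟩)
    · rw [S, e _ (by omega), e _ (by omega)] at h2
      exact Or.inl h2
    · rw [L, e _ (by omega), e _ (by omega), e _ (by omega), e _ (by omega)] at h2
      exact Or.inr h2
  · intro hw
    obtain ⟨n, h1, h2, h3⟩ := hw.exists_ne hl
    have h4 : w ≤ q - 5 := by
      by_contra hlt
      exact h3 (ha n (by omega))
    rw [S, L, e _ (by omega), e _ (by omega), e _ (by omega), e _ (by omega)]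
    exact hw.imp (fun h => ⟨by omega, h⟩) fun h => ⟨by omega, h⟩

/-- Push the second particle along with the last one. The extra displacement is carried unchanged to
a late time, where it is the right move of b next to a free particle that is one move ahead. -/
theorem Detach.kick (h : Detach k l a b σ) (hl : 1 ≤ l) (hlk : l ≤ k) (hj : Top k l b j) :
    ∃ a', Detach k l a' (RiggedConf.rightMove k l b) (σ + 1) := by
  obtain ⟨i, hi⟩ := h.top
  have hb := h.mem_left hl
  obtain ⟨T, hT⟩ := h.eventually hl hlk 0
  have hPR : ∀ t ≥ T, IsGreatest (PR k l ((RiggedConf.rightMove k l)^[t] a)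
      ((σ + t) / (l : ℤ))) j ∧ Top k l ((RiggedConf.rightMove k l)^[t] a) ((σ + t) / (l : ℤ)) := by
    intro t ht
    obtain ⟨e1, e2, e3⟩ := hT t ht
    rw [e1, PR_free hl e3]
    exact ⟨hj, top_free hl hlk fun n hn => e3 n (by omega)⟩
  obtain ⟨a', ha'⟩ : ∃ a', Kick k l a a' := by
    obtain ⟨p1, p2⟩ := hPR T le_rfl
    rw [PR_iterate h.mem hl hi T p2] at p1
    exact ⟨_, i, j, hi, p1, mv_right ((readyR_second h.mem hi p1).pos (hi.mem_C h.mem))⟩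
  have hit : ∀ t, Kick k l ((RiggedConf.rightMove k l)^[t] a)
      ((RiggedConf.rightMove k l)^[t] a') := by
    intro t
    induction t with
    | zero => exact ha'
    | succ t ih =>
      rw [Function.iterate_succ_apply', Function.iterate_succ_apply']
      exact (ih.step (h.iterate_mem hl t) hl).2.2
  obtain ⟨q1, ⟨i', q2⟩, -⟩ := ha'.step h.mem hl
  obtain ⟨M, -, hM⟩ := exists_bound (RiggedConf.rightMove k l b)
  obtain ⟨T', hT'⟩ := h.eventually hl hlk M
  refine ⟨a', q1, ⟨i', q2⟩, T + T', ?_, fun n hn => hM n (Or.inl ?_)⟩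
  · obtain ⟨e1, e2, e3⟩ := hT (T + T') (by omega)
    obtain ⟨i₁, j₁, k1, k2, k3⟩ := hit (T + T')
    obtain ⟨p1, p2⟩ := hPR (T + T') (by omega)
    obtain rfl := k1.unique p2
    obtain rfl := k2.unique p1
    have hx := h.iterate_mem hl (T + T')
    rw [e1] at k3 hx
    rw [rightMove_free hl hlk hx fun n hn => e3 n (by omega)] at k3
    rw [show σ + 1 + ((T + T' : ℕ) : ℤ) = σ + (T + T' : ℕ) + 1 by ring]
    exact k3.right_unique ((hj.mv hb).add_right _)
  · refine (hT' (T + T') (by omega)).2.1.trans (le_trans ?_ hn)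
    exact Int.ediv_le_ediv (by omega) (by omega)

theorem Detach.kick_iterate (h : Detach k l a b σ) (hl : 1 ≤ l) (hlk : l ≤ k)
    (hj : Top k l b j) (n : ℕ) :
    ∃ a', Detach k l a' ((RiggedConf.rightMove k l)^[n] b) (σ + n) := by
  induction n with
  | zero => exact ⟨a, by simpa using h⟩
  | succ n ih =>
    obtain ⟨a', ha'⟩ := ih
    obtain ⟨-, j', -, hj'⟩ := RiggedConf.iterate_mem hl (h.mem_left hl) hj n
    obtain ⟨a'', ha''⟩ := ha'.kick hl hlk hj'
    refine ⟨a'', ?_⟩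
    rw [Function.iterate_succ_apply', Nat.cast_succ, ← add_assoc]
    exact ha''

/-! ### Admissible distances between free particles -/

theorem add_free_mem {d q : ℤ} {c : ℕ} (hlk : l ≤ k) (h1 : 1 ≤ c) (h2 : c ≤ l)
    (hd : d = q * l + (l - c)) (hb : b ∈ C k l) (hz : ∀ n, q ≤ n → b n = 0)
    (e1 : b (q - 1) + l ≤ k) (e2 : b (q - 1) + c ≤ l) (e3 : b (q - 2) + 2 * b (q - 1) + c ≤ k)
    (e4 : b (q - 3) + 2 * b (q - 2) + 2 * b (q - 1) + c ≤ k + l) (e5 : b (q - 1) + 2 * l ≤ k + l) :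
    b + freeParticle l d ∈ C k l := by
  rw [(freeParticle_eq h1 h2 hd).2]
  set x := b + (Finsupp.single q c + Finsupp.single (q + 1) (l - c)) with hx
  have x1 : ∀ n, n < q → x n = b n := fun n hn => by
    rw [hx, Finsupp.add_apply, Finsupp.add_apply, Finsupp.single_eq_of_ne (by omega),
      Finsupp.single_eq_of_ne (by omega)]
    rfl
  have x2 : x q = c := by simp [hx, hz q le_rfl]
  have x3 : x (q + 1) = l - c := by simp [hx, hz (q + 1) (by omega)]
  have x4 : ∀ n, q + 1 < n → x n = 0 := fun n hn => by
    rw [hx, Finsupp.add_apply, Finsupp.add_apply, Finsupp.single_eq_of_ne (by omega),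
      Finsupp.single_eq_of_ne (by omega), hz n (by omega)]
    rfl
  clear_value x
  have y1 := x1 (q - 1) (by omega)
  have y2 := x1 (q - 2) (by omega)
  have y3 := x1 (q - 3) (by omega)
  refine ⟨fun w => ?_, fun w => ?_, fun w => ?_⟩
  · by_cases w1 : w ≤ q - 3
    · rw [x1 _ (by omega), x1 _ (by omega), x1 _ (by omega)]
      exact hb.1 w
    obtain rfl | rfl | rfl | rfl | h : w = q - 2 ∨ w = q - 1 ∨ w = q ∨ w = q + 1 ∨ q + 2 ≤ w := by
      omega
    · rw [show q - 2 + 1 = q - 1 by ring, show q - 2 + 2 = q by ring]; omega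
    · rw [show q - 1 + 1 = q by ring, show q - 1 + 2 = q + 1 by ring]; omega
    · have := x4 (w + 2) (by omega); omega
    · have := x4 (q + 1 + 1) (by omega); have := x4 (q + 1 + 2) (by omega); omega
    · have := x4 w (by omega); have := x4 (w + 1) (by omega); have := x4 (w + 2) (by omega); omega
  · by_cases w1 : w ≤ q - 2
    · rw [S, x1 _ (by omega), x1 _ (by omega)]
      exact hb.2.1 w
    unfold S
    obtain rfl | rfl | rfl | h : w = q - 1 ∨ w = q ∨ w = q + 1 ∨ q + 2 ≤ w := by
      omega
    · rw [show q - 1 + 1 = q by ring]; omega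
    · omega
    · have := x4 (q + 1 + 1) (by omega); omega
    · have := x4 w (by omega); have := x4 (w + 1) (by omega); omega
  · by_cases w1 : w ≤ q - 3
    · rw [L, x1 _ (by omega), x1 _ (by omega), x1 _ (by omega), x1 _ (by omega)]
      exact hb.2.2 w
    unfold L
    obtain rfl | rfl | rfl | rfl | rfl | h :
      w = q - 2 ∨ w = q - 1 ∨ w = q ∨ w = q + 1 ∨ w = q + 2 ∨ q + 3 ≤ w := by omega
    · rw [show q - 2 - 1 = q - 3 by ring, show q - 2 + 1 = q - 1 by ring,
        show q - 2 + 2 = q by ring]; omega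
    · rw [show q - 1 - 1 = q - 2 by ring, show q - 1 + 1 = q by ring,
        show q - 1 + 2 = q + 1 by ring]; omega
    · have := x4 (w + 2) (by omega); omega
    · have := x4 (q + 1 + 1) (by omega); have := x4 (q + 1 + 2) (by omega)
      rw [add_sub_cancel_right]; omega
    · have := x4 (q + 2 + 1) (by omega); have := x4 (q + 2 + 2) (by omega)
      have := x4 (q + 2) (by omega)
      rw [show q + 2 - 1 = q + 1 by ring]; omega
    · have := x4 w (by omega); have := x4 (w + 1) (by omega); have := x4 (w + 2) (by omega)
      have := x4 (w - 1) (by omega); omega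

theorem add_free_mem_of_far {d : ℤ} (hl : 1 ≤ l) (hlk : l ≤ k) (hb : b ∈ C k l)
    (hz : ∀ n, d / l - 3 ≤ n → b n = 0) : b + freeParticle l d ∈ C k l := by
  obtain ⟨c, h1, h2, h3, -⟩ := freeParticle_spec hl d
  have z1 := hz (d / l - 1) (by omega)
  have z2 := hz (d / l - 2) (by omega)
  have z3 := hz (d / l - 3) (by omega)
  exact add_free_mem hlk h1 h2 h3 hb (fun n hn => hz n (by omega)) (by omega) (by omega)
    (by omega) (by omega) (by omega)

/-- The relative position of two free particles whose energies differ by at least `A_{l,l}`. -/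
theorem gap {d d' : ℤ} {q q' : ℤ} {c c' : ℕ} (h1 : 1 ≤ c)
    (h3 : d = q * l + (l - c)) (h2' : c' ≤ l) (h3' : d' = q' * l + (l - c'))
    (hd : d' + A k l l ≤ d) :
    q = q' + 2 ∧ c + (2 * l - k) ≤ c' ∨ q = q' + 3 ∧ c + (2 * l - k) ≤ c' + l ∨ q' + 4 ≤ q := by
  have hA : A k l l = 2 * l + (2 * l - k) := by simp only [A, min_self]; omega
  have h4 : q' + 2 ≤ q := by
    by_contra hlt
    have : (q - q') * (l : ℤ) ≤ 1 * l := mul_le_mul_of_nonneg_right (by omega) (by omega)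
    have : d - d' = (q - q') * l + c' - c := by rw [h3, h3']; ring
    omega
  obtain rfl | rfl | h : q = q' + 2 ∨ q = q' + 3 ∨ q' + 4 ≤ q := by omega
  · left
    have : d - d' = 2 * l + c' - c := by rw [h3, h3']; ring
    omega
  · right; left
    have : d - d' = 3 * l + c' - c := by rw [h3, h3']; ring
    omega
  · omega

/-- The part 2l of A_{l,l} separates the particles by at least two sites, and the part (2l - k)_+ is
the excess that the triple and L inequalities demand when they are two or three sites apart. -/
theorem add_free_free_mem {d d' : ℤ} (hl : 1 ≤ l) (hlk : l ≤ k)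
    (hb : b + freeParticle l d' ∈ C k l) (hz : ∀ n, d' / l ≤ n → b n = 0)
    (hd : d' + A k l l ≤ d) :
    b + freeParticle l d' + freeParticle l d ∈ C k l ∧
      ∀ n, d / l ≤ n → (b + freeParticle l d') n = 0 := by
  obtain ⟨c, h1, h2, h3, -⟩ := freeParticle_spec hl d
  obtain ⟨c', h1', h2', h3', h4', h5', h6'⟩ := freeParticle_spec hl d'
  have hg := gap h1 h3 h2' h3' hd
  set q := d / l
  set q' := d' / l
  set x := b + freeParticle l d' with hx
  have x0 : x q' = c' := by rw [hx, Finsupp.add_apply, hz _ le_rfl, h4', zero_add]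
  have x1 : x (q' + 1) = l - c' := by rw [hx, Finsupp.add_apply, hz _ (by omega), h5', zero_add]
  have x2 : ∀ n, q' + 2 ≤ n → x n = 0 := fun n hn => by
    rw [hx, Finsupp.add_apply, hz _ (by omega), h6' _ (by omega) (by omega)]
  have hz' : ∀ n, q ≤ n → x n = 0 := fun n hn => x2 n (by omega)
  have hS := hb.2.1 (q' - 1)
  rw [S, show q' - 1 + 1 = q' by ring] at hS
  refine ⟨?_, hz'⟩
  rcases hg with ⟨hq, hc⟩ | ⟨hq, hc⟩ | hq
  · have y1 : x (q - 1) = l - c' := by rw [hq, show q' + 2 - 1 = q' + 1 by ring, x1]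
    have y2 : x (q - 2) = c' := by rw [hq, show q' + 2 - 2 = q' by ring, x0]
    have y3 : x (q - 3) = x (q' - 1) := by rw [hq, show q' + 2 - 3 = q' - 1 by ring]
    exact add_free_mem hlk h1 h2 h3 hb hz' (by omega) (by omega) (by omega) (by omega) (by omega)
  · have y1 : x (q - 1) = 0 := x2 _ (by omega)
    have y2 : x (q - 2) = l - c' := by rw [hq, show q' + 3 - 2 = q' + 1 by ring, x1]
    have y3 : x (q - 3) = c' := by rw [hq, show q' + 3 - 3 = q' by ring, x0]
    exact add_free_mem hlk h1 h2 h3 hb hz' (by omega) (by omega) (by omega) (by omega) (by omega)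
  · have y1 : x (q - 1) = 0 := x2 _ (by omega)
    have y2 : x (q - 2) = 0 := x2 _ (by omega)
    have y3 : x (q - 3) ≤ l := by
      obtain h | h : q = q' + 4 ∨ q' + 5 ≤ q := by omega
      · rw [h, show q' + 4 - 3 = q' + 1 by ring]; omega
      · rw [x2 _ (by omega)]; omega
    exact add_free_mem hlk h1 h2 h3 hb hz' (by omega) (by omega) (by omega) (by omega) (by omega)

/-- Two free particles whose energies differ by `A_{l,l}` cannot come closer to each other. -/
theorem not_rightMove_eq {d d' : ℤ} (hl : 1 ≤ l) (hlk : l ≤ k)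
    (hz : ∀ n, d' / l ≤ n → b n = 0) (hd : d = d' + A k l l) (ha : a ∈ C k l) (hi : Top k l a i)
    (h : rightMove k l a = b + freeParticle l d' + freeParticle l d) : False := by
  obtain ⟨c, h1, h2, h3, h4, h5, h6⟩ := freeParticle_spec hl d
  obtain ⟨c', h1', h2', h3', h4', h5', h6'⟩ := freeParticle_spec hl d'
  have hA : A k l l = 2 * l + (2 * l - k) := by simp only [A, min_self]; omega
  have hg := gap h1 h3 h2' h3' hd.ge
  have hm := hi.mv ha
  rw [h] at hm
  set q := d / l
  set q' := d' / l
  set x := b + freeParticle l d' with hx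
  have x0 : x q' = c' := by rw [hx, Finsupp.add_apply, hz _ le_rfl, h4', zero_add]
  have x1 : x (q' + 1) = l - c' := by rw [hx, Finsupp.add_apply, hz _ (by omega), h5', zero_add]
  have x2 : ∀ n, q' + 2 ≤ n → x n = 0 := fun n hn => by
    rw [hx, Finsupp.add_apply, hz _ (by omega), h6' _ (by omega) (by omega)]
  have hg' : q = q' + 2 ∧ c' = c + (2 * l - k) ∨ q = q' + 3 ∧ c' + l = c + (2 * l - k) := by
    rcases hg with ⟨hq, hc⟩ | ⟨hq, hc⟩ | hq
    · left
      have : d - d' = 2 * l + c' - c := by rw [h3, h3', hq]; ring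
      omega
    · right
      have : d - d' = 3 * l + c' - c := by rw [h3, h3', hq]; ring
      omega
    · exfalso
      have : 4 * (l : ℤ) ≤ (q - q') * l := mul_le_mul_of_nonneg_right (by omega) (by omega)
      have : d - d' = (q - q') * l + c' - c := by rw [h3, h3']; ring
      omega
  have y : ∀ n, n ≠ q → n ≠ q + 1 → (x + freeParticle l d) n = x n := fun n hn hn' => by
    rw [Finsupp.add_apply, h6 n hn hn', add_zero]
  have yq : (x + freeParticle l d) q = c := by
    rw [Finsupp.add_apply, h4, x2 _ (by omega), zero_add]
  have yq1 : (x + freeParticle l d) (q + 1) = l - c := by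
    rw [Finsupp.add_apply, h5, x2 _ (by omega), zero_add]
  have hSq : S (x + freeParticle l d) q = l := by rw [S, yq, yq1]; omega
  have htop := top_free hl hlk (k := k) (l := l) (d := d) (a := x) fun n hn => x2 n (by omega)
  have hiq : i = q ∨ i = q - 1 ∨ i = q - 2 := by
    rcases hi.of_mv ha hl hm with h | h | ⟨h, -⟩ <;> have := h.unique htop <;> omega
  have m1 := hm.apply_self
  have m2 := hm.apply_succ
  have v1 := ha.2.1 (q' + 1)
  have v2 := ha.2.2 (q' + 1)
  have v3 := ha.2.1 q'
  rw [S] at v1 v3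
  rw [L, add_sub_cancel_right, show q' + 1 + 1 = q' + 2 by ring,
    show q' + 1 + 2 = q' + 3 by ring] at v2
  rw [show q' + 1 + 1 = q' + 2 by ring] at v1
  rcases hiq with rfl | rfl | rfl
  · have n0 : a q' = c' := by
      rw [← x0, ← y q' (by omega) (by omega), hm.apply_of_ne (by omega) (by omega)]
    have n1 : a (q' + 1) = l - c' := by
      rw [← x1, ← y (q' + 1) (by omega) (by omega), hm.apply_of_ne (by omega) (by omega)]
    rcases hg' with ⟨hq, hc⟩ | ⟨hq, hc⟩
    · rw [hq] at m1 m2 yq yq1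
      rw [show q' + 2 + 1 = q' + 3 by ring] at m2 yq1
      omega
    · have n2 : a (q' + 2) = 0 := by
        rw [← x2 (q' + 2) (by omega), ← y (q' + 2) (by omega) (by omega),
          hm.apply_of_ne (by omega) (by omega)]
      rw [hq] at m1 m2 yq yq1
      omega
  · have n0 : a q' = c' := by
      rw [← x0, ← y q' (by omega) (by omega), hm.apply_of_ne (by omega) (by omega)]
    rw [y _ (by omega) (by omega)] at m1
    rw [show q - 1 + 1 = q by ring] at m2
    rcases hg' with ⟨hq, hc⟩ | ⟨hq, hc⟩
    · rw [show q - 1 = q' + 1 by omega, x1] at m1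
      omega
    · have n1 : a (q' + 1) = l - c' := by
        rw [← x1, ← y (q' + 1) (by omega) (by omega), hm.apply_of_ne (by omega) (by omega)]
      rw [show q - 1 = q' + 2 by omega, x2 _ le_rfl] at m1
      rw [hq] at m2 yq
      omega
  · have : HasParticle k l a q := Or.inl (by rw [← hm.S_of_ne (by omega) (by omega), hSq])
    have := hi.2 this
    omega

/-- If σ were smaller, injectivity would make some iterate of a with at least one move equal to the
two free particles at distance exactly A_{l,l}, which is no right move of anything. -/
theorem Detach.le_of_free {d : ℤ} (hl : 1 ≤ l) (hlk : l ≤ k)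
    (hz : ∀ n, d / l ≤ n → b n = 0) (h : Detach k l a (b + freeParticle l d) σ) :
    d + A k l l ≤ σ := by
  by_contra hlt
  have hx := h.mem_left hl
  obtain ⟨hy, hz'⟩ := add_free_free_mem hl hlk hx hz (le_refl (d + A k l l))
  obtain ⟨i, hi⟩ := h.top
  obtain ⟨u, hu⟩ : ∃ u : ℕ, d + A k l l = σ + (u + 1 : ℕ) :=
    ⟨(d + A k l l - σ - 1).toNat, by push_cast; omega⟩
  obtain ⟨m1, i', -, m2⟩ := RiggedConf.iterate_mem hl h.mem hi u
  refine not_rightMove_eq hl hlk hz rfl m1 m2 ?_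
  rw [← Function.iterate_succ_apply' (RiggedConf.rightMove k l)]
  refine Detach.inj (h.iterate hl hlk (u + 1)) ?_ hl hlk
  rw [← hu]
  exact detach_free hl hlk hy hz'

/-- The energies of two successive particles of the same weight differ by at least `A_{l,l}`. -/
theorem Detach.add_A_le {b' : Conf} {σ' : ℤ} (h : Detach k l a b σ) (h' : Detach k l b b' σ')
    (hl : 1 ≤ l) (hlk : l ≤ k) : σ' + A k l l ≤ σ := by
  obtain ⟨T, hT⟩ := h'.eventually hl hlk 0
  obtain ⟨e1, e2, e3⟩ := hT T le_rfl
  obtain ⟨j, hj⟩ := h'.top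
  -- Pushing both particles T times raises both energies by T and frees the second one, so the
  -- difference can be read off between free particles.
  obtain ⟨a', ha'⟩ := h.kick_iterate hl hlk hj T
  rw [e1] at ha'
  have := ha'.le_of_free hl hlk fun n hn => e3 n (by omega)
  omega

/-! ### Length and energy -/

/-- The energy `∑ i a_i`. -/
def energy (a : Conf) : ℤ := a.sum fun i n => i * n

theorem energy_add (a b : Conf) : energy (a + b) = energy a + energy b :=
  Finsupp.sum_add_index' (by simp) (by intros; push_cast; ring)

theorem energy_single (i : ℤ) (n : ℕ) : energy (Finsupp.single i n) = i * n :=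
  Finsupp.sum_single_index (by simp)

theorem length_add (a b : Conf) : length (a + b) = length a + length b :=
  Finsupp.sum_add_index' (by simp) (by intros; rfl)

theorem length_single (i : ℤ) (n : ℕ) : length (Finsupp.single i n) = n :=
  Finsupp.sum_single_index rfl

theorem length_eq_zero : length a = 0 ↔ a = 0 := by
  simp only [length, Finsupp.sum, Finset.sum_eq_zero_iff, Finsupp.mem_support_iff]
  constructor
  · intro h
    ext n
    by_contra hn
    exact hn (h n hn)
  · rintro rfl; simp

theorem Mv.energy_eq (h : Mv i a b) : energy b = energy a + 1 := by
  have := congrArg energy h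
  rw [energy_add, energy_add, energy_single, energy_single] at this
  push_cast at this
  linarith

theorem Mv.length_eq (h : Mv i a b) : length b = length a := by
  have := congrArg length h
  rw [length_add, length_add, length_single, length_single] at this
  omega

theorem energy_le {r : ℤ} (h : ∀ n, r < n → a n = 0) : energy a ≤ r * length a := by
  rw [energy, length, Finsupp.sum, Finsupp.sum, Nat.cast_sum, Finset.mul_sum]
  refine Finset.sum_le_sum fun n hn => ?_
  rw [Finsupp.mem_support_iff] at hn
  refine mul_le_mul_of_nonneg_right ?_ (by positivity)
  by_contra hlt
  exact hn (h n (by omega))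

theorem energy_nonneg (h : ∀ n < 0, a n = 0) : 0 ≤ energy a := by
  rw [energy, Finsupp.sum]
  refine Finset.sum_nonneg fun n hn => ?_
  rw [Finsupp.mem_support_iff] at hn
  refine mul_nonneg ?_ (by positivity)
  by_contra hlt
  exact hn (h n (by omega))

theorem iterate_energy (hl : 1 ≤ l) (ha : a ∈ C k l) (hi : Top k l a i) (t : ℕ) :
    energy ((rightMove k l)^[t] a) = energy a + t ∧
      length ((rightMove k l)^[t] a) = length a := by
  induction t with
  | zero => simp
  | succ t ih =>
    obtain ⟨m1, i', -, m2⟩ := iterate_mem hl ha hi t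
    rw [Function.iterate_succ_apply', (m2.mv m1).energy_eq, (m2.mv m1).length_eq, ih.1, ih.2]
    exact ⟨by push_cast; ring, rfl⟩

theorem length_freeParticle (hl : 1 ≤ l) (d : ℤ) : length (freeParticle l d) = l := by
  obtain ⟨c, h1, h2, h3, -⟩ := freeParticle_spec hl d
  rw [(freeParticle_eq h1 h2 h3).2, length_add, length_single, length_single]
  omega

theorem Detach.length_eq (h : Detach k l a b σ) (hl : 1 ≤ l) : length a = length b + l := by
  obtain ⟨t, ht, -⟩ := h.eq
  obtain ⟨i, hi⟩ := h.top
  have := (iterate_energy hl h.mem hi t).2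
  rw [ht, length_add, length_freeParticle hl] at this
  exact this.symm

/-! ### The weight -/

theorem weight_eq (ha : a ∈ C k l) (hj : HasParticle k l a j) : weight k a = l := by
  refine le_antisymm (Nat.sInf_le ha) (le_csInf ⟨l, ha⟩ fun l' hl' => ?_)
  have := hl'.2.1 j; have := hl'.2.2 j
  unfold HasParticle at hj
  omega

theorem Detach.weight_eq (h : Detach k l a b σ) : weight k a = l := by
  obtain ⟨i, hi⟩ := h.top
  exact RiggedConf.weight_eq h.mem hi.1

theorem weight_spec (ha : a ∈ C k l) (h0 : a ≠ 0) :
    1 ≤ weight k a ∧ weight k a ≤ l ∧ a ∈ C k (weight k a) ∧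
      ∃ j, HasParticle k (weight k a) a j := by
  have h1 : a ∈ C k (weight k a) := Nat.sInf_mem (⟨l, ha⟩ : {l | a ∈ C k l}.Nonempty)
  have h2 : weight k a ≤ l := Nat.sInf_le ha
  have h3 : 1 ≤ weight k a := by
    by_contra hlt
    refine h0 (Finsupp.ext fun n => ?_)
    have := h1.2.1 n
    unfold S at this
    rw [Finsupp.zero_apply]
    omega
  refine ⟨h3, h2, h1, ?_⟩
  by_contra! hne
  have h4 : a ∈ C k (weight k a - 1) := by
    refine ⟨h1.1, fun j => ?_, fun j => ?_⟩ <;>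
    · have := h1.2.1 j; have := h1.2.2 j
      have := hne j
      unfold HasParticle at this
      omega
  have : weight k a ≤ weight k a - 1 := Nat.sInf_le h4
  omega

/-! ### Freeing the last particle -/

/-- At the break time the whole particle is concentrated on the last occupied site r, and the site
before it is empty; so the cut of `removed` takes away exactly a free particle of energy r l. -/
theorem freed_spec (hl : 1 ≤ l) (hlk : l ≤ k) (ha : a ∈ C k l) (hi : Top k l a i) :
    ∃ r : ℤ, (rightMove k l)^[breakTime k l a] a = removed k l a + Finsupp.single r l ∧
      (∀ n, r - 1 ≤ n → removed k l a n = 0) ∧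
      shiftedEnergy k l a = r * l - breakTime k l a := by
  obtain ⟨n₀, -, -, hn₀⟩ := hi.1.exists_ne hl
  obtain ⟨M, -, hM⟩ := exists_bound a
  obtain ⟨r, hr, hr'⟩ := Int.exists_greatest_of_bdd (P := fun n => a n ≠ 0)
    ⟨M, fun z hz => by
      by_contra hlt
      exact hz (hM z (Or.inl (by omega)))⟩ ⟨n₀, hn₀⟩
  have hend : rightEnd a = r + 1 := by
    have : IsGreatest {i | a i ≠ 0} r := ⟨hr, fun z hz => hr' z hz⟩
    rw [rightEnd, this.csSup_eq]
  set P : ℕ → Prop := fun t => ((rightMove k l)^[t] a) r ≠ 0 ∧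
    ∀ j ≥ r + 1, ((rightMove k l)^[t] a) j = 0 with hP
  have hbreak : breakTime k l a = sInf {t | ¬ P (t + 1)} := by
    simp only [breakTime, hend, add_sub_cancel_right, hP]
  -- The energy grows by one with each move, but as long as nothing passes r it is at most r times
  -- the length.
  have hne : {t | ¬ P (t + 1)}.Nonempty := by
    by_contra hcon
    rw [Set.not_nonempty_iff_eq_empty] at hcon
    have hall : ∀ t, P (t + 1) := fun t => by
      by_contra h
      have : t ∈ {t | ¬ P (t + 1)} := h
      simp [hcon] at this
    obtain ⟨u, hu⟩ : ∃ u : ℕ, r * length a - energy a < (u + 1 : ℕ) :=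
      ⟨(r * length a - energy a).toNat, by
        have := Int.self_le_toNat (r * length a - energy a)
        push_cast; omega⟩
    have h1 := iterate_energy hl ha hi (u + 1)
    have h2 := energy_le (r := r) fun n hn => (hall u).2 n (by omega)
    rw [h1.1, h1.2] at h2
    omega
  have h1 : ¬ P (breakTime k l a + 1) := by
    rw [hbreak]
    exact Nat.sInf_mem hne
  have h2 : P (breakTime k l a) := by
    rcases Nat.eq_zero_or_pos (breakTime k l a) with h | h
    · rw [h]
      exact ⟨hr, fun j hj => by
        by_contra hne
        have := hr' j hne
        omega⟩
    · have : breakTime k l a - 1 ∉ {t | ¬ P (t + 1)} :=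
        Nat.notMem_of_lt_sInf (by rw [← hbreak]; omega)
      simpa [Nat.sub_add_cancel h] using this
  obtain ⟨hb, i', -, hi'⟩ := iterate_mem hl ha hi (breakTime k l a)
  have hm := hi'.mv hb
  simp only [hP, Function.iterate_succ_apply'] at h1 h2
  have hfr : freed k l a = (rightMove k l)^[breakTime k l a] a := rfl
  obtain ⟨b, hb'⟩ : ∃ b, b = (rightMove k l)^[breakTime k l a] a := ⟨_, rfl⟩
  rw [← hb'] at hb hi' hm h1 h2 hfr ⊢
  obtain ⟨h3, h4⟩ := h2
  have m1 := hm.apply_self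
  have m2 := hm.apply_succ
  -- A move below r keeps r occupied and everything beyond it empty, so the breaking move is made at
  -- r.
  obtain rfl : i' = r := by
    by_contra hne
    have h5 : ¬ r < i' := fun h => by have := h4 i' (by omega); omega
    refine h1 ⟨?_, fun j hj => ?_⟩
    · by_cases h6 : i' + 1 = r
      · rw [h6] at m2; omega
      · rwa [hm.apply_of_ne (by omega) (by omega)]
    · rw [hm.apply_of_ne (by omega) (by omega)]
      exact h4 j hj
  have e1 := h4 (i' + 1) (by omega)
  have e2 := h4 (i' + 2) (by omega)
  have hpart : HasParticle k l b i' := hi'.1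
  have b1 := hb.2.1 (i' - 1)
  rw [S, show i' - 1 + 1 = i' by ring] at b1
  have b2 := hb.2.1 i'
  rw [S] at b2
  rw [HasParticle, S, L] at hpart
  -- If S is sharp this is immediate. If L is sharp, then S ≤ l at r - 1 gives b r ≥ k, and l ≤ k
  -- leaves only b r = l.
  have e3 : b i' = l := by omega
  have e4 : b (i' - 1) = 0 := by omega
  refine ⟨i', ?_, fun n hn => ?_, ?_⟩
  · ext n
    rw [Finsupp.add_apply, removed, hfr, Finsupp.filter_apply, hend, Finsupp.single_apply]
    split_ifs with n1 n2 n2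
    · omega
    · rw [add_zero]
    · rw [← n2, e3, zero_add]
    · rw [h4 n (by omega), zero_add]
  · rw [removed, hfr, Finsupp.filter_apply, hend]
    split_ifs with n1
    · obtain rfl : n = i' - 1 := by omega
      exact e4
    · rfl
  · have : highestPos k l b = i' := hi'.highestPos_eq
    simp only [shiftedEnergy, hfr]
    change highestPos k l b * _ + _ - _ = _
    rw [this]
    rw [e3, e1]; push_cast; ring

theorem detach_removed (hl : 1 ≤ l) (hlk : l ≤ k) (ha : a ∈ C k l) (hi : Top k l a i) :
    Detach k l a (removed k l a) (shiftedEnergy k l a) := by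
  obtain ⟨r, h1, h2, h3⟩ := freed_spec hl hlk ha hi
  refine ⟨ha, ⟨i, hi⟩, breakTime k l a, ?_, fun n hn => h2 n ?_⟩
  · rw [h1, h3, sub_add_cancel, freeParticle_mul hl]
  · rw [h3, sub_add_cancel, Int.mul_ediv_cancel _ (by omega)] at hn
    omega

theorem exists_detach (hlk : l ≤ k) (ha : a ∈ C k l) (h0 : a ≠ 0) :
    ∃ (p : ℕ) (b : Conf) (σ r : ℤ) (t : ℕ), 1 ≤ p ∧ p ≤ l ∧ Detach k p a b σ ∧
      (rightMove k p)^[t] a = b + Finsupp.single r p ∧ ∀ n, r - 1 ≤ n → b n = 0 := by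
  obtain ⟨h1, h2, h3, j, h4⟩ := weight_spec ha h0
  obtain ⟨i, hi⟩ := exists_top h1 h4
  obtain ⟨r, e1, e2, e3⟩ := freed_spec h1 (h2.trans hlk) h3 hi
  exact ⟨_, _, _, r, _, h1, h2, detach_removed h1 (h2.trans hlk) h3 hi, e1, e2⟩

/-- Detaching lowers the length by p ≥ 1. The step also records the remainder with all of the
particle on one site, the form in which overlaps can be compared. -/
theorem C_induction (hlk : l ≤ k) {motive : Conf → Prop} (zero : motive 0)
    (step : ∀ (p : ℕ) (a b : Conf) (σ r : ℤ) (t : ℕ), 1 ≤ p → p ≤ l → Detach k p a b σ →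
      (rightMove k p)^[t] a = b + Finsupp.single r p → (∀ n, r - 1 ≤ n → b n = 0) →
      motive b → motive a) : ∀ a ∈ C k l, motive a := by
  intro a
  induction hn : length a using Nat.strong_induction_on generalizing a with
  | _ n ih =>
    intro ha
    by_cases h0 : a = 0
    · rwa [h0]
    obtain ⟨p, b, σ, r, t, h1, h2, h3, h4, h5⟩ := exists_detach hlk ha h0
    have := h3.length_eq h1
    exact step p a b σ r t h1 h2 h3 h4 h5
      (ih _ (by omega) b rfl (C_mono h2 (h3.mem_left h1)))

/-! ### The map `ι` -/

theorem iotaAux_zero_right (k n : ℕ) : iotaAux k n 0 = [] := by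
  cases n <;> simp [iotaAux]

theorem iotaAux_congr (hlk : l ≤ k) (ha : a ∈ C k l) {n m : ℕ} (hn : length a ≤ n)
    (hm : length a ≤ m) : iotaAux k n a = iotaAux k m a := by
  induction n generalizing m a with
  | zero =>
    rw [length_eq_zero.1 (by omega : length a = 0), iotaAux_zero_right, iotaAux_zero_right]
  | succ n ih =>
    by_cases h0 : a = 0
    · rw [h0, iotaAux_zero_right, iotaAux_zero_right]
    have hpos : length a ≠ 0 := fun h => h0 (length_eq_zero.1 h)
    obtain ⟨m, rfl⟩ := Nat.exists_eq_succ_of_ne_zero (by omega : m ≠ 0)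
    obtain ⟨h1, h2, h3, j, h4⟩ := weight_spec ha h0
    obtain ⟨i, hi⟩ := exists_top h1 h4
    have hd := detach_removed h1 (h2.trans hlk) h3 hi
    have := hd.length_eq h1
    simp only [iotaAux, if_neg h0]
    rw [ih (C_mono h2 (hd.mem_left h1)) (m := m) (by omega) (by omega)]

theorem iota_zero (k : ℕ) : iota k 0 = [] := iotaAux_zero_right _ _

theorem Detach.iota_eq (h : Detach k l a b σ) (hl : 1 ≤ l) (hlk : l ≤ k) :
    iota k a = (l, σ - ((iota k b).map fun p => (A k l p.1 : ℤ)).sum) :: iota k b := by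
  have hlen := h.length_eq hl
  have h0 : a ≠ 0 := fun h => by rw [length_eq_zero.2 h] at hlen; omega
  obtain ⟨i, hi⟩ := h.top
  obtain ⟨rfl, rfl⟩ := h.unique (detach_removed hl hlk h.mem hi) hl hlk
  obtain ⟨n, hn⟩ := Nat.exists_eq_succ_of_ne_zero (by omega : length a ≠ 0)
  have hw := h.weight_eq
  rw [iota, hn, iotaAux, if_neg h0, hw]
  simp only
  rw [iotaAux_congr (m := length (removed k l a)) hlk (h.mem_left hl) (by omega) le_rfl]
  rfl

theorem iota_ne_nil (hlk : l ≤ k) (ha : a ∈ C k l) (h0 : a ≠ 0) : iota k a ≠ [] := by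
  obtain ⟨p, b, σ, r, t, h1, h2, h3, -⟩ := exists_detach hlk ha h0
  rw [h3.iota_eq h1 (h2.trans hlk)]
  simp

theorem iota_mem_R (hlk : l ≤ k) : ∀ a ∈ C k l, ∀ l', a ∈ C k l' → iota k a ∈ R l' := by
  refine C_induction hlk (fun l' _ => by rw [iota_zero]; simp [R]) ?_
  intro p a b σ r t h1 h2 h3 _ _ ih l' hl'
  have hpk := h2.trans hlk
  have hpl : p ≤ l' := by
    rw [← h3.weight_eq]
    exact Nat.sInf_le hl'
  have hb := h3.mem_left h1
  obtain ⟨i1, i2⟩ := ih p hb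
  rw [h3.iota_eq h1 hpk]
  refine ⟨?_, ?_⟩
  · intro q hq
    rcases List.mem_cons.1 hq with rfl | hq
    · exact ⟨h1, hpl⟩
    · exact ⟨(i1 q hq).1, (i1 q hq).2.trans hpl⟩
  · by_cases h0 : b = 0
    · rw [h0, iota_zero]
      exact List.isChain_singleton _
    obtain ⟨p', b', σ', r', t', h1', h2', h3', -⟩ := exists_detach hpk hb h0
    have e := h3'.iota_eq h1' (h2'.trans hpk)
    rw [e] at i1 i2 ⊢
    refine List.isChain_cons_cons.2 ⟨⟨h2', ?_⟩, i2⟩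
    rintro (rfl : p = p')
    -- The correction sum for a contains one term A k p p more than that for b, so this gap is
    -- exactly the inequality between the riggings.
    have := h3.add_A_le h3' h1 hpk
    simp only [List.map_cons, List.sum_cons]
    omega

/-- The list determines the weight, by recursion the remainder, and hence the shifted energy;
`Detach.inj` then recovers the configuration. -/
theorem iota_injOn (hlk : l ≤ k) : Set.InjOn (iota k) (C k l) := by
  suffices h : ∀ a ∈ C k l, ∀ b ∈ C k l, iota k a = iota k b → a = b from
    fun a ha b hb => h a ha b hb
  refine C_induction hlk ?_ ?_
  · intro b hb h
    by_contra h0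
    refine iota_ne_nil hlk hb (Ne.symm h0) ?_
    rw [← h, iota_zero]
  · intro p a a' σ r t h1 h2 h3 _ _ ih b hb h
    have h0 : b ≠ 0 := by
      rintro rfl
      rw [h3.iota_eq h1 (h2.trans hlk), iota_zero] at h
      simp at h
    obtain ⟨p', b', σ', r', t', h1', h2', h3', -⟩ := exists_detach hlk hb h0
    rw [h3.iota_eq h1 (h2.trans hlk), h3'.iota_eq h1' (h2'.trans hlk)] at h
    obtain ⟨e1, e2⟩ := List.cons_eq_cons.1 h
    obtain ⟨rfl, e3⟩ := Prod.mk.inj e1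
    obtain rfl := ih b' (C_mono h2 (h3'.mem_left h1)) e2
    obtain rfl : σ = σ' := by omega
    exact h3.inj h3' h1 (h2.trans hlk)

/-! ### The map κ as a right inverse of ι -/

theorem eventualValue_eq {f : ℕ → Conf} (h : ∀ᶠ t in atTop, f t = a) : eventualValue f = a := by
  have h' : ∃ b, ∀ᶠ t in atTop, f t = b := ⟨a, h⟩
  rw [eventualValue, dif_pos h']
  obtain ⟨t, h1, h2⟩ := (h'.choose_spec.and h).exists
  rw [← h1, h2]

/-- The energy `s_1 = ρ_1 + ∑_{j > 1} A_{l, λ_j}` of the first entry `p` of `p :: r`. -/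
def headEnergy (k l : ℕ) (p : ℕ × ℤ) (r : RiggedList) : ℤ :=
  p.2 + (r.map fun q => (A k l q.1 : ℤ)).sum

theorem R_tail {p : ℕ × ℤ} {r : RiggedList} (h : p :: r ∈ R l) : r ∈ R l :=
  ⟨fun q hq => h.1 q (List.mem_cons_of_mem _ hq), h.2.tail⟩

theorem exists_split {r : RiggedList} (hr : r ∈ R (l + 1)) :
    ∃ q r', r = q ++ r' ∧ (∀ p ∈ q, p.1 = l + 1) ∧ r' ∈ R l := by
  induction r with
  | nil => exact ⟨[], [], rfl, by simp, by simp [R]⟩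
  | cons p r ih =>
    by_cases hp : p.1 = l + 1
    · obtain ⟨q, r', rfl, h2, h3⟩ := ih (R_tail hr)
      refine ⟨p :: q, r', rfl, fun x hx => ?_, h3⟩
      rcases List.mem_cons.1 hx with rfl | hx
      · exact hp
      · exact h2 x hx
    · refine ⟨[], p :: r, rfl, by simp, fun x hx => ⟨(hr.1 x hx).1, ?_⟩, hr.2⟩
      have hp' := (hr.1 p List.mem_cons_self).2
      have hc : (p :: r).Pairwise fun p q => q.1 ≤ p.1 := by
        have : (p :: r).IsChain fun p q => q.1 ≤ p.1 := hr.2.imp fun _ _ h => h.1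
        have : IsTrans (ℕ × ℤ) fun p q => q.1 ≤ p.1 := ⟨fun _ _ _ h h' => h'.trans h⟩
        exact List.isChain_iff_pairwise.1 ‹_›
      rcases List.mem_cons.1 hx with rfl | hx
      · omega
      · have := (List.pairwise_cons.1 hc).1 x hx
        omega

theorem mult_append {q r : RiggedList} (hq : ∀ p ∈ q, p.1 = l + 1) (hr : r ∈ R l) :
    mult (l + 1) (q ++ r) = q.length := by
  rw [mult, List.countP_append, List.countP_eq_length.2 (by simpa using hq),
    List.countP_eq_zero.2, add_zero]
  intro p hp
  have := (hr.1 p hp).2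
  simp only [decide_eq_true_eq]
  omega

/-- Since sweeping keeps the number of particles of the remainder, the same sweep can be repeated; t
sweeps cancel a shift of the energy by t. -/
theorem Detach.iterate_sweep {m : ℕ} (h : Detach k l a b σ) (hl : 1 ≤ l) (hlk : l ≤ k)
    (hm : Num k l b m) (t : ℕ) :
    Detach k l ((leftSweep k l (m + 1))^[t] a) ((leftSweep k l m)^[t] b) (σ - t) ∧
      Num k l ((leftSweep k l m)^[t] b) m := by
  induction t with
  | zero => exact ⟨by simpa using h, hm⟩
  | succ t ih =>
    rw [Function.iterate_succ_apply', Function.iterate_succ_apply']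
    refine ⟨?_, (ih.2.sweep (ih.1.mem_left hl) hl).2⟩
    convert ih.1.sweep hl hlk ih.2 using 1
    push_cast; ring

/-- Adding the free particles of weight `l` and sweeping them back. -/
theorem exists_sweep_freeParticles (hl : 1 ≤ l) (hlk : l ≤ k) (hb : b ∈ C k l)
    (hn : Num k l b 0) (q : RiggedList) (hq : ∀ p ∈ q, p.1 = l) (hR : q ++ iota k b ∈ R l) :
    ∃ a ∈ C k l, iota k a = q ++ iota k b ∧ ∃ T : ℕ, ∀ t ≥ T,
      b + freeParticles k l t q.length (q ++ iota k b) ∈ C k l ∧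
      Num k l (b + freeParticles k l t q.length (q ++ iota k b)) q.length ∧
      (leftSweep k l q.length)^[t] (b + freeParticles k l t q.length (q ++ iota k b)) = a ∧
      ∀ p q', q = p :: q' → ∀ n, (headEnergy k l p (q' ++ iota k b) + t) / (l : ℤ) ≤ n →
        (b + freeParticles k l t q'.length (q' ++ iota k b)) n = 0 := by
  induction q with
  | nil =>
    refine ⟨b, hb, rfl, 0, fun t _ => ?_⟩
    have : leftSweep k l 0 = id := rfl
    simp only [List.length_nil, freeParticles, add_zero, this, Function.iterate_id, id]
    exact ⟨hb, hn, trivial, by simp⟩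
  | cons p q ih =>
    obtain ⟨a', ha', hι, T, hT⟩ := ih (fun x hx => hq x (List.mem_cons_of_mem _ hx)) (R_tail hR)
    have hp := hq p List.mem_cons_self
    set s := headEnergy k l p (q ++ iota k b) with hs
    have key : ∃ T' ≥ T, ∀ t : ℕ, t ≥ T' →
        b + freeParticles k l t q.length (q ++ iota k b) + freeParticle l (s + t) ∈ C k l ∧
        ∀ n, (s + t) / (l : ℤ) ≤ n →
          (b + freeParticles k l t q.length (q ++ iota k b)) n = 0 := by
      -- The innermost free particle needs large t to stand clear of b. Every further one is placed
      -- by the gap to its predecessor, which does not depend on t.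
      cases q with
      | nil =>
        obtain ⟨N, -, hN⟩ := exists_bound b
        refine ⟨T + ((N + 3) * l - s).toNat, by omega, fun t ht => ?_⟩
        have h1 : N + 3 ≤ (s + t) / (l : ℤ) := by
          rw [Int.le_ediv_iff_mul_le (by omega)]
          have := Int.self_le_toNat ((N + 3) * l - s)
          omega
        simp only [List.length_nil, freeParticles, add_zero]
        exact ⟨add_free_mem_of_far hl hlk hb fun n hn => hN n (Or.inl (by omega)),
          fun n hn => hN n (Or.inl (by omega))⟩
      | cons p' q =>
        refine ⟨T, le_rfl, fun t ht => ?_⟩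
        obtain ⟨h1, -, -, h4⟩ := hT t ht
        have h5 := h4 p' q rfl
        have hp' := hq p' (by simp)
        -- Equal parts have weakly decreasing riggings, and the energy of the outer particle
        -- contains the additional summand A k l l.
        have hle : headEnergy k l p' (q ++ iota k b) + t + A k l l ≤ s + t := by
          have hch := hR.2
          simp only [List.cons_append] at hch
          have := (List.isChain_cons_cons.1 hch).1.2 (by omega)
          rw [hs]
          simp only [headEnergy, List.cons_append, List.map_cons, List.sum_cons, hp']
          omega
        have heq : b + freeParticles k l t (p' :: q).length (p' :: q ++ iota k b) =
            b + freeParticles k l t q.length (q ++ iota k b) +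
              freeParticle l (headEnergy k l p' (q ++ iota k b) + t) := by
          rw [List.length_cons, List.cons_append, freeParticles, headEnergy]
          abel
        rw [heq] at h1 ⊢
        exact add_free_free_mem hl hlk h1 h5 hle
    obtain ⟨T', hTT, hT'⟩ := key
    have heq : ∀ t : ℕ, b + freeParticles k l t (p :: q).length (p :: q ++ iota k b) =
        b + freeParticles k l t q.length (q ++ iota k b) + freeParticle l (s + t) := by
      intro t
      rw [List.length_cons, List.cons_append, freeParticles, hs, headEnergy]
      abel
    have hdet : ∀ t ≥ T',
        Detach k l (b + freeParticles k l t q.length (q ++ iota k b) + freeParticle l (s + t))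
          (b + freeParticles k l t q.length (q ++ iota k b)) (s + t) := fun t ht =>
      detach_free hl hlk (hT' t ht).1 (hT' t ht).2
    -- The swept configuration detaches to the remainder already found and to s, neither of which
    -- depends on t. By `Detach.inj` it is therefore constant for large t.
    have hdet' : ∀ t ≥ T', Detach k l ((leftSweep k l (p :: q).length)^[t]
        (b + freeParticles k l t (p :: q).length (p :: q ++ iota k b))) a' s := by
      intro t ht
      obtain ⟨-, h2, h3, -⟩ := hT t (by omega)
      have := ((hdet t ht).iterate_sweep hl hlk h2 t).1
      rwa [h3, add_sub_cancel_right, ← heq] at this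
    refine ⟨_, (hdet' T' le_rfl).mem, ?_, T', fun t ht => ⟨?_, ?_, ?_, ?_⟩⟩
    · rw [(hdet' T' le_rfl).iota_eq hl hlk, hι, hs, headEnergy, add_sub_cancel_right, ← hp]
      rfl
    · rw [heq]
      exact (hT' t ht).1
    · rw [heq]
      exact (hdet t ht).num hl hlk (hT t (by omega)).2.1
    · exact (hdet' t ht).inj (hdet' T' le_rfl) hl hlk
    · rintro p' q' h
      obtain ⟨rfl, rfl⟩ := List.cons_eq_cons.1 h
      exact (hT' t ht).2

theorem kappa_spec (hlk : l ≤ k) {r : RiggedList} (hr : r ∈ R l) :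
    kappa k l r ∈ C k l ∧ iota k (kappa k l r) = r := by
  induction l generalizing r with
  | zero =>
    obtain rfl : r = [] := by
      cases r with
      | nil => rfl
      | cons p r =>
        have := hr.1 p List.mem_cons_self
        omega
    refine ⟨?_, iota_zero k⟩
    simp [kappa, C, S, L]
  | succ l ih =>
    obtain ⟨q, r', rfl, h1, h2⟩ := exists_split hr
    obtain ⟨h3, h4⟩ := ih (by omega) h2
    -- The bounds of weight l leave no inequality of weight l + 1 sharp.
    have hn : Num k (l + 1) (kappa k l r') 0 := by
      rw [num_zero_iff (C_mono (Nat.le_succ l) h3) (by omega)]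
      intro j hj
      have := h3.2.1 j; have := h3.2.2 j
      rw [HasParticle] at hj
      omega
    obtain ⟨a, ha, hι, T, hT⟩ := exists_sweep_freeParticles (by omega) hlk
      (C_mono (Nat.le_succ l) h3) hn q h1 (by rwa [h4])
    have hk : kappa k (l + 1) (q ++ r') = a := by
      simp only [kappa, mult_append h1 h2, List.drop_left]
      refine eventualValue_eq ?_
      filter_upwards [eventually_ge_atTop T] with t ht
      have := (hT t ht).2.2.1
      rwa [h4] at this
    rw [hk, hι, h4]
    exact ⟨ha, rfl⟩

/-! ### The overlap of a configuration with a heavier particle -/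

/-- The relation `t = max (x + v - k) (x + p - k - t') 0`. -/
def OverlapAt (k p x v t t' : ℕ) : Prop :=
  (x + v ≤ k + t ∧ x + p ≤ k + t + t') ∧ (t = 0 ∨ x + v = k + t ∨ x + p = k + t + t')

/-- The sequence `θ` measuring the overlap of `a` with a particle of weight `p` that passes
through `a`. -/
def IsOverlap (k p : ℕ) (a θ : Conf) : Prop :=
  ∀ j, OverlapAt k p (S a j) (S a (j - 1)) (θ j) (θ (j + 1))

/-- The letters v, x, q, z, w are the values of S at i - 2, ..., i + 2 around a move at i with S
sharp there. The move lowers x and raises z; the overlap responds by passing a unit from i to i + 1,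
or not at all. -/
theorem overlap_step_of_S {p q v x z w t₀ t₁ t₂ t₃ T : ℕ} (hqp : q < p)
    (h₀ : OverlapAt k p x v t₀ t₁) (h₁ : OverlapAt k p q x t₁ t₂) (h₂ : OverlapAt k p z q t₂ t₃)
    (h₃ : OverlapAt k p w z t₃ T) (hx : x ≤ q) (hx' : 1 ≤ x) (hz : z + 1 ≤ q)
    (hvx : v + x ≤ k) (hxz : x + z ≤ k) (hzw : z + w < k) :
    OverlapAt k p w (z + 1) t₃ T ∧ ((1 ≤ t₁ ∧ OverlapAt k p (x - 1) v t₀ (t₁ - 1) ∧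
        OverlapAt k p q (x - 1) (t₁ - 1) (t₂ + 1) ∧ OverlapAt k p (z + 1) q (t₂ + 1) t₃) ∨
      (OverlapAt k p (x - 1) v t₀ t₁ ∧ OverlapAt k p q (x - 1) t₁ t₂ ∧
        OverlapAt k p (z + 1) q t₂ t₃)) := by
  obtain ⟨⟨a0, b0⟩, c0⟩ := h₀
  obtain ⟨⟨a1, b1⟩, c1⟩ := h₁
  obtain ⟨⟨a2, b2⟩, c2⟩ := h₂
  obtain ⟨⟨a3, b3⟩, c3⟩ := h₃
  refine ⟨⟨⟨by omega, by omega⟩, by omega⟩, ?_⟩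
  have d2 : t₂ + k ≤ q + p ∨ t₂ = 0 := by clear c0 c1 c3; omega
  have d2' : t₂ + x + q ≤ q + p ∨ t₂ = 0 := by clear c0 c1 c3; omega
  have d1 : q + p ≤ k ∧ t₁ = 0 ∧ t₂ = 0 ∨ t₁ + t₂ + k = q + p := by clear c0 c3 c2; omega
  have d3 : z + 1 + q ≤ k + t₂ ∧ z + 1 + p ≤ k + t₂ + t₃ ∧ (t₂ = 0) ∨
      z + q ≤ k + t₂ ∧ z + p ≤ k + t₂ + t₃ ∧
        (z + q = k + t₂ ∨ z + p = k + t₂ + t₃) := by clear c0 c1 c3 d1 d2 d2'; omega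
  clear c1 c2 c3
  rcases d3 with ⟨f1, f2, f3⟩ | ⟨f1, f2, f3⟩
  · refine Or.inr ⟨⟨⟨by omega, by omega⟩, ?_⟩, ⟨⟨by omega, by omega⟩, by omega⟩,
      ⟨⟨by omega, by omega⟩, by omega⟩⟩
    omega
  · refine Or.inl ⟨by omega, ⟨⟨by omega, by omega⟩, ?_⟩, ⟨⟨by omega, by omega⟩, by omega⟩,
      ⟨⟨by omega, by omega⟩, by omega⟩⟩
    omega

/-- In the case where only L is sharp at i, a unit of overlap passes from i to i + 1, or from i to i
+ 2 when the raised z no longer fits beside w. The total is kept in either case. -/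
theorem overlap_step_of_L {p q v w x y z t₀ t₁ t₂ t₃ T : ℕ} (hqp : q < p) (hpk : p ≤ k)
    (h₀ : OverlapAt k p x v t₀ t₁) (h₁ : OverlapAt k p y x t₁ t₂) (h₂ : OverlapAt k p z y t₂ t₃)
    (h₃ : OverlapAt k p w z t₃ T) (hx : x ≤ q) (hz : z + 1 ≤ q)
    (hvxy : v + x + y ≤ k + q) (hxyz : x + y + z = k + q) (hyzw : y + z + w < k + q)
    (hy : y < q) :
    (1 ≤ t₁ ∧ OverlapAt k p (x - 1) v t₀ (t₁ - 1) ∧ OverlapAt k p y (x - 1) (t₁ - 1) (t₂ + 1) ∧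
        OverlapAt k p (z + 1) y (t₂ + 1) t₃ ∧ OverlapAt k p w (z + 1) t₃ T) ∨
      (1 ≤ t₁ ∧ OverlapAt k p (x - 1) v t₀ (t₁ - 1) ∧ OverlapAt k p y (x - 1) (t₁ - 1) t₂ ∧
        OverlapAt k p (z + 1) y t₂ (t₃ + 1) ∧ OverlapAt k p w (z + 1) (t₃ + 1) T) := by
  obtain ⟨⟨a0, b0⟩, c0⟩ := h₀
  obtain ⟨⟨a1, b1⟩, c1⟩ := h₁
  obtain ⟨⟨a2, b2⟩, c2⟩ := h₂
  obtain ⟨⟨a3, b3⟩, c3⟩ := h₃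
  have d0 : x + p = k + t₀ + t₁ := by clear c2 c3; omega
  clear c0
  by_cases hw : w + (z + 1) ≤ k + t₃
  · have c3' : t₃ = 0 ∨ w + (z + 1) = k + t₃ ∨ w + p = k + t₃ + T := by omega
    clear c3
    have d2 : z + y = k + t₂ ∨ z + p = k + t₂ + t₃ := by omega
    clear c2
    refine Or.inl ⟨by omega, ⟨⟨by omega, by omega⟩, Or.inr (Or.inr (by omega))⟩,
      ⟨⟨by omega, by omega⟩, ?_⟩, ⟨⟨by omega, by omega⟩, by omega⟩, ⟨⟨hw, by omega⟩, c3'⟩⟩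
    omega
  · have e3 : w + z = k + t₃ := by omega
    clear c3
    have e2 : z + p = k + t₂ + t₃ := by omega
    have e1 : y + x = k + t₁ := by omega
    clear c1 c2
    refine Or.inr ⟨by omega, ⟨⟨by omega, by omega⟩, Or.inr (Or.inr (by omega))⟩,
      ⟨⟨by omega, by omega⟩, Or.inr (Or.inl (by omega))⟩,
      ⟨⟨by omega, by omega⟩, Or.inr (Or.inr (by omega))⟩,
      ⟨⟨by omega, by omega⟩, Or.inr (Or.inl (by omega))⟩⟩

/-- The length of the overlap is an invariant of the motion of lighter particles, so it may be
computed after they have been freed. -/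
theorem IsOverlap.rightMove {p q : ℕ} {θ : Conf} (hqp : q < p) (hpk : p ≤ k)
    (ha : a ∈ C k q) (hi : Top k q a i) (h : IsOverlap k p a θ) :
    ∃ θ', IsOverlap k p (rightMove k q a) θ' ∧ length θ' = length θ := by
  have hm := hi.mv ha
  have hr := hi.readyR ha
  have hb := hi.mem_C ha
  set b := RiggedConf.rightMove k q a
  have s1 : S b (i - 1) = S a (i - 1) - 1 := by have := hm.S_pred; omega
  have s1' : 1 ≤ S a (i - 1) := by have := hm.S_pred; omega
  have s2 := hm.S_succ
  have s3 := hm.S_of_ne (j := i - 2) (by omega) (by omega)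
  have s4 := hm.S_of_ne (j := i) (by omega) (by omega)
  have s5 := hm.S_of_ne (j := i + 2) (by omega) (by omega)
  have h0 := h (i - 1)
  have h1 := h i
  have h2 := h (i + 1)
  have h3 := h (i + 2)
  have l0 := ha.2.2 (i - 1)
  have l1 := ha.2.2 i
  have l2 := hr.L_succ
  have hP := hr.hasParticle
  have x1 := ha.2.1 (i - 1)
  have x2 := ha.2.1 i
  have x3 := hr.S_succ
  rw [HasParticle] at hP
  rw [L_eq_add] at l0 l1 l2 hP
  rw [show i - 1 - 1 = i - 2 by ring, sub_add_cancel] at h0 l0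
  rw [show i + 1 + 1 = i + 2 by ring, show i + 1 - 1 = i by ring] at h2 l2
  rw [show i + 2 + 1 = i + 3 by ring, show i + 2 - 1 = i + 1 by ring] at h3
  have key : ∀ θ' : Conf, (∀ j, j < i ∨ i + 2 < j → θ' j = θ j) →
      OverlapAt k p (S a (i - 1) - 1) (S a (i - 2)) (θ (i - 1)) (θ' i) →
      OverlapAt k p (S a i) (S a (i - 1) - 1) (θ' i) (θ' (i + 1)) →
      OverlapAt k p (S a (i + 1) + 1) (S a i) (θ' (i + 1)) (θ' (i + 2)) →
      OverlapAt k p (S a (i + 2)) (S a (i + 1) + 1) (θ' (i + 2)) (θ (i + 3)) →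
      IsOverlap k p b θ' := by
    intro θ' e0 e1 e2 e3 e4 j
    rw [← s1, ← s3, ← e0 _ (Or.inl (by omega))] at e1
    rw [← s1, ← s4] at e2
    rw [← s2, ← s4] at e3
    rw [← s2, ← s5, ← e0 _ (Or.inr (by omega))] at e4
    by_cases c1 : j = i - 1
    · subst c1; rwa [show i - 1 - 1 = i - 2 by ring, sub_add_cancel]
    by_cases c2 : j = i
    · subst c2; exact e2
    by_cases c3 : j = i + 1
    · subst c3; rwa [show i + 1 + 1 = i + 2 by ring, show i + 1 - 1 = i by ring]
    by_cases c4 : j = i + 2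
    · subst c4; rwa [show i + 2 + 1 = i + 3 by ring, show i + 2 - 1 = i + 1 by ring]
    rw [e0 j (by omega), e0 (j + 1) (by omega), hm.S_of_ne (by omega) (by omega),
      hm.S_of_ne (by omega) (by omega)]
    exact h j
  have caseA : 1 ≤ θ i → OverlapAt k p (S a (i - 1) - 1) (S a (i - 2)) (θ (i - 1)) (θ i - 1) →
      OverlapAt k p (S a i) (S a (i - 1) - 1) (θ i - 1) (θ (i + 1) + 1) →
      OverlapAt k p (S a (i + 1) + 1) (S a i) (θ (i + 1) + 1) (θ (i + 2)) →
      OverlapAt k p (S a (i + 2)) (S a (i + 1) + 1) (θ (i + 2)) (θ (i + 3)) →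
      ∃ θ', IsOverlap k p b θ' ∧ length θ' = length θ := by
    intro f0 f1 f2 f3 f4
    have hm := mv_right f0
    have g1 := hm.apply_self
    refine ⟨_, key _ (fun j hj => hm.apply_of_ne (by omega) (by omega)) ?_ ?_ ?_ ?_, hm.length_eq⟩
    · rwa [← Nat.sub_eq_of_eq_add g1]
    · rwa [← Nat.sub_eq_of_eq_add g1, hm.apply_succ]
    · rwa [hm.apply_succ, hm.apply_of_ne (by omega) (by omega)]
    · rwa [hm.apply_of_ne (by omega) (by omega)]
  rcases eq_or_ne (S a i) q with hS | hS
  · rw [hS] at h1 h2 caseA key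
    obtain ⟨f4, ⟨f0, f1, f2, f3⟩ | ⟨f1, f2, f3⟩⟩ := overlap_step_of_S hqp h0 h1 h2 h3
      (by omega) s1' (by omega) (by omega) (by omega) (by omega)
    · exact caseA f0 f1 f2 f3 f4
    · exact ⟨θ, key θ (fun _ _ => rfl) f1 f2 f3 f4, rfl⟩
  · rcases overlap_step_of_L hqp hpk h0 h1 h2 h3
      (by omega) (by omega) (by omega) (by omega) (by omega) (by omega)
      with ⟨f0, f1, f2, f3, f4⟩ | ⟨f0, f1, f2, f3, f4⟩
    · exact caseA f0 f1 f2 f3 f4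
    · have hm := mv_right f0
      obtain ⟨θ₁, e⟩ : ∃ θ₁, Mv i θ θ₁ := ⟨_, hm⟩
      have g1 := e.apply_self
      have g2 := e.apply_succ
      have hm' := mv_right (a := θ₁) (i := i + 1) (by omega)
      obtain ⟨θ₂, e'⟩ : ∃ θ₂, Mv (i + 1) θ₁ θ₂ := ⟨_, hm'⟩
      have g1' := e'.apply_self
      have g2' := e'.apply_succ
      rw [show i + 1 + 1 = i + 2 by ring, e.apply_of_ne (by omega) (by omega)] at g2'
      have v1 : θ₂ i = θ i - 1 := by rw [e'.apply_of_ne (by omega) (by omega)]; omega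
      have v2 : θ₂ (i + 1) = θ (i + 1) := by omega
      refine ⟨θ₂, key θ₂ (fun j hj => ?_) ?_ ?_ ?_ ?_, by rw [e'.length_eq, e.length_eq]⟩
      · rw [e'.apply_of_ne (by omega) (by omega), e.apply_of_ne (by omega) (by omega)]
      · rwa [v1]
      · rwa [v1, v2]
      · rwa [v2, g2']
      · rwa [g2']

theorem IsOverlap.iterate {p q : ℕ} {θ : Conf} (hq : 1 ≤ q) (hqp : q < p) (hpk : p ≤ k)
    (ha : a ∈ C k q) (hi : Top k q a i) (h : IsOverlap k p a θ) (t : ℕ) :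
    ∃ θ', IsOverlap k p ((RiggedConf.rightMove k q)^[t] a) θ' ∧ length θ' = length θ := by
  induction t with
  | zero => exact ⟨θ, h, rfl⟩
  | succ t ih =>
    obtain ⟨θ₁, h1, h2⟩ := ih
    obtain ⟨m1, i', -, m2⟩ := iterate_mem hq ha hi t
    obtain ⟨θ₂, h3, h4⟩ := h1.rightMove hqp hpk m1 m2
    rw [Function.iterate_succ_apply']
    exact ⟨θ₂, h3, h4.trans h2⟩

/-- A particle of weight q concentrated at r, with the preceding site empty, meets the heavy
particle only at r: the overlap there is (q + p - k)_+ and vanishes at r - 1 and from r + 1 on.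
Erasing that entry leaves an overlap of b. -/
theorem IsOverlap.of_add_single {p q : ℕ} {θ : Conf} {r : ℤ} (hqp : q < p) (hpk : p ≤ k)
    (hc : b + Finsupp.single r q ∈ C k q) (hb : ∀ n, r - 1 ≤ n → b n = 0)
    (h : IsOverlap k p (b + Finsupp.single r q) θ) :
    ∃ θ', IsOverlap k p b θ' ∧ length θ = length θ' + (q + p - k) := by
  set c := b + Finsupp.single r q
  have c1 : ∀ n, n ≠ r → c n = b n := fun n hn => by
    simp [c, hn.symm]
  have c2 : c r = q := by simp [c, hb r (by omega)]
  have S1 : ∀ n, n ≤ r - 2 → S c n = S b n := fun n hn => by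
    rw [S, S, c1 n (by omega), c1 (n + 1) (by omega)]
  have S2 : ∀ n, r + 1 ≤ n → S c n = 0 := fun n hn => by
    rw [S, c1 n (by omega), c1 (n + 1) (by omega), hb n (by omega), hb (n + 1) (by omega)]
  have S3 : ∀ n, r - 1 ≤ n → S b n = 0 := fun n hn => by
    rw [S, hb n (by omega), hb (n + 1) (by omega)]
  have S4 : S c r = q := by rw [S, c2, c1 _ (by omega), hb _ (by omega)]; rfl
  have S5 : S c (r - 1) = q := by
    rw [S, c1 (r - 1) (by omega), hb (r - 1) le_rfl, sub_add_cancel, c2, zero_add]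
  have hL := hc.2.2 (r - 1)
  rw [L_eq_add, show r - 1 - 1 = r - 2 by ring, sub_add_cancel, S4, S5] at hL
  have hS := hc.2.1
  have θ1 : ∀ n, r + 1 ≤ n → θ n = 0 := by
    intro n hn
    obtain ⟨-, h2⟩ := h n
    rw [S2 n hn] at h2
    have := hS (n - 1)
    omega
  have θ2 : θ r = q + p - k := by
    obtain ⟨⟨h1, h2⟩, h3⟩ := h r
    rw [θ1 _ le_rfl, S4] at h2 h3
    rw [S5] at h1 h3
    omega
  have θ3 : θ (r - 1) = 0 := by
    obtain ⟨⟨h1, h2⟩, h3⟩ := h (r - 1)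
    rw [sub_add_cancel, θ2, S5] at h2 h3
    rw [S5] at h1
    rw [show r - 1 - 1 = r - 2 by ring] at h3
    omega
  have hlen : θ = θ.erase r + Finsupp.single r (q + p - k) := by
    rw [← θ2, Finsupp.erase_add_single]
  refine ⟨θ.erase r, fun j => ?_, ?_⟩
  · by_cases hj : j ≤ r - 2
    · rw [← S1 j hj, ← S1 (j - 1) (by omega), Finsupp.erase_ne (by omega),
        Finsupp.erase_ne (by omega)]
      exact h j
    · have e : ∀ n, r - 1 ≤ n → θ.erase r n = 0 := fun n hn => by
        by_cases h1 : n = r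
        · rw [h1, Finsupp.erase_same]
        · rw [Finsupp.erase_ne h1]
          by_cases h2 : n = r - 1
          · rw [h2, θ3]
          · exact θ1 n (by omega)
      rw [e j (by omega), e (j + 1) (by omega), S3 j (by omega)]
      have : S b (j - 1) ≤ q := by
        by_cases h1 : r - 1 ≤ j - 1
        · rw [S3 _ h1]; omega
        · rw [← S1 _ (by omega)]; exact hS _
      exact ⟨⟨by omega, by omega⟩, Or.inl rfl⟩
  · conv_lhs => rw [hlen]
    rw [length_add, length_single]

/-- Removing a lighter particle of weight q lowers the length of the configuration by q and that of
the overlap by (q + p - k)_+, so the right side drops by exactly A_{p,q}. -/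
theorem IsOverlap.sum_A_eq {p : ℕ} (hlp : l < p) (hpk : p ≤ k) :
    ∀ a ∈ C k l, ∀ θ, IsOverlap k p a θ →
      ((iota k a).map fun q => (A k p q.1 : ℤ)).sum = 2 * length a + length θ := by
  refine C_induction (by omega) (fun θ h => ?_) ?_
  · have : θ = 0 := by
      ext j
      have := h j
      simp only [OverlapAt, S, Finsupp.zero_apply] at this ⊢
      omega
    rw [iota_zero, this]
    simp [length]
  · intro q a b σ r t hq hql hd e1 e2 ih θ h
    obtain ⟨i, hi⟩ := hd.top
    obtain ⟨θ₁, h1, h2⟩ := h.iterate hq (by omega) hpk hd.mem hi t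
    have hmem := hd.iterate_mem hq t
    rw [e1] at h1 hmem
    obtain ⟨θ₂, h3, h4⟩ := h1.of_add_single (by omega) hpk hmem e2
    rw [hd.iota_eq hq (by omega), List.map_cons, List.sum_cons, ih θ₂ h3, ← h2, h4,
      hd.length_eq hq, A, min_eq_right (by omega : q ≤ p), Nat.add_comm p q]
    push_cast
    ring

/-! ### The phase of a particle -/

/-- The sum `∑_{j < i} a_j`. -/
def below (i : ℤ) (a : Conf) : ℕ := length (a.filter (· < i))

theorem below_congr (h : ∀ j < i, a j = b j) : below i a = below i b := by
  rw [below, below]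
  congr 1
  ext n
  rw [Finsupp.filter_apply, Finsupp.filter_apply]
  split_ifs with hn
  · exact h n hn
  · rfl

theorem below_eq_length (h : ∀ j, i ≤ j → a j = 0) : below i a = length a := by
  rw [below]
  congr 1
  ext n
  rw [Finsupp.filter_apply]
  split_ifs with hn
  · rfl
  · exact (h n (by omega)).symm

theorem below_eq_zero (h : ∀ j < i, a j = 0) : below i a = 0 := by
  rw [below_congr (b := 0) h, below_eq_length (by simp)]
  exact length_eq_zero.2 rfl

theorem below_succ (i : ℤ) (a : Conf) : below (i + 1) a = below i a + a i := by
  rw [below, below, ← length_single i (a i), ← length_add]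
  congr 1
  ext n
  rw [Finsupp.add_apply, Finsupp.filter_apply, Finsupp.filter_apply, Finsupp.single_apply]
  by_cases h : n = i
  · subst h; simp
  · rw [if_neg (Ne.symm h)]
    by_cases h' : n < i
    · rw [if_pos h', if_pos (by omega), add_zero]
    · rw [if_neg h', if_neg (by omega), add_zero]

/-- The particle of weight `p` that started at energy `0` from the left of everything has
reached the position `i` after `t` moves. -/
def Phase (k p : ℕ) (a : Conf) (i : ℤ) (t : ℤ) : Prop :=
  ∃ θ : Conf, (∀ j, i ≤ j → θ j = 0) ∧ θ (i - 1) + S a i = p ∧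
    (∀ j, j ≤ i - 2 → OverlapAt k p (S a j) (S a (j - 1)) (θ j) (θ (j + 1))) ∧
    i * a i + (i + 1) * a (i + 1) + (i + 1) * θ (i - 1) = t + 2 * below i a + below (i - 1) θ

theorem phase_zero {p : ℕ} (hpk : p ≤ k) (h0 : a 0 = p) (h1 : a 1 = 0) (h : ∀ j < 0, a j = 0) :
    Phase k p a 0 0 := by
  refine ⟨0, fun _ _ => rfl, ?_, fun j hj => ?_, ?_⟩
  · simp [S, h0, h1]
  · rw [S, S, h j (by omega), h (j + 1) (by omega), h (j - 1) (by omega), sub_add_cancel,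
      h j (by omega)]
    simp [OverlapAt, hpk]
  · rw [below_eq_zero h, below_eq_zero fun _ _ => rfl]
    simp [h1]

theorem Phase.mv {p : ℕ} {t : ℤ} (h : Phase k p a i t) (hm : Mv i a b) :
    Phase k p b i (t + 1) := by
  obtain ⟨θ, h1, h2, h3, h4⟩ := h
  refine ⟨θ, h1, ?_, fun j hj => ?_, ?_⟩
  · rwa [hm.S_of_ne (by omega) (by omega)]
  · rw [hm.S_of_ne (by omega) (by omega), hm.S_of_ne (by omega) (by omega)]
    exact h3 j hj
  · rw [below_congr (b := a) fun j hj => hm.apply_of_ne (by omega) (by omega), hm.apply_succ]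
    rw [hm.apply_self] at h4
    push_cast at *
    linarith

/-- No unit moves here; only the position attributed to the particle does. The new overlap value p -
S (i + 1) is chosen to keep the weight, the recursion for the value at i - 1 comes from the sharp
inequality, and the energy balance then follows. -/
theorem Phase.advance {p : ℕ} {t : ℤ} (h : Phase k p a i t) (ha : a ∈ C k p)
    (hP : HasParticle k p a i ∨ L a (i - 1) = k + p) : Phase k p a (i + 1) t := by
  obtain ⟨θ, h1, h2, h3, h4⟩ := h
  set x := p - S a (i + 1)
  have hx : x + S a (i + 1) = p := Nat.sub_add_cancel (ha.2.1 _)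
  have e0 : ∀ j, j ≠ i → (θ + Finsupp.single i x) j = θ j := fun j hj => by
    simp [hj.symm]
  have e1 : (θ + Finsupp.single i x) i = x := by simp [h1 i le_rfl]
  refine ⟨θ + Finsupp.single i x, fun j hj => ?_, ?_, fun j hj => ?_, ?_⟩
  · rw [e0 j (by omega)]
    exact h1 j (by omega)
  · rwa [add_sub_cancel_right, e1]
  · by_cases hj' : j = i - 1
    · subst hj'
      have b1 := ha.2.1 i
      have b2 := ha.2.2 i
      have b3 := ha.2.2 (i - 1)
      rw [HasParticle] at hP
      rw [L_eq_add] at b2 b3 hP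
      rw [L_eq_add] at hP
      rw [sub_add_cancel] at b3 hP ⊢
      rw [e0 _ (by omega), e1]
      refine ⟨⟨by omega, by omega⟩, ?_⟩
      omega
    · rw [e0 j (by omega), e0 (j + 1) (by omega)]
      exact h3 j (by omega)
  · have e2 : below i θ = below (i - 1) θ + θ (i - 1) := by
      have := below_succ (i - 1) θ
      rwa [sub_add_cancel] at this
    rw [add_sub_cancel_right, e1, below_succ, show i + 1 + 1 = i + 2 by ring,
      below_congr (b := θ) fun j hj => e0 j (by omega), e2]
    rw [S] at h2 hx
    rw [show i + 1 + 1 = i + 2 by ring] at hx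
    obtain rfl : p = θ (i - 1) + (a i + a (i + 1)) := h2.symm
    have hx' : (x : ℤ) = θ (i - 1) + (a i + a (i + 1)) - (a (i + 1) + a (i + 2)) := by
      have := congrArg (Nat.cast : ℕ → ℤ) hx
      push_cast at this
      linarith
    rw [hx']
    push_cast
    linarith

theorem Phase.rightMove {p : ℕ} {t : ℤ} (hp : 1 ≤ p) (ha : a ∈ C k p) (hi : Top k p a i)
    (h : Phase k p a i t) :
    ∃ i', Top k p (rightMove k p a) i' ∧ Phase k p (rightMove k p a) i' (t + 1) := by
  have hm := hi.mv ha
  have hb := hi.mem_C ha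
  have h' := h.mv hm
  have hP : HasParticle k p (RiggedConf.rightMove k p a) i := by
    have := hi.1
    rw [Set.mem_ofPred_eq, HasParticle] at this
    rwa [HasParticle, hm.S_of_ne (by omega) (by omega),
      hm.L_of_ne (by omega) (by omega) (by omega) (by omega)]
  rcases hi.of_mv ha hp hm with h1 | h1 | ⟨h1, -, h2, -⟩
  · exact ⟨i, h1, h'⟩
  · exact ⟨_, h1, h'.advance hb (Or.inl hP)⟩
  · refine ⟨i + 2, h1, ?_⟩
    -- A double step passes i + 1, which need not be a position; the sharp L at i, one step behind,
    -- justifies the second advance.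
    have := (h'.advance hb (Or.inl hP)).advance hb (Or.inr (by rwa [add_sub_cancel_right]))
    rwa [show i + 1 + 1 = i + 2 by ring] at this

theorem Phase.iterate {p : ℕ} (hp : 1 ≤ p) (ha : a ∈ C k p) (hi : Top k p a i)
    (h : Phase k p a i 0) (t : ℕ) :
    ∃ i', Top k p ((RiggedConf.rightMove k p)^[t] a) i' ∧
      Phase k p ((RiggedConf.rightMove k p)^[t] a) i' t := by
  induction t with
  | zero => exact ⟨i, hi, h⟩
  | succ t ih =>
    obtain ⟨i', h1, h2⟩ := ih
    rw [Function.iterate_succ_apply']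
    exact_mod_cast h2.rightMove hp (iterate_mem hp ha hi t).1 h1

/-- Once the particle has passed all of b, the sums below its position have become full lengths and
its own overlap is zero. Comparing its energy with σ + T gives σ. -/
theorem Detach.eq_of_phase (h : Detach k l a b σ) (hl : 1 ≤ l) (hlk : l ≤ k)
    (hi : Top k l a i) (hph : Phase k l a i 0) :
    ∃ θ, IsOverlap k l b θ ∧ σ = 2 * length b + length θ := by
  obtain ⟨T, hT⟩ := h.eventually hl hlk 0
  obtain ⟨e1, -, e3⟩ := hT T le_rfl
  obtain ⟨i', h1, h2⟩ := hph.iterate hl h.mem hi T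
  rw [e1] at h1 h2
  obtain rfl : i' = (σ + T) / (l : ℤ) :=
    IsGreatest.unique h1 (top_free hl hlk fun n hn => e3 n (by omega))
  obtain ⟨c, f1, f2, f3, f4, f5, f6⟩ := freeParticle_spec hl (σ + T)
  set q := (σ + T) / (l : ℤ)
  obtain ⟨θ, g1, g2, g3, g4⟩ := h2
  have v0 : (b + freeParticle l (σ + T)) q = c := by
    rw [Finsupp.add_apply, e3 q (by omega), f4, zero_add]
  have v1 : (b + freeParticle l (σ + T)) (q + 1) = l - c := by
    rw [Finsupp.add_apply, e3 (q + 1) (by omega), f5, zero_add]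
  have v2 : ∀ j < q, (b + freeParticle l (σ + T)) j = b j := fun j hj => by
    rw [Finsupp.add_apply, f6 j (by omega) (by omega), add_zero]
  have g2' : θ (q - 1) = 0 := by rw [S, v0, v1] at g2; omega
  have g1' : ∀ j, q - 1 ≤ j → θ j = 0 := fun j hj => by
    by_cases h : j = q - 1
    · rw [h, g2']
    · exact g1 j (by omega)
  refine ⟨θ, fun j => ?_, ?_⟩
  · by_cases hj : j ≤ q - 2
    · have := g3 j hj
      rwa [S, S, v2 j (by omega), v2 (j + 1) (by omega), v2 (j - 1) (by omega),
        v2 (j - 1 + 1) (by omega)] at this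
    · rw [g1' j (by omega), g1' (j + 1) (by omega), S, S, e3 j (by omega), e3 (j + 1) (by omega),
        e3 (j - 1) (by omega), e3 (j - 1 + 1) (by omega)]
      simp [OverlapAt, hlk]
  · rw [v0, v1, g2', below_congr v2, below_eq_length fun j hj => e3 j (by omega),
      below_eq_length fun j hj => g1' j hj] at g4
    rw [Nat.cast_sub f2] at g4
    have : q * l + (l - c : ℤ) = q * c + (q + 1) * (l - c) := by ring
    push_cast at g4
    linarith

/-! ### Non-negative support -/

/-- The configuration is supported on the non-negative sites. -/
def NonnegSupp (a : Conf) : Prop := ∀ i < 0, a i = 0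

theorem NonnegSupp.mv (h : NonnegSupp a) (hm : Mv i a b) : NonnegSupp b := by
  intro n hn
  have h1 := hm.apply_self
  have h2 : 0 ≤ i := by
    by_contra hlt
    have := h i (by omega)
    omega
  rw [hm.apply_of_ne (by omega) (by omega)]
  exact h n hn

theorem NonnegSupp.iterate (hl : 1 ≤ l) (ha : a ∈ C k l) (hi : Top k l a i) (h : NonnegSupp a)
    (t : ℕ) : NonnegSupp ((rightMove k l)^[t] a) := by
  induction t with
  | zero => exact h
  | succ t ih =>
    obtain ⟨m1, i', -, m2⟩ := iterate_mem hl ha hi t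
    rw [Function.iterate_succ_apply']
    exact ih.mv (m2.mv m1)

/-- The shifted energy of the particle that is just about to enter the non-negative sites. -/
theorem Detach.eq_of_enters (h : Detach k l a b σ) (hl : 1 ≤ l) (hlk : l ≤ k)
    (h0 : ¬ NonnegSupp a) (h1 : NonnegSupp (RiggedConf.rightMove k l a)) :
    σ + 1 = ((iota k b).map fun q => (A k l q.1 : ℤ)).sum := by
  have ha := h.mem
  obtain ⟨i, hi⟩ := h.top
  have hm := hi.mv ha
  have hb := hi.mem_C ha
  have hd := h.rightMove hl hlk
  have hr := hi.readyR ha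
  have hof := hi.of_mv ha hl hm
  set c := RiggedConf.rightMove k l a
  have m1 := hm.apply_self
  have m2 := hm.apply_succ
  have hi0 : -1 ≤ i := by
    by_contra hlt
    have := h1 (i + 1) (by omega)
    omega
  obtain rfl : i = -1 := by
    by_contra hne
    refine h0 fun n hn => ?_
    rw [← hm.apply_of_ne (by omega) (by omega)]
    exact h1 n hn
  rw [show (-1 : ℤ) + 1 = 0 by ring] at m2
  have c1 : c (-1) = 0 := h1 _ (by omega)
  have c2 : c (-2) = 0 := h1 _ (by omega)
  have a2 : a (-2) = 0 := by rw [← hm.apply_of_ne (by omega) (by omega)]; exact c2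
  have c3 : c 1 = a 1 := hm.apply_of_ne (by omega) (by omega)
  have hP : S a (-1) = l ∨ L a (-1) = k + l := hr.hasParticle
  have hS := ha.2.1 (-1)
  have hS' := hr.S_succ
  have ht := ha.1 (-1)
  simp only [S, L] at hP hS hS' ht
  norm_num at hP hS hS' ht
  rw [a2] at hP
  -- The unit that enters came from the site -1. If S is sharp at -1, the entry at 0 becomes l. If L
  -- is, then the triple and S bounds at -1 are both sharp, with the same result.
  have c0 : c 0 = l := by omega
  have c4 : c 1 = 0 := by omega
  have hS0 : S c 0 = l := by rw [S, zero_add, c0, c4, add_zero]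
  have hSm : S c (-1) = l := by rw [S, show (-1 : ℤ) + 1 = 0 by ring, c0, c1, zero_add]
  have htop : Top k l c 0 := by
    rcases hof with h | h | h
    · have := h.2 (show HasParticle k l c 0 from Or.inl hS0)
      omega
    · exact h
    · have := h.2.1
      omega
  -- The single particle of weight l is counted from the left at -1, where S is sharp as well, and
  -- seen from the right at 0. Hence the remainder contains lighter particles only.
  have hnum : Num k l c 1 := by
    refine ⟨-2, [-1], fun n hn => h1 n (by omega), ⟨⟨Or.inl ⟨by omega, hSm⟩, ?_⟩, ?_⟩, rfl⟩
    · intro j hj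
      rcases hj with ⟨h2, h3⟩ | ⟨h2, -⟩
      · by_contra hlt
        obtain rfl : j = -2 := by omega
        rw [S, c2, show (-2 : ℤ) + 1 = -1 by ring, c1] at h3
        omega
      · omega
    · change PL k l c (-1 + 2) = ∅
      ext j
      simp only [Set.mem_empty_iff_false, iff_false]
      intro hj
      have h2 := le_of_mem_PL hj
      have h3 := htop.2 (hasParticle_of_mem_PL hj)
      omega
  obtain ⟨m, hn⟩ := exists_num (k := k) hl b
  obtain rfl : m = 0 := by
    have := (hd.num hl hlk hn).unique hnum hb hl
    omega
  have hbC := h.mem_left hl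
  have hbC' : b ∈ C k (l - 1) := by
    have hne := (num_zero_iff hbC hl).1 hn
    refine ⟨hbC.1, fun j => ?_, fun j => ?_⟩ <;>
    · have := hne j
      have := hbC.2.1 j; have := hbC.2.2 j
      rw [HasParticle] at *
      omega
  obtain ⟨θ, e1, e2⟩ := hd.eq_of_phase hl hlk htop (phase_zero hlk c0 c4 h1)
  rw [e2, IsOverlap.sum_A_eq (l := l - 1) (by omega) hlk b hbC' θ e1]

/-- Otherwise move right until the support first becomes non-negative. That takes at least one move,
and `Detach.eq_of_enters` at the last of them puts σ below the sum. -/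
theorem Detach.nonnegSupp_of_le (h : Detach k l a b σ) (hl : 1 ≤ l) (hlk : l ≤ k)
    (hb : NonnegSupp b) (hσ : ((iota k b).map fun q => (A k l q.1 : ℤ)).sum ≤ σ) :
    NonnegSupp a := by
  by_contra h0
  have hex : ∃ t : ℕ, NonnegSupp ((RiggedConf.rightMove k l)^[t] a) := by
    obtain ⟨T, hT⟩ := h.eventually hl hlk 0
    obtain ⟨e1, e2, -⟩ := hT T le_rfl
    refine ⟨T, fun n hn => ?_⟩
    obtain ⟨c, -, -, -, -, -, f6⟩ := freeParticle_spec hl (σ + T)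
    rw [e1, Finsupp.add_apply, hb n hn, f6 n (by omega) (by omega)]
  classical
  obtain ⟨u, hu⟩ := Nat.exists_eq_succ_of_ne_zero
    (show Nat.find hex ≠ 0 from fun h1 => h0 (by simpa [h1] using Nat.find_spec hex))
  have h1 := Nat.find_spec hex
  have h2 := Nat.find_min hex (m := u) (by omega)
  rw [hu, Function.iterate_succ_apply'] at h1
  have := (h.iterate hl hlk u).eq_of_enters hl hlk h2 h1
  omega

/-- With no other particle of weight l, a left sweep is the inverse of the right move. Sweep until
the support first becomes negative, which must happen because energy drops by one each time, and
apply `Detach.eq_of_enters` there. -/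
theorem Detach.le_of_nonnegSupp (h : Detach k l a b σ) (hl : 1 ≤ l) (hlk : l ≤ k)
    (ha : NonnegSupp a) (hb : Num k l b 0) :
    ((iota k b).map fun q => (A k l q.1 : ℤ)).sum ≤ σ := by
  have hsw : ∀ u : ℕ, Detach k l ((leftSweep k l 1)^[u] a) b (σ - u) := fun u => by
    have := (h.iterate_sweep hl hlk hb u).1
    have e : leftSweep k l 0 = id := rfl
    rwa [e, Function.iterate_id] at this
  have hmove : ∀ u : ℕ,
      RiggedConf.rightMove k l ((leftSweep k l 1)^[u + 1] a) = (leftSweep k l 1)^[u] a := by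
    intro u
    refine ((hsw (u + 1)).rightMove hl hlk).inj ?_ hl hlk
    convert hsw u using 1
    push_cast; ring
  have hen : ∀ u : ℕ, energy ((leftSweep k l 1)^[u] a) = energy a - u := by
    intro u
    induction u with
    | zero => simp
    | succ u ih =>
      obtain ⟨i, hi⟩ := (hsw (u + 1)).top
      have := (hi.mv (hsw (u + 1)).mem).energy_eq
      rw [hmove, ih] at this
      push_cast
      linarith
  have hex : ∃ u : ℕ, ¬ NonnegSupp ((leftSweep k l 1)^[u] a) := by
    refine ⟨(energy a + 1).toNat, fun h => ?_⟩
    have h1 := energy_nonneg h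
    rw [hen] at h1
    have := Int.self_le_toNat (energy a + 1)
    omega
  classical
  obtain ⟨u, hu⟩ := Nat.exists_eq_succ_of_ne_zero
    (show Nat.find hex ≠ 0 from fun h1 => Nat.find_spec hex (by simpa [h1] using ha))
  have h1 := Nat.find_spec hex
  have h2 := Nat.find_min hex (m := u) (by omega)
  rw [not_not, ← hmove u] at h2
  rw [hu] at h1
  have := (hsw (u + 1)).eq_of_enters hl hlk h1 h2
  push_cast at this
  omega

/-- Right moves preserve non-negative support, so it passes to the remainder. If the remainder has
another particle of the same weight, the ordering of the riggings reduces the sign of the first one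
to that of the next; otherwise the entering energy decides. -/
theorem nonnegSupp_iff (hlk : l ≤ k) : ∀ a ∈ C k l, NonnegSupp a ↔ ∀ p ∈ iota k a, 0 ≤ p.2 := by
  refine C_induction hlk (by simp [iota_zero, NonnegSupp]) ?_
  intro p a b σ r t hp hpl h _ _ ih
  have hpk := hpl.trans hlk
  have hb := h.mem_left hp
  rw [h.iota_eq hp hpk, List.forall_mem_cons, ← ih]
  constructor
  · intro ha
    have hbs : NonnegSupp b := fun n hn => by
      obtain ⟨t, ht, -⟩ := h.eq
      obtain ⟨i, hi⟩ := h.top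
      have := ha.iterate hp h.mem hi t n hn
      rw [ht, Finsupp.add_apply] at this
      omega
    refine ⟨?_, hbs⟩
    by_cases hn : ∀ j, ¬ HasParticle k p b j
    · have := h.le_of_nonnegSupp hp hpk ha ((num_zero_iff hb hp).2 hn)
      simpa using this
    · push Not at hn
      obtain ⟨j, hj⟩ := hn
      obtain ⟨i, hi⟩ := exists_top hp hj
      have hd := detach_removed hp hpk hb hi
      have h1 := h.add_A_le hd hp hpk
      have h2 := ih.1 hbs
      rw [hd.iota_eq hp hpk] at h2 ⊢
      have h3 := h2 _ List.mem_cons_self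
      simp only [List.map_cons, List.sum_cons] at h3 ⊢
      omega
  · rintro ⟨h1, h2⟩
    exact h.nonnegSupp_of_le hp hpk h2 (by simpa using h1)

/-! ### The bijections -/

theorem iota_mapsTo (hlk : l ≤ k) : Set.MapsTo (iota k) (CPos k l) (RPos l) := fun a ha =>
  ⟨iota_mem_R hlk a ha.1 l ha.1, (nonnegSupp_iff hlk a ha.1).1 ha.2⟩

theorem kappa_mapsTo (hlk : l ≤ k) : Set.MapsTo (kappa k l) (RPos l) (CPos k l) := fun r hr => by
  obtain ⟨h1, h2⟩ := kappa_spec hlk hr.1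
  refine ⟨h1, (nonnegSupp_iff hlk _ h1).2 ?_⟩
  rw [h2]
  exact hr.2

theorem kappa_invOn (hlk : l ≤ k) : Set.InvOn (kappa k l) (iota k) (CPos k l) (RPos l) := by
  refine ⟨fun a ha => ?_, fun r hr => (kappa_spec hlk hr.1).2⟩
  obtain ⟨h1, h2⟩ := kappa_spec hlk (iota_mem_R hlk a ha.1 l ha.1)
  exact iota_injOn hlk h1 ha.1 h2

end RiggedConf

theorem mainTheorem1 (k l : ℕ) (hl : l ≤ k) :
    Set.BijOn (RiggedConf.iota k) (RiggedConf.CPos k l) (RiggedConf.RPos l) ∧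
    Set.BijOn (RiggedConf.kappa k l) (RiggedConf.RPos l) (RiggedConf.CPos k l) ∧
    Set.InvOn (RiggedConf.kappa k l) (RiggedConf.iota k)
      (RiggedConf.CPos k l) (RiggedConf.RPos l) := by
  have h := RiggedConf.kappa_invOn hl
  exact ⟨h.bijOn (RiggedConf.iota_mapsTo hl) (RiggedConf.kappa_mapsTo hl),
    h.symm.bijOn (RiggedConf.kappa_mapsTo hl) (RiggedConf.iota_mapsTo hl), h⟩
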